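/- Let $\mathbf k$ be a field of characteristic $0$ and $(V,\sigma)$ a braided vector space over $\mathbf k$: $\sigma\in\mathrm{End}(V\otimes V)$ (not assumed invertible) satisfies $\sigma_1\sigma_2\sigma_1=\sigma_2\sigma_1\sigma_2$ on $V^{\otimes 3}$, where $\sigma_i$ is $\sigma$ acting on the tensor factors $i,i+1$. For $w\in\mathfrak S_n$ put $T^\sigma_w=\sigma_{i_1}\cdots\sigma_{i_l}$ for a reduced expression $w=s_{i_1}\cdots s_{i_l}$, and let $\beta_{mn}=T^\sigma_{\chi_{mn}}:V^{\otimes m}\otimes V^{\otimes n}\to V^{\otimes n}\otimes V^{\otimes m}$, where $\chi_{mn}(a)=a+n$ for $a\le m$ and $\chi_{mn}(a)=a-m$ for $a>m$. *Binary trees.* Let $\mathcal B_n$ be the set of planar binary trees with $n$ internal vertices, ordered from left to right (for $Y\vee Y'$: the vertices of $Y$, the root, the vertices of $Y'$), and let $\mathcal Y(V)=\bigoplus_n\mathbf k\mathcal B_n\otimes V^{\otimes n}$, with $Y\otimes(v_1\otimes\cdots\otimes v_n)$ written $Y(v_1,\dots,v_n)$. Let $|$ be the tree without internal vertex, and let $Y\vee_vY'$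 be the tree with root decorated by $v$ and left and right subtrees $Y,Y'$. Equip $\mathcal Y(V)$ with the grading by $n$; the product $*_\sigma$ with unit $|$ given by $Y*_\sigma Y'=Y_1\vee_u(Y_2*_\sigma Y')+(Y*_\sigma Y_1')\vee_vY_2'$ for $Y=Y_1\vee_uY_2$, $Y'=Y'_1\vee_vY'_2$; the braiding $\sigma_{BT}(Y(v_1,\dots,v_m)\otimes Y'(v_{m+1},\dots,v_{m+n}))=(Y'\otimes Y)\beta_{mn}(v_1\otimes\cdots\otimes v_{m+n})$; the counit $\varepsilon'_{BT}(Y)=\delta_{Y,|}$; and the coproduct given by $\Delta'_{BT}(|)=|\otimes|$ and $\Delta'_{BT}(Y\vee_vY')=(Y\vee_vY')\otimes|+(*_\sigma\otimes\vee)(\sigma_{BT})_2(\sigma_{V,\mathcal Y(V)})_3(\Delta'_{BT}(Y)\otimes v\otimes\Delta'_{BT}(Y'))$, where $\sigma_{V,\mathcal Y(V)}(v\otimes Y(v_1,\dots,v_n))=(Y\otimes\mathrm{id}_V)\beta_{1n}(v\otimes v_1\otimes\cdots\otimes v_n)$. *Rooted forests.* Let $\mathcal F_n$ be the set of planar rooted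 forests with $n$ vertices, ordered in preorder (depth first, from left to right), and let $\mathcal R(V)=\bigoplus_n\mathbf k\mathcal F_n\otimes V^{\otimes n}$, with the analogous notation $F(v_1,\dots,v_n)$. Let $B^+_v(F)$ be the tree obtained by grafting the forest $F$ on a new root decorated by $v$. Equip $\mathcal R(V)$ with the grading by $n$; the concatenation product, with unit the empty forest $\emptyset=1$; the braiding $\sigma_{RT}(F(v_1,\dots,v_m)\otimes G(v_{m+1},\dots,v_{m+n}))=(G\otimes F)\beta_{mn}(v_1\otimes\cdots\otimes v_{m+n})$; the counit $\varepsilon'_{RT}(F)=\delta_{F,\emptyset}$; and the coproduct $\Delta'_{RT}$ determined by $\Delta'_{RT}(1)=1\otimes1$, by $\Delta'_{RT}(T\cdot F)=(\mu\otimes\mu)(\sigma_{RT})_2(\Delta'_{RT}(T)\otimes\Delta'_{RT}(F))$ for a tree $T$ and a forest $F$ ($\mu$ denoting concatenation), and, for a tree $T(v_1,\dots,v_n)$, by $$\Delta'_{RT}(T(v_1,\dots,v_n))=\sum_P(P\otimes T/P)\,T^\sigma_{w_P^{-1}}(v_1\otimes\cdots\otimes v_n).$$ Here $P$ runs over the subforests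 of $T$, i.e. the sets of vertices closed under passing to descendants (including $\emptyset$ and $T$), $T/P$ is what remains of $T$ after removing $P$, and $w_P\in\mathfrak S_n$ is the permutation such that, with $d$ the number of vertices of $P$, $w_P(1)<\cdots<w_P(d)$ are the vertices of $P$ and $w_P(d+1)<\cdots<w_P(n)$ are the others. **Theorem.** $\mathcal Y(V)$ and $\mathcal R(V)$, with these structures, are graded braided Hopf algebras. There is a unique homomorphism of unital algebras $\Theta_\sigma:\mathcal Y(V)\to\mathcal R(V)$ with $\Theta_\sigma(|\vee_vY)=B^+_v(\Theta_\sigma(Y))$ for all $v\in V$ and $Y\in\mathcal Y(V)$, and $\Theta_\sigma$ is an isomorphism of graded braided Hopf algebras: it is bijective, and it respects the gradings, products, units, coproducts, counits, antipodes and braidings. -/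

import Mathlib

open scoped TensorProduct DirectSum

namespace BraidedTrees

noncomputable section

/-! ### Braided Hopf algebras -/

section Braided

variable {k : Type*} [CommRing k]

/-- `σ : A ⊗ B → C ⊗ D` applied to the first two factors of `A ⊗ B ⊗ E`. -/
def onFirst {A B C D : Type*} (E : Type*) [AddCommGroup A] [Module k A] [AddCommGroup B] [Module k B]
    [AddCommGroup C] [Module k C] [AddCommGroup D] [Module k D] [AddCommGroup E] [Module k E]
    (f : A ⊗[k] B →ₗ[k] C ⊗[k] D) : A ⊗[k] (B ⊗[k] E) →ₗ[k] C ⊗[k] (D ⊗[k] E) :=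
  (TensorProduct.assoc k C D E).toLinearMap ∘ₗ f.rTensor E ∘ₗ
    (TensorProduct.assoc k A B E).symm.toLinearMap

/-- `f : B ⊗ C → D ⊗ E` applied to the two middle factors of `(A ⊗ B) ⊗ (C ⊗ F)`. -/
def onMiddle (A : Type*) {B C D E : Type*} (F : Type*) [AddCommGroup A] [Module k A]
    [AddCommGroup B] [Module k B] [AddCommGroup C] [Module k C] [AddCommGroup D] [Module k D]
    [AddCommGroup E] [Module k E] [AddCommGroup F] [Module k F]
    (f : B ⊗[k] C →ₗ[k] D ⊗[k] E) :
    (A ⊗[k] B) ⊗[k] (C ⊗[k] F) →ₗ[k] (A ⊗[k] D) ⊗[k] (E ⊗[k] F) :=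
  (TensorProduct.assoc k A D (E ⊗[k] F)).symm.toLinearMap ∘ₗ (onFirst F f).lTensor A ∘ₗ
    (TensorProduct.assoc k A B (C ⊗[k] F)).toLinearMap

/-- A braiding: a (not necessarily invertible) endomorphism of `V ⊗ V` with
`σ₁ σ₂ σ₁ = σ₂ σ₁ σ₂` on `V ⊗ V ⊗ V`. -/
def IsBraiding {V : Type*} [AddCommGroup V] [Module k V] (σ : V ⊗[k] V →ₗ[k] V ⊗[k] V) : Prop :=
  onFirst V σ ∘ₗ σ.lTensor V ∘ₗ onFirst V σ = σ.lTensor V ∘ₗ onFirst V σ ∘ₗ σ.lTensor V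

/-- The structure maps of a graded braided bialgebra. The axioms are in
`IsGradedBraidedHopf`. -/
structure BraidedData (k : Type*) [CommRing k] (H : Type*) [AddCommGroup H] [Module k H] where
  mul : H ⊗[k] H →ₗ[k] H
  one : H
  comul : H →ₗ[k] H ⊗[k] H
  counit : H →ₗ[k] k
  braiding : H ⊗[k] H →ₗ[k] H ⊗[k] H
  grading : ℕ → Submodule k H

variable {H H' : Type*} [AddCommGroup H] [Module k H] [AddCommGroup H'] [Module k H']

/-- Unital braided algebra. -/
structure IsBraidedAlgebra (D : BraidedData k H) : Prop where
  braid : IsBraiding D.braiding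
  mul_assoc : D.mul ∘ₗ D.mul.rTensor H =
    D.mul ∘ₗ D.mul.lTensor H ∘ₗ (TensorProduct.assoc k H H H).toLinearMap
  one_mul : ∀ a, D.mul (D.one ⊗ₜ a) = a
  mul_one : ∀ a, D.mul (a ⊗ₜ D.one) = a
  braiding_mul_right : D.braiding ∘ₗ D.mul.lTensor H =
    D.mul.rTensor H ∘ₗ (TensorProduct.assoc k H H H).symm.toLinearMap ∘ₗ
      D.braiding.lTensor H ∘ₗ onFirst H D.braiding
  braiding_mul_left :
    D.braiding ∘ₗ D.mul.rTensor H ∘ₗ (TensorProduct.assoc k H H H).symm.toLinearMap =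
      D.mul.lTensor H ∘ₗ onFirst H D.braiding ∘ₗ D.braiding.lTensor H
  braiding_one_right : ∀ a, D.braiding (a ⊗ₜ D.one) = D.one ⊗ₜ a
  braiding_one_left : ∀ a, D.braiding (D.one ⊗ₜ a) = a ⊗ₜ D.one

/-- Braided coalgebra. -/
structure IsBraidedCoalgebra (D : BraidedData k H) : Prop where
  braid : IsBraiding D.braiding
  coassoc : (TensorProduct.assoc k H H H).toLinearMap ∘ₗ D.comul.rTensor H ∘ₗ D.comul =
    D.comul.lTensor H ∘ₗ D.comul
  counit_left : ∀ a, TensorProduct.lid k H (D.counit.rTensor H (D.comul a)) = a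
  counit_right : ∀ a, TensorProduct.rid k H (D.counit.lTensor H (D.comul a)) = a
  comul_left_braiding :
    onFirst H D.braiding ∘ₗ D.braiding.lTensor H ∘ₗ
      (TensorProduct.assoc k H H H).toLinearMap ∘ₗ D.comul.rTensor H =
    D.comul.lTensor H ∘ₗ D.braiding
  comul_right_braiding :
    D.braiding.lTensor H ∘ₗ onFirst H D.braiding ∘ₗ D.comul.lTensor H =
    (TensorProduct.assoc k H H H).toLinearMap ∘ₗ D.comul.rTensor H ∘ₗ D.braiding
  counit_left_braiding : ∀ a b,
    TensorProduct.lid k H (D.counit.rTensor H (D.braiding (a ⊗ₜ b))) = D.counit b • a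
  counit_right_braiding : ∀ a b,
    TensorProduct.rid k H (D.counit.lTensor H (D.braiding (a ⊗ₜ b))) = D.counit a • b

/-- Braided bialgebra: `Δ μ = (μ ⊗ μ) σ₂ (Δ ⊗ Δ)`, with unital coproduct and multiplicative
unital counit. -/
structure IsBraidedBialgebra (D : BraidedData k H) : Prop
    extends IsBraidedAlgebra D, IsBraidedCoalgebra D where
  comul_mul : D.comul ∘ₗ D.mul =
    TensorProduct.map D.mul D.mul ∘ₗ onMiddle H H D.braiding ∘ₗ
      TensorProduct.map D.comul D.comul
  comul_one : D.comul D.one = D.one ⊗ₜ D.one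
  counit_mul : ∀ a b, D.counit (D.mul (a ⊗ₜ b)) = D.counit a * D.counit b
  counit_one : D.counit D.one = 1

/-- `S` is an antipode: `μ (S ⊗ id) Δ = ε 1 = μ (id ⊗ S) Δ`. -/
def IsAntipode (D : BraidedData k H) (S : H →ₗ[k] H) : Prop :=
  (∀ a, D.mul (S.rTensor H (D.comul a)) = D.counit a • D.one) ∧
    ∀ a, D.mul (S.lTensor H (D.comul a)) = D.counit a • D.one

/-- The image of `p ⊗ q` in `H ⊗ H`. -/
def tensorSub (p q : Submodule k H) : Submodule k (H ⊗[k] H) :=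
  LinearMap.range (TensorProduct.mapIncl p q)

/-- Graded braided Hopf algebra: a braided bialgebra with an antipode, graded by `ℕ` in such a way
that all structure maps are homogeneous of degree `0`. -/
structure IsGradedBraidedHopf (D : BraidedData k H) : Prop extends IsBraidedBialgebra D where
  antipode : ∃ S : H →ₗ[k] H, IsAntipode D S ∧
    ∀ n, (D.grading n).map S ≤ D.grading n
  isInternal : DirectSum.IsInternal D.grading
  mul_graded : ∀ m n, (tensorSub (D.grading m) (D.grading n)).map D.mul ≤ D.grading (m + n)
  one_graded : D.one ∈ D.grading 0
  comul_graded : ∀ n, (D.grading n).map D.comul ≤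
    ⨆ p ∈ Finset.HasAntidiagonal.antidiagonal n, tensorSub (D.grading p.1) (D.grading p.2)
  counit_graded : ∀ n, n ≠ 0 → D.grading n ≤ LinearMap.ker D.counit
  braiding_graded : ∀ m n, (tensorSub (D.grading m) (D.grading n)).map D.braiding ≤
    tensorSub (D.grading n) (D.grading m)

/-- Homomorphism of unital algebras. -/
structure IsAlgHom (D : BraidedData k H) (D' : BraidedData k H') (f : H →ₗ[k] H') : Prop where
  map_one : f D.one = D'.one
  map_mul : f ∘ₗ D.mul = D'.mul ∘ₗ TensorProduct.map f f

/-- Isomorphism of graded braided Hopf algebras: a linear bijection that respects all the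
structure. -/
structure IsGradedBraidedHopfIso (D : BraidedData k H) (D' : BraidedData k H')
    (f : H →ₗ[k] H') : Prop extends IsAlgHom D D' f where
  bijective : Function.Bijective f
  map_comul : D'.comul ∘ₗ f = TensorProduct.map f f ∘ₗ D.comul
  map_counit : D'.counit ∘ₗ f = D.counit
  map_braiding : TensorProduct.map f f ∘ₗ D.braiding = D'.braiding ∘ₗ TensorProduct.map f f
  map_grading : ∀ n, (D.grading n).map f = D'.grading n
  map_antipode : ∀ S S', IsAntipode D S → IsAntipode D' S' → f ∘ₗ S = S' ∘ₗ f

end Braided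

/-! ### Lifting permutations to operators on tensor powers -/

section Lift

variable {k V : Type*} [Field k] [AddCommGroup V] [Module k V]

variable (k V) in
/-- `V ⊗ V^{⊗ n} ≃ V^{⊗ (n+1)}`, `v ⊗ (v₁ ⊗ ⋯ ⊗ vₙ) ↦ v ⊗ v₁ ⊗ ⋯ ⊗ vₙ`. -/
def consEquiv (n : ℕ) : V ⊗[k] (⨂[k]^n V) ≃ₗ[k] ⨂[k]^(n + 1) V :=
  TensorProduct.congr
      (PiTensorProduct.subsingletonEquiv (R := k) (s := fun _ : Fin 1 => V) 0).symm
      (LinearEquiv.refl k (⨂[k]^n V)) ≪≫ₗ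
    TensorPower.mulEquiv ≪≫ₗ TensorPower.cast k V (Nat.add_comm 1 n)

/-- `σ` applied to the tensor factors with (zero-based) numbers `i` and `i + 1` of `V^{⊗ n}`
(the identity in the irrelevant case `n ≤ i + 1`). -/
def sigmaAt (σ : V ⊗[k] V →ₗ[k] V ⊗[k] V) : (n i : ℕ) → (⨂[k]^n V →ₗ[k] ⨂[k]^n V)
  | 0, _ => LinearMap.id
  | 1, _ => LinearMap.id
  | n + 2, 0 =>
    let e : V ⊗[k] (V ⊗[k] (⨂[k]^n V)) ≃ₗ[k] ⨂[k]^(n + 2) V :=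
      TensorProduct.congr (LinearEquiv.refl k V) (consEquiv k V n) ≪≫ₗ consEquiv k V (n + 1)
    e.toLinearMap ∘ₗ onFirst _ σ ∘ₗ e.symm.toLinearMap
  | n + 2, i + 1 =>
    (consEquiv k V (n + 1)).toLinearMap ∘ₗ (sigmaAt σ (n + 1) i).lTensor V ∘ₗ
      (consEquiv k V (n + 1)).symm.toLinearMap

/-- The permutation of `{0, …, n-1}` obtained from `w` by deleting `0` from the domain and `w 0`
from the codomain and renumbering in increasing order. -/
def deleteZero {n : ℕ} (w : Equiv.Perm (Fin (n + 1))) : Equiv.Perm (Fin n) :=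
  (finSuccAboveEquiv 0).trans
    ((w.subtypeEquiv fun _ => (w.injective.ne_iff (y := 0)).symm).trans (finSuccAboveEquiv (w 0)).symm)

/-- A reduced expression `w = s_{i₁} ⋯ s_{i_l}` of a permutation in the adjacent transpositions
`s_i = (i, i+1)` (zero-based): if `w 0 = j`, then `w = s_{j-1} ⋯ s_1 s_0 · (1 × w')` with
`w' = deleteZero w`. Its length is the number of inversions of `w`. -/
def reducedWord : {n : ℕ} → Equiv.Perm (Fin n) → List ℕ
  | 0, _ => []
  | _ + 1, w => (List.range (w 0)).reverse ++ (reducedWord (deleteZero w)).map (· + 1)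

/-- The lift `T^σ_w = σ_{i₁} ∘ ⋯ ∘ σ_{i_l}` of `w = s_{i₁} ⋯ s_{i_l}` (reduced). For the flip
it is `v₁ ⊗ ⋯ ⊗ vₙ ↦ v_{w⁻¹(1)} ⊗ ⋯ ⊗ v_{w⁻¹(n)}`. -/
def braidLift (σ : V ⊗[k] V →ₗ[k] V ⊗[k] V) {n : ℕ} (w : Equiv.Perm (Fin n)) :
    ⨂[k]^n V →ₗ[k] ⨂[k]^n V :=
  ((reducedWord w).map (sigmaAt σ n)).foldr (fun f g => f ∘ₗ g) LinearMap.id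

/-- The block permutation `χ_{m,n}`, which moves the first `m` letters behind the last `n`. -/
def chi (m n : ℕ) : Equiv.Perm (Fin (m + n)) :=
  finAddFlip.trans (finCongr (Nat.add_comm n m))

/-- `β_{m,n} : V^{⊗ m} ⊗ V^{⊗ n} → V^{⊗ n} ⊗ V^{⊗ m}`, given by `T^σ_{χ_{m,n}}`. -/
def beta (σ : V ⊗[k] V →ₗ[k] V ⊗[k] V) (m n : ℕ) :
    (⨂[k]^m V) ⊗[k] (⨂[k]^n V) →ₗ[k] (⨂[k]^n V) ⊗[k] (⨂[k]^m V) :=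
  (TensorPower.mulEquiv.symm : ⨂[k]^(n + m) V ≃ₗ[k] _).toLinearMap ∘ₗ
    (TensorPower.cast k V (Nat.add_comm m n)).toLinearMap ∘ₗ
      braidLift σ (chi m n) ∘ₗ TensorPower.mulEquiv.toLinearMap

end Lift

/-! ### Shapes with decorations in `V` -/

section Decorated

variable (k V : Type*) [Field k] [AddCommGroup V] [Module k V]
  {S : Type*} [DecidableEq S] (deg : S → ℕ)

/-- For a set `S` of shapes with a degree function, the space `⨁_{s ∈ S} V^{⊗ deg s}`, that is,
`⨁ₙ k Sₙ ⊗ V^{⊗ n}` with `Sₙ` the set of shapes of degree `n`. -/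
abbrev Decorated : Type _ := ⨁ s : S, ⨂[k]^(deg s) V

/-- A shape `s` of degree `n`, as the linear map `v₁ ⊗ ⋯ ⊗ vₙ ↦ s(v₁, …, vₙ)`. -/
def decorate (s : S) {n : ℕ} (h : deg s = n) : ⨂[k]^n V →ₗ[k] Decorated k V deg :=
  DirectSum.lof k S (fun s => ⨂[k]^(deg s) V) s ∘ₗ (TensorPower.cast k V h.symm).toLinearMap

/-- The homogeneous component of degree `n`. -/
def degreePart (n : ℕ) : Submodule k (Decorated k V deg) :=
  ⨆ s : {s : S // deg s = n}, LinearMap.range (decorate k V deg s.1 s.2)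

variable {k V}

/-- The braiding `s(v₁, …, v_m) ⊗ t(v_{m+1}, …, v_{m+n}) ↦ (t ⊗ s) β_{m,n}(v₁ ⊗ ⋯ ⊗ v_{m+n})`. -/
def decBraiding (σ : V ⊗[k] V →ₗ[k] V ⊗[k] V) :
    Decorated k V deg ⊗[k] Decorated k V deg →ₗ[k] Decorated k V deg ⊗[k] Decorated k V deg :=
  TensorProduct.lift <| DirectSum.toModule k S _ fun s => LinearMap.flip <|
    DirectSum.toModule k S _ fun t => LinearMap.flip <| TensorProduct.curry <|
      TensorProduct.map (decorate k V deg t rfl) (decorate k V deg s rfl) ∘ₗ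
        beta σ (deg s) (deg t)

/-- The map `V ⊗ 𝒟 → 𝒟 ⊗ V`, `v ⊗ s(v₁, …, vₙ) ↦ (s ⊗ id) β_{1,n}(v ⊗ v₁ ⊗ ⋯ ⊗ vₙ)`. -/
def vecBraiding (σ : V ⊗[k] V →ₗ[k] V ⊗[k] V) :
    V ⊗[k] Decorated k V deg →ₗ[k] Decorated k V deg ⊗[k] V :=
  let e := PiTensorProduct.subsingletonEquiv (R := k) (s := fun _ : Fin 1 => V) 0
  TensorProduct.lift <| LinearMap.flip <| DirectSum.toModule k S _ fun s =>
    LinearMap.flip <| TensorProduct.curry <|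
      TensorProduct.map (decorate k V deg s rfl) e.toLinearMap ∘ₗ
        beta σ 1 (deg s) ∘ₗ e.symm.toLinearMap.rTensor (⨂[k]^(deg s) V)

/-- The linear form `s(v₁, …, vₙ) ↦ δ_{s, s₀}`, for a shape `s₀` of degree `0`. -/
def deltaForm (s₀ : S) (h : deg s₀ = 0) : Decorated k V deg →ₗ[k] k :=
  (PiTensorProduct.isEmptyEquiv (R := k) (s := fun _ : Fin 0 => V) (Fin 0)).toLinearMap ∘ₗ
    (TensorPower.cast k V h).toLinearMap ∘ₗ
      DirectSum.component k S (fun s => ⨂[k]^(deg s) V) s₀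

end Decorated

/-! ### The braided Hopf algebra of planar binary trees -/

section BinaryTrees

/-- Planar binary trees; `BinaryTree.nil` is the tree `|`, and `BinaryTree.node () l r` is
`l ∨ r`. -/
abbrev BT : Type := BinaryTree Unit

/-- The number of internal vertices. -/
def btDeg : BT → ℕ
  | .nil => 0
  | .node _ l r => btDeg l + (btDeg r + 1)

variable (k V : Type*) [Field k] [AddCommGroup V] [Module k V]

/-- `𝒴(V)`. The internal vertices of a binary tree are ordered from left to right (that of
`l ∨ r`: the vertices of `l`, the root, the vertices of `r`). -/
abbrev YSpace : Type _ := Decorated k V btDeg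

/-- The tree `|`. -/
def yOne : YSpace k V := decorate k V btDeg .nil rfl (TensorPower.algebraMap₀ 1)

/-- `V^{⊗ a} ⊗ (V ⊗ V^{⊗ b}) ≃ V^{⊗ (a+(b+1))}`. -/
def splitEquiv (a b : ℕ) :
    (⨂[k]^a V) ⊗[k] (V ⊗[k] (⨂[k]^b V)) ≃ₗ[k] ⨂[k]^(a + (b + 1)) V :=
  TensorProduct.congr (LinearEquiv.refl k _) (consEquiv k V b) ≪≫ₗ TensorPower.mulEquiv

/-- `splitEquiv`, for the decorations of a tree `l ∨ r`. -/
def nodeEquiv (a : Unit) (l r : BT) :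
    (⨂[k]^(btDeg l) V) ⊗[k] (V ⊗[k] (⨂[k]^(btDeg r) V)) ≃ₗ[k] ⨂[k]^(btDeg (.node a l r)) V :=
  splitEquiv k V (btDeg l) (btDeg r)

/-- The grafting `Y ⊗ (v ⊗ Y') ↦ Y ∨_v Y'`. -/
def vee : YSpace k V ⊗[k] (V ⊗[k] YSpace k V) →ₗ[k] YSpace k V :=
  TensorProduct.lift <| DirectSum.toModule k BT _ fun l => LinearMap.flip <|
    TensorProduct.lift <| LinearMap.flip <| DirectSum.toModule k BT _ fun r =>
      LinearMap.flip <| TensorProduct.curry <| LinearMap.flip <| TensorProduct.curry <|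
        decorate k V btDeg (.node () l r) rfl ∘ₗ (nodeEquiv k V () l r).toLinearMap

/-- The product of two trees with given shapes:
`| * Y = Y * | = Y` and `Y * Y' = Y₁ ∨_u (Y₂ * Y') + (Y * Y'₁) ∨_v Y'₂`
for `Y = Y₁ ∨_u Y₂`, `Y' = Y'₁ ∨_v Y'₂`. -/
def mulShape : (Y Y' : BT) → (⨂[k]^(btDeg Y) V) ⊗[k] (⨂[k]^(btDeg Y') V) →ₗ[k] YSpace k V
  | .nil, Y' =>
    decorate k V btDeg Y' rfl ∘ₗ (TensorProduct.lid k _).toLinearMap ∘ₗ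
      (TensorPower.algebraMap₀.symm : ⨂[k]^0 V ≃ₗ[k] k).toLinearMap.rTensor _
  | .node a Y₁ Y₂, .nil =>
    decorate k V btDeg (.node a Y₁ Y₂) rfl ∘ₗ (TensorProduct.rid k _).toLinearMap ∘ₗ
      (TensorPower.algebraMap₀.symm : ⨂[k]^0 V ≃ₗ[k] k).toLinearMap.lTensor _
  | .node a Y₁ Y₂, .node b Y₁' Y₂' =>
    vee k V ∘ₗ
        TensorProduct.map (decorate k V btDeg Y₁ rfl)
          ((mulShape Y₂ (.node b Y₁' Y₂')).lTensor V ∘ₗ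
            (TensorProduct.assoc k V _ _).toLinearMap) ∘ₗ
        (TensorProduct.assoc k _ _ _).toLinearMap ∘ₗ
        (nodeEquiv k V a Y₁ Y₂).symm.toLinearMap.rTensor
          (⨂[k]^(btDeg (.node b Y₁' Y₂')) V) +
      vee k V ∘ₗ
        TensorProduct.map (mulShape (.node a Y₁ Y₂) Y₁')
          ((decorate k V btDeg Y₂' rfl).lTensor V) ∘ₗ
        (TensorProduct.assoc k _ _ _).symm.toLinearMap ∘ₗ
        (nodeEquiv k V b Y₁' Y₂').symm.toLinearMap.lTensor
          (⨂[k]^(btDeg (.node a Y₁ Y₂)) V)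
termination_by Y Y' => btDeg Y + btDeg Y'
decreasing_by all_goals simp only [btDeg]; omega

/-- The product `*_σ` of `𝒴(V)`. -/
def yMul : YSpace k V ⊗[k] YSpace k V →ₗ[k] YSpace k V :=
  TensorProduct.lift <| DirectSum.toModule k BT _ fun Y => LinearMap.flip <|
    DirectSum.toModule k BT _ fun Y' => LinearMap.flip <| TensorProduct.curry <| mulShape k V Y Y'

variable {k V}

/-- `(*_σ, ∨) = (*_σ ⊗ ∨) (σ_BT)₂ (σ_{V,𝒴(V)})₃` on `𝒴 ⊗ 𝒴 ⊗ V ⊗ 𝒴 ⊗ 𝒴`. -/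
def mulVee (σ : V ⊗[k] V →ₗ[k] V ⊗[k] V) :
    (YSpace k V ⊗[k] YSpace k V) ⊗[k] (V ⊗[k] (YSpace k V ⊗[k] YSpace k V)) →ₗ[k]
      YSpace k V ⊗[k] YSpace k V :=
  TensorProduct.map (yMul k V) (vee k V) ∘ₗ
    onMiddle _ _ (decBraiding btDeg σ) ∘ₗ
      (onFirst (YSpace k V) (vecBraiding btDeg σ)).lTensor _

/-- The coproduct on trees of a given shape: `Δ(|) = | ⊗ |` and
`Δ(Y ∨_v Y') = (Y ∨_v Y') ⊗ | + (*_σ, ∨)(Δ(Y) ⊗ v ⊗ Δ(Y'))`. -/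
def comulShape (σ : V ⊗[k] V →ₗ[k] V ⊗[k] V) :
    (Y : BT) → ⨂[k]^(btDeg Y) V →ₗ[k] YSpace k V ⊗[k] YSpace k V
  | .nil =>
    LinearMap.toSpanSingleton k _ (yOne k V ⊗ₜ yOne k V) ∘ₗ
      (TensorPower.algebraMap₀.symm : ⨂[k]^0 V ≃ₗ[k] k).toLinearMap
  | .node a l r =>
    (TensorProduct.mk k _ _).flip (yOne k V) ∘ₗ decorate k V btDeg (.node a l r) rfl +
      mulVee σ ∘ₗ
        TensorProduct.map (comulShape σ l) ((comulShape σ r).lTensor V) ∘ₗ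
          (nodeEquiv k V a l r).symm.toLinearMap

/-- The braided Hopf algebra `𝒴(V)` of planar binary trees. -/
def yHopf (σ : V ⊗[k] V →ₗ[k] V ⊗[k] V) : BraidedData k (YSpace k V) where
  mul := yMul k V
  one := yOne k V
  comul := DirectSum.toModule k BT _ fun Y => comulShape σ Y
  counit := deltaForm btDeg .nil rfl
  braiding := decBraiding btDeg σ
  grading := degreePart k V btDeg

end BinaryTrees

/-! ### The braided Hopf algebra of planar rooted forests -/

section Forests

/-- Planar rooted forests: a forest is empty, or it has a first tree `B⁺(F₁)`, where `F₁` is the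
forest of the branches at the root of that tree, followed by a forest `F₂` (`cons F₁ F₂` is
`B⁺(F₁) · F₂`). The tree `B⁺(F)` is the one-tree forest `cons F nil`. -/
inductive Forest : Type
  | nil : Forest
  | cons : Forest → Forest → Forest
  deriving DecidableEq

namespace Forest

/-- The number of vertices. -/
def deg : Forest → ℕ
  | nil => 0
  | cons F₁ F₂ => (deg F₁ + 1) + deg F₂

/-- Concatenation of forests. -/
def append : Forest → Forest → Forest
  | nil, G => G
  | cons F₁ F₂, G => cons F₁ (append F₂ G)

theorem deg_append : ∀ F G : Forest, (append F G).deg = F.deg + G.deg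
  | nil, G => by simp [append, deg]
  | cons F₁ F₂, G => by simp only [append, deg, deg_append F₂ G]; omega

/-- Subforests of a forest `F`, that is, sets of vertices closed under passing to descendants: for
the first tree `B⁺(F₁)` of `F = B⁺(F₁) · F₂` it either contains the root and thus the whole
tree (`none`), or it is a subforest of `F₁` (`some c`); and there is a subforest of `F₂`. -/
def Sub : Forest → Type
  | nil => Unit
  | cons F₁ F₂ => Option (Sub F₁) × Sub F₂

instance Sub.instFintype : (F : Forest) → Fintype (Sub F)
  | nil => inferInstanceAs (Fintype Unit)
  | cons F₁ F₂ =>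
    letI := Sub.instFintype F₁
    letI := Sub.instFintype F₂
    inferInstanceAs (Fintype (Option (Sub F₁) × Sub F₂))

/-- The subforest, as a forest. -/
def Sub.part : {F : Forest} → Sub F → Forest
  | nil, _ => nil
  | cons F₁ _, (none, d) => cons F₁ d.part
  | cons _ _, (some c, d) => c.part.append d.part

/-- What remains of the forest when the subforest is removed. -/
def Sub.rest : {F : Forest} → Sub F → Forest
  | nil, _ => nil
  | cons _ _, (none, d) => d.rest
  | cons _ _, (some c, d) => cons c.rest d.rest

/-- Which vertices, numbered in preorder (root first, then the branches, trees from left to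
right), belong to the subforest. -/
def Sub.mem : {F : Forest} → Sub F → Fin F.deg → Bool
  | nil, _ => fun _ => false
  | cons F₁ _, (none, d) => Fin.append (fun _ : Fin (F₁.deg + 1) => true) d.mem
  | cons F₁ _, (some c, d) =>
    Fin.append (Fin.cons (n := F₁.deg) (α := fun _ => Bool) false c.mem) d.mem

/-- The set of vertices of the subforest. -/
def Sub.vertices {F : Forest} (c : Sub F) : Finset (Fin F.deg) :=
  Finset.univ.filter fun i => c.mem i = true

theorem Sub.card_vertices : {F : Forest} → (c : Sub F) → c.vertices.card = c.part.deg
  | nil, _ => by simp [vertices, part, mem, deg]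
  | cons F₁ F₂, (none, d) => by
    have h := Sub.card_vertices d
    simp only [vertices, Finset.card_filter] at h ⊢
    simp only [part, deg, mem]
    rw [← h]
    erw [Fin.sum_univ_add]
    simp
  | cons F₁ F₂, (some c, d) => by
    have h := Sub.card_vertices d
    have h' := Sub.card_vertices c
    simp only [vertices, Finset.card_filter] at h h' ⊢
    simp only [part, deg_append, mem]
    rw [← h, ← h']
    erw [Fin.sum_univ_add, Fin.sum_univ_succ]
    simp

theorem Sub.part_add_rest : {F : Forest} → (c : Sub F) → c.part.deg + c.rest.deg = F.deg
  | nil, _ => by simp [part, rest, deg]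
  | cons F₁ F₂, (none, d) => by
    have h := Sub.part_add_rest d
    simp only [part, rest, deg]; omega
  | cons F₁ F₂, (some c, d) => by
    have h := Sub.part_add_rest d
    have h' := Sub.part_add_rest c
    simp only [part, rest, deg, deg_append]; omega

theorem Sub.card_compl {F : Forest} (c : Sub F) : c.verticesᶜ.card = c.rest.deg := by
  have h := c.part_add_rest
  rw [Finset.card_compl, c.card_vertices, Fintype.card_fin]; omega

/-- The unshuffle `w` such that `w(1) < ⋯ < w(d)` are the vertices of the subforest and
`w(d+1) < ⋯ < w(n)` are the remaining ones. -/
def Sub.perm {F : Forest} (c : Sub F) : Equiv.Perm (Fin F.deg) :=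
  (finCongr c.part_add_rest).symm.trans
    (finSumFinEquiv.symm.trans (finSumEquivOfFinset c.card_vertices c.card_compl))

end Forest

variable (k V : Type*) [Field k] [AddCommGroup V] [Module k V]

/-- `ℛ(V)`; the vertices of a forest are ordered in preorder. -/
abbrev RSpace : Type _ := Decorated k V Forest.deg

/-- The empty forest. -/
def rOne : RSpace k V := decorate k V Forest.deg .nil rfl (TensorPower.algebraMap₀ 1)

/-- The concatenation product. -/
def rMul : RSpace k V ⊗[k] RSpace k V →ₗ[k] RSpace k V :=
  TensorProduct.lift <| DirectSum.toModule k Forest _ fun F => LinearMap.flip <|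
    DirectSum.toModule k Forest _ fun G => LinearMap.flip <| TensorProduct.curry <|
      decorate k V Forest.deg (F.append G) (F.deg_append G) ∘ₗ TensorPower.mulEquiv.toLinearMap

/-- The grafting `v ⊗ F ↦ B⁺_v(F)`. -/
def bPlus : V ⊗[k] RSpace k V →ₗ[k] RSpace k V :=
  TensorProduct.lift <| LinearMap.flip <| DirectSum.toModule k Forest _ fun F =>
    LinearMap.flip <| TensorProduct.curry <|
      decorate k V Forest.deg (.cons F .nil) rfl ∘ₗ (consEquiv k V F.deg).toLinearMap

variable {k V}

/-- The coproduct on the tree `T = B⁺(F)`: the sum over all subforests `P` of `T` of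
`(P ⊗ T/P) T^σ_{w⁻¹}(v₁ ⊗ ⋯ ⊗ vₙ)`, where `w` is the unshuffle of `P`. -/
def treeComul (σ : V ⊗[k] V →ₗ[k] V ⊗[k] V) (F : Forest) :
    ⨂[k]^(F.deg + 1) V →ₗ[k] RSpace k V ⊗[k] RSpace k V :=
  ∑ c : Forest.Sub (.cons F .nil),
    TensorProduct.map (decorate k V Forest.deg c.part rfl) (decorate k V Forest.deg c.rest rfl) ∘ₗ
      TensorPower.mulEquiv.symm.toLinearMap ∘ₗ
        (TensorPower.cast k V c.part_add_rest.symm).toLinearMap ∘ₗ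
          braidLift σ c.perm⁻¹

/-- The coproduct on forests of a given shape, with `Δ(∅) = ∅ ⊗ ∅` and
`Δ(T · F) = (μ ⊗ μ) σ₂ (Δ(T) ⊗ Δ(F))` for a tree `T` and a forest `F`. -/
def forestComul (σ : V ⊗[k] V →ₗ[k] V ⊗[k] V) :
    (F : Forest) → ⨂[k]^F.deg V →ₗ[k] RSpace k V ⊗[k] RSpace k V
  | .nil =>
    LinearMap.toSpanSingleton k _ (rOne k V ⊗ₜ rOne k V) ∘ₗ
      (TensorPower.algebraMap₀.symm : ⨂[k]^0 V ≃ₗ[k] k).toLinearMap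
  | .cons F₁ F₂ =>
    TensorProduct.map (rMul k V) (rMul k V) ∘ₗ
      onMiddle _ _ (decBraiding Forest.deg σ) ∘ₗ
        TensorProduct.map (treeComul σ F₁) (forestComul σ F₂) ∘ₗ
          (TensorPower.mulEquiv.symm : ⨂[k]^(F₁.deg + 1 + F₂.deg) V ≃ₗ[k] _).toLinearMap

/-- The braided Hopf algebra `ℛ(V)` of planar rooted forests. -/
def rHopf (σ : V ⊗[k] V →ₗ[k] V ⊗[k] V) : BraidedData k (RSpace k V) where
  mul := rMul k V
  one := rOne k V
  comul := DirectSum.toModule k Forest _ fun F => forestComul σ F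
  counit := deltaForm Forest.deg .nil rfl
  braiding := decBraiding Forest.deg σ
  grading := degreePart k V Forest.deg

/-- `Θ` is an algebra homomorphism `𝒴(V) → ℛ(V)` with `Θ(| ∨_v Y) = B⁺_v(Θ(Y))`. -/
def IsTheta (σ : V ⊗[k] V →ₗ[k] V ⊗[k] V) (Θ : YSpace k V →ₗ[k] RSpace k V) : Prop :=
  IsAlgHom (yHopf σ) (rHopf σ) Θ ∧
    ∀ (v : V) (Y : YSpace k V),
      Θ (vee k V (yOne k V ⊗ₜ (v ⊗ₜ Y))) = bPlus k V (v ⊗ₜ Θ Y)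

end Forests

end

end BraidedTrees

namespace BraidedTrees

noncomputable section

/-! ### Crossings of modules -/

section Crossings

variable {k : Type*} [CommRing k]

section Ext

variable {A B C D E P : Type*} [AddCommGroup A] [Module k A] [AddCommGroup B] [Module k B]
  [AddCommGroup C] [Module k C] [AddCommGroup D] [Module k D] [AddCommGroup E] [Module k E]
  [AddCommGroup P] [Module k P]

theorem tensor_ext_right {f g : A ⊗[k] (B ⊗[k] C) →ₗ[k] P}
    (h : ∀ a b c, f (a ⊗ₜ (b ⊗ₜ c)) = g (a ⊗ₜ (b ⊗ₜ c))) : f = g := by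
  refine TensorProduct.ext' fun a z => ?_
  induction z using TensorProduct.induction_on with
  | zero => simp
  | tmul b c => exact h a b c
  | add x y hx hy => rw [TensorProduct.tmul_add, map_add, map_add, hx, hy]

theorem tensor_ext_left {f g : (A ⊗[k] B) ⊗[k] C →ₗ[k] P}
    (h : ∀ a b c, f ((a ⊗ₜ b) ⊗ₜ c) = g ((a ⊗ₜ b) ⊗ₜ c)) : f = g :=
  TensorProduct.ext_threefold h

theorem tensor_ext_middle {f g : (A ⊗[k] B) ⊗[k] (C ⊗[k] D) →ₗ[k] P}
    (h : ∀ a b c d, f ((a ⊗ₜ b) ⊗ₜ (c ⊗ₜ d)) = g ((a ⊗ₜ b) ⊗ₜ (c ⊗ₜ d))) : f = g := by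
  refine tensor_ext_right fun z c d => ?_
  induction z using TensorProduct.induction_on with
  | zero => simp
  | tmul a b => exact h a b c d
  | add x y hx hy => simp only [TensorProduct.add_tmul, map_add, hx, hy]

end Ext

section Cross

variable {A A₁ A₂ B B₁ C C₁ : Type*}
  [AddCommGroup A] [Module k A] [AddCommGroup A₁] [Module k A₁] [AddCommGroup A₂] [Module k A₂]
  [AddCommGroup B] [Module k B] [AddCommGroup B₁] [Module k B₁]
  [AddCommGroup C] [Module k C] [AddCommGroup C₁] [Module k C₁]

/-- `A` crosses `B ⊗ C`: first `B` by means of `x`, then `C` by means of `y`. -/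
def crossR (x : A ⊗[k] B →ₗ[k] B₁ ⊗[k] A₁) (y : A₁ ⊗[k] C →ₗ[k] C₁ ⊗[k] A₂) :
    A ⊗[k] (B ⊗[k] C) →ₗ[k] (B₁ ⊗[k] C₁) ⊗[k] A₂ :=
  (TensorProduct.assoc k B₁ C₁ A₂).symm.toLinearMap ∘ₗ y.lTensor B₁ ∘ₗ onFirst C x

/-- `B ⊗ C` crosses `A`: first `C` by means of `y`, then `B` by means of `x`. -/
def crossL (x : B ⊗[k] A₁ →ₗ[k] A₂ ⊗[k] B₁) (y : C ⊗[k] A →ₗ[k] A₁ ⊗[k] C₁) :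
    (B ⊗[k] C) ⊗[k] A →ₗ[k] A₂ ⊗[k] (B₁ ⊗[k] C₁) :=
  onFirst C₁ x ∘ₗ y.lTensor B ∘ₗ (TensorProduct.assoc k B C A).toLinearMap

/-- The second half of `crossR x y`. -/
def crossRSnd (B₁ : Type*) [AddCommGroup B₁] [Module k B₁]
    (y : A₁ ⊗[k] C →ₗ[k] C₁ ⊗[k] A₂) (c : C) :
    B₁ ⊗[k] A₁ →ₗ[k] (B₁ ⊗[k] C₁) ⊗[k] A₂ :=
  (TensorProduct.assoc k B₁ C₁ A₂).symm.toLinearMap ∘ₗ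
    (y ∘ₗ (TensorProduct.mk k A₁ C).flip c).lTensor B₁

/-- The second half of `crossL x y`. -/
def crossLSnd (C₁ : Type*) [AddCommGroup C₁] [Module k C₁]
    (x : B ⊗[k] A₁ →ₗ[k] A₂ ⊗[k] B₁) (b : B) :
    A₁ ⊗[k] C₁ →ₗ[k] A₂ ⊗[k] (B₁ ⊗[k] C₁) :=
  (TensorProduct.assoc k A₂ B₁ C₁).toLinearMap ∘ₗ (x ∘ₗ TensorProduct.mk k B A₁ b).rTensor C₁

theorem crossRSnd_tmul (y : A₁ ⊗[k] C →ₗ[k] C₁ ⊗[k] A₂) (c : C) (b : B₁) (a : A₁) :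
    crossRSnd B₁ y c (b ⊗ₜ a) = (TensorProduct.assoc k B₁ C₁ A₂).symm (b ⊗ₜ y (a ⊗ₜ c)) := by
  simp [crossRSnd]

theorem crossLSnd_tmul (x : B ⊗[k] A₁ →ₗ[k] A₂ ⊗[k] B₁) (b : B) (a : A₁) (c : C₁) :
    crossLSnd C₁ x b (a ⊗ₜ c) = TensorProduct.assoc k A₂ B₁ C₁ (x (b ⊗ₜ a) ⊗ₜ c) := by
  simp [crossLSnd]

theorem onFirst_tmul {D E : Type*} [AddCommGroup D] [Module k D] [AddCommGroup E] [Module k E]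
    (f : A ⊗[k] B →ₗ[k] C ⊗[k] D) (a : A) (b : B) (e : E) :
    onFirst E f (a ⊗ₜ (b ⊗ₜ e)) = TensorProduct.assoc k C D E (f (a ⊗ₜ b) ⊗ₜ e) := by
  simp [onFirst]

theorem crossR_tmul (x : A ⊗[k] B →ₗ[k] B₁ ⊗[k] A₁) (y : A₁ ⊗[k] C →ₗ[k] C₁ ⊗[k] A₂)
    (a : A) (b : B) (c : C) :
    crossR x y (a ⊗ₜ (b ⊗ₜ c)) = crossRSnd B₁ y c (x (a ⊗ₜ b)) := by
  simp only [crossR, LinearMap.comp_apply, onFirst_tmul]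
  induction x (a ⊗ₜ b) using TensorProduct.induction_on with
  | zero => simp
  | tmul p q => simp [crossRSnd_tmul]
  | add p q hp hq => simp only [TensorProduct.add_tmul, map_add, hp, hq]

theorem crossL_tmul (x : B ⊗[k] A₁ →ₗ[k] A₂ ⊗[k] B₁) (y : C ⊗[k] A →ₗ[k] A₁ ⊗[k] C₁)
    (a : A) (b : B) (c : C) :
    crossL x y ((b ⊗ₜ c) ⊗ₜ a) = crossLSnd C₁ x b (y (c ⊗ₜ a)) := by
  simp only [crossL, LinearMap.comp_apply, LinearEquiv.coe_coe, TensorProduct.assoc_tmul,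
    LinearMap.lTensor_tmul]
  induction y (c ⊗ₜ a) using TensorProduct.induction_on with
  | zero => simp
  | tmul p q => rw [onFirst_tmul, crossLSnd_tmul]
  | add p q hp hq => simp only [TensorProduct.tmul_add, map_add, hp, hq]

end Cross

section Square

variable {A A₁ A₂ B B₁ C C₁ A' A₁' A₂' B' B₁' C' C₁' : Type*}
  [AddCommGroup A] [Module k A] [AddCommGroup A₁] [Module k A₁] [AddCommGroup A₂] [Module k A₂]
  [AddCommGroup B] [Module k B] [AddCommGroup B₁] [Module k B₁]
  [AddCommGroup C] [Module k C] [AddCommGroup C₁] [Module k C₁]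
  [AddCommGroup A'] [Module k A'] [AddCommGroup A₁'] [Module k A₁']
  [AddCommGroup A₂'] [Module k A₂']
  [AddCommGroup B'] [Module k B'] [AddCommGroup B₁'] [Module k B₁']
  [AddCommGroup C'] [Module k C'] [AddCommGroup C₁'] [Module k C₁']

theorem map_comp_crossR {x : A ⊗[k] B →ₗ[k] B₁ ⊗[k] A₁} {y : A₁ ⊗[k] C →ₗ[k] C₁ ⊗[k] A₂}
    {x' : A' ⊗[k] B' →ₗ[k] B₁' ⊗[k] A₁'} {y' : A₁' ⊗[k] C' →ₗ[k] C₁' ⊗[k] A₂'}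
    {f : A →ₗ[k] A'} {f₁ : A₁ →ₗ[k] A₁'} {f₂ : A₂ →ₗ[k] A₂'} {g : B →ₗ[k] B'}
    {g₁ : B₁ →ₗ[k] B₁'} {h : C →ₗ[k] C'} {h₁ : C₁ →ₗ[k] C₁'}
    (hx : TensorProduct.map g₁ f₁ ∘ₗ x = x' ∘ₗ TensorProduct.map f g)
    (hy : TensorProduct.map h₁ f₂ ∘ₗ y = y' ∘ₗ TensorProduct.map f₁ h) :
    TensorProduct.map (TensorProduct.map g₁ h₁) f₂ ∘ₗ crossR x y =
      crossR x' y' ∘ₗ TensorProduct.map f (TensorProduct.map g h) := by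
  refine tensor_ext_right fun a b c => ?_
  have hx' := LinearMap.congr_fun hx (a ⊗ₜ b)
  simp only [LinearMap.comp_apply, TensorProduct.map_tmul, crossR_tmul] at hx' ⊢
  rw [← hx']
  induction x (a ⊗ₜ b) using TensorProduct.induction_on with
  | zero => simp
  | add p q hp hq => simp only [map_add, hp, hq]
  | tmul p q =>
    have hy' := LinearMap.congr_fun hy (q ⊗ₜ c)
    simp only [LinearMap.comp_apply, TensorProduct.map_tmul, crossRSnd_tmul] at hy' ⊢
    rw [← hy']
    induction y (q ⊗ₜ c) using TensorProduct.induction_on with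
    | zero => simp
    | add p q hp hq => simp only [map_add, TensorProduct.tmul_add, hp, hq]
    | tmul r s => simp

theorem map_comp_crossL {x : B ⊗[k] A₁ →ₗ[k] A₂ ⊗[k] B₁} {y : C ⊗[k] A →ₗ[k] A₁ ⊗[k] C₁}
    {x' : B' ⊗[k] A₁' →ₗ[k] A₂' ⊗[k] B₁'} {y' : C' ⊗[k] A' →ₗ[k] A₁' ⊗[k] C₁'}
    {f : A →ₗ[k] A'} {f₁ : A₁ →ₗ[k] A₁'} {f₂ : A₂ →ₗ[k] A₂'} {g : B →ₗ[k] B'}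
    {g₁ : B₁ →ₗ[k] B₁'} {h : C →ₗ[k] C'} {h₁ : C₁ →ₗ[k] C₁'}
    (hx : TensorProduct.map f₂ g₁ ∘ₗ x = x' ∘ₗ TensorProduct.map g f₁)
    (hy : TensorProduct.map f₁ h₁ ∘ₗ y = y' ∘ₗ TensorProduct.map h f) :
    TensorProduct.map f₂ (TensorProduct.map g₁ h₁) ∘ₗ crossL x y =
      crossL x' y' ∘ₗ TensorProduct.map (TensorProduct.map g h) f := by
  refine tensor_ext_left fun b c a => ?_
  have hy' := LinearMap.congr_fun hy (c ⊗ₜ a)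
  simp only [LinearMap.comp_apply, TensorProduct.map_tmul, crossL_tmul] at hy' ⊢
  rw [← hy']
  induction y (c ⊗ₜ a) using TensorProduct.induction_on with
  | zero => simp
  | add p q hp hq => simp only [map_add, hp, hq]
  | tmul p q =>
    have hx' := LinearMap.congr_fun hx (b ⊗ₜ p)
    simp only [LinearMap.comp_apply, TensorProduct.map_tmul, crossLSnd_tmul] at hx' ⊢
    rw [← hx']
    induction x (b ⊗ₜ p) using TensorProduct.induction_on with
    | zero => simp
    | add p q hp hq => simp only [map_add, TensorProduct.add_tmul, hp, hq]
    | tmul r s => simp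

end Square

section Interchange

variable {A B C D : Type*}
  [AddCommGroup A] [Module k A] [AddCommGroup B] [Module k B]
  [AddCommGroup C] [Module k C] [AddCommGroup D] [Module k D]

/-- Crossing two factors over two factors does not depend on the order of the two independent
crossings. -/
theorem crossR_crossL (x : A ⊗[k] C →ₗ[k] C ⊗[k] A) (y : B ⊗[k] C →ₗ[k] C ⊗[k] B)
    (x' : A ⊗[k] D →ₗ[k] D ⊗[k] A) (y' : B ⊗[k] D →ₗ[k] D ⊗[k] B) :
    crossR (crossL x y) (crossL x' y') = crossL (crossR x x') (crossR y y') := by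
  refine tensor_ext_middle fun a b c d => ?_
  rw [crossR_tmul, crossL_tmul, crossL_tmul, crossR_tmul]
  induction y (b ⊗ₜ c) using TensorProduct.induction_on with
  | zero => simp
  | add p q hp hq => simp only [map_add, hp, hq]
  | tmul c b =>
    rw [crossLSnd_tmul, crossRSnd_tmul]
    have h1 : ∀ w : C ⊗[k] A, crossRSnd C (crossL x' y') d (TensorProduct.assoc k C A B (w ⊗ₜ b)) =
        (TensorProduct.assoc k C D (A ⊗[k] B)).symm
          ((onFirst B x' ∘ₗ (TensorProduct.mk k A (D ⊗[k] B)).flip (y' (b ⊗ₜ d))).lTensor C w) := by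
      intro w
      induction w using TensorProduct.induction_on with
      | zero => simp
      | add p q hp hq => simp only [map_add, TensorProduct.add_tmul, hp, hq]
      | tmul p q => simp [crossRSnd_tmul, crossL]
    rw [h1]
    induction y' (b ⊗ₜ d) using TensorProduct.induction_on with
    | zero => simp
    | add p q hp hq =>
      simp only [map_add, TensorProduct.tmul_add, LinearMap.comp_add, LinearMap.lTensor_add,
        LinearMap.add_apply, hp, hq]
    | tmul d b =>
      rw [TensorProduct.assoc_symm_tmul, crossLSnd_tmul, crossR_tmul]
      induction x (a ⊗ₜ c) using TensorProduct.induction_on with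
      | zero => simp
      | add p q hp hq => simp only [map_add, TensorProduct.add_tmul, hp, hq]
      | tmul p q =>
        rw [crossRSnd_tmul, LinearMap.lTensor_tmul, LinearMap.comp_apply, LinearMap.flip_apply,
          TensorProduct.mk_apply, onFirst_tmul]
        induction x' (q ⊗ₜ d) using TensorProduct.induction_on with
        | zero => simp
        | add p q hp hq => simp only [map_add, TensorProduct.add_tmul, TensorProduct.tmul_add, hp,
          hq]
        | tmul p q => simp

end Interchange

end Crossings

/-! ### Naturality of crossings -/

section Intertwining

variable {k : Type*} [CommRing k]
  {A A' A'' B B' B'' C C' D D' : Type*}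
  [AddCommGroup A] [Module k A] [AddCommGroup A'] [Module k A'] [AddCommGroup A''] [Module k A'']
  [AddCommGroup B] [Module k B] [AddCommGroup B'] [Module k B'] [AddCommGroup B''] [Module k B'']
  [AddCommGroup C] [Module k C] [AddCommGroup C'] [Module k C']
  [AddCommGroup D] [Module k D] [AddCommGroup D'] [Module k D']

/-- The maps `f` and `g` commute with the crossings `x` and `x'`. -/
def Intertwines (x : A ⊗[k] B →ₗ[k] B ⊗[k] A) (x' : A' ⊗[k] B' →ₗ[k] B' ⊗[k] A')
    (f : A →ₗ[k] A') (g : B →ₗ[k] B') : Prop :=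
  TensorProduct.map g f ∘ₗ x = x' ∘ₗ TensorProduct.map f g

namespace Intertwines

variable {x : A ⊗[k] B →ₗ[k] B ⊗[k] A} {x' : A' ⊗[k] B' →ₗ[k] B' ⊗[k] A'}
  {x'' : A'' ⊗[k] B'' →ₗ[k] B'' ⊗[k] A''}

theorem apply {f : A →ₗ[k] A'} {g : B →ₗ[k] B'} (h : Intertwines x x' f g) (z : A ⊗[k] B) :
    TensorProduct.map g f (x z) = x' (TensorProduct.map f g z) :=
  LinearMap.congr_fun h z

theorem comp {f : A →ₗ[k] A'} {g : B →ₗ[k] B'} {f' : A' →ₗ[k] A''} {g' : B' →ₗ[k] B''}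
    (h' : Intertwines x' x'' f' g') (h : Intertwines x x' f g) :
    Intertwines x x'' (f' ∘ₗ f) (g' ∘ₗ g) := by
  rw [Intertwines, TensorProduct.map_comp, TensorProduct.map_comp, LinearMap.comp_assoc, h,
    ← LinearMap.comp_assoc, h', LinearMap.comp_assoc]

theorem comp_right {f : A →ₗ[k] A'} {g : B →ₗ[k] B'} {g' : B' →ₗ[k] B''}
    {x'' : A' ⊗[k] B'' →ₗ[k] B'' ⊗[k] A'}
    (h' : Intertwines x' x'' LinearMap.id g') (h : Intertwines x x' f g) :
    Intertwines x x'' f (g' ∘ₗ g) := h'.comp h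

theorem comp_left {f : A →ₗ[k] A'} {g : B →ₗ[k] B'} {f' : A' →ₗ[k] A''}
    {x'' : A'' ⊗[k] B' →ₗ[k] B' ⊗[k] A''}
    (h' : Intertwines x' x'' f' LinearMap.id) (h : Intertwines x x' f g) :
    Intertwines x x'' (f' ∘ₗ f) g := h'.comp h

theorem id : Intertwines x x LinearMap.id LinearMap.id := by
  simp [Intertwines]

theorem zero_right {f : A →ₗ[k] A'} : Intertwines x x' f 0 := by
  simp [Intertwines, TensorProduct.map_zero_left, TensorProduct.map_zero_right]

theorem zero_left {g : B →ₗ[k] B'} : Intertwines x x' 0 g := by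
  simp [Intertwines, TensorProduct.map_zero_left, TensorProduct.map_zero_right]

theorem add_right {f : A →ₗ[k] A'} {g g' : B →ₗ[k] B'} (h : Intertwines x x' f g)
    (h' : Intertwines x x' f g') : Intertwines x x' f (g + g') := by
  rw [Intertwines, TensorProduct.map_add_left, TensorProduct.map_add_right, LinearMap.add_comp,
    LinearMap.comp_add, h, h']

theorem add_left {f f' : A →ₗ[k] A'} {g : B →ₗ[k] B'} (h : Intertwines x x' f g)
    (h' : Intertwines x x' f' g) : Intertwines x x' (f + f') g := by
  rw [Intertwines, TensorProduct.map_add_left, TensorProduct.map_add_right, LinearMap.add_comp,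
    LinearMap.comp_add, h, h']

theorem neg_right {f : A →ₗ[k] A'} {g : B →ₗ[k] B'} (h : Intertwines x x' f g) :
    Intertwines x x' f (-g) := by
  have h1 : TensorProduct.map (-g) f = -TensorProduct.map g f :=
    TensorProduct.ext' fun _ _ => by simp [TensorProduct.neg_tmul]
  have h2 : TensorProduct.map f (-g) = -TensorProduct.map f g :=
    TensorProduct.ext' fun _ _ => by simp [TensorProduct.tmul_neg]
  rw [Intertwines, h1, h2, LinearMap.neg_comp, LinearMap.comp_neg, h]

theorem neg_left {f : A →ₗ[k] A'} {g : B →ₗ[k] B'} (h : Intertwines x x' f g) :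
    Intertwines x x' (-f) g := by
  have h1 : TensorProduct.map g (-f) = -TensorProduct.map g f :=
    TensorProduct.ext' fun _ _ => by simp [TensorProduct.tmul_neg]
  have h2 : TensorProduct.map (-f) g = -TensorProduct.map f g :=
    TensorProduct.ext' fun _ _ => by simp [TensorProduct.neg_tmul]
  rw [Intertwines, h1, h2, LinearMap.neg_comp, LinearMap.comp_neg, h]

theorem sub_right {f : A →ₗ[k] A'} {g g' : B →ₗ[k] B'} (h : Intertwines x x' f g)
    (h' : Intertwines x x' f g') : Intertwines x x' f (g - g') := by
  rw [sub_eq_add_neg]; exact h.add_right h'.neg_right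

theorem sub_left {f f' : A →ₗ[k] A'} {g : B →ₗ[k] B'} (h : Intertwines x x' f g)
    (h' : Intertwines x x' f' g) : Intertwines x x' (f - f') g := by
  rw [sub_eq_add_neg]; exact h.add_left h'.neg_left

theorem symm_right {x' : A ⊗[k] B' →ₗ[k] B' ⊗[k] A} {e : B ≃ₗ[k] B'}
    (h : Intertwines x x' LinearMap.id e.toLinearMap) :
    Intertwines x' x LinearMap.id e.symm.toLinearMap := by
  have h1 := congrArg (fun f => TensorProduct.map e.symm.toLinearMap LinearMap.id ∘ₗ f ∘ₗ
    TensorProduct.map LinearMap.id e.symm.toLinearMap) h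
  simp only [LinearMap.comp_assoc, ← TensorProduct.map_comp] at h1
  rw [← LinearMap.comp_assoc, ← TensorProduct.map_comp] at h1
  simpa [Intertwines] using h1.symm

theorem symm_left {x' : A' ⊗[k] B →ₗ[k] B ⊗[k] A'} {e : A ≃ₗ[k] A'}
    (h : Intertwines x x' e.toLinearMap LinearMap.id) :
    Intertwines x' x e.symm.toLinearMap LinearMap.id := by
  have h1 := congrArg (fun f => TensorProduct.map LinearMap.id e.symm.toLinearMap ∘ₗ f ∘ₗ
    TensorProduct.map e.symm.toLinearMap LinearMap.id) h
  simp only [LinearMap.comp_assoc, ← TensorProduct.map_comp] at h1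
  rw [← LinearMap.comp_assoc, ← TensorProduct.map_comp] at h1
  simpa [Intertwines] using h1.symm

theorem crossR {f : A →ₗ[k] A'} {g : B →ₗ[k] B'} {h : C →ₗ[k] C'}
    {y : A ⊗[k] C →ₗ[k] C ⊗[k] A} {y' : A' ⊗[k] C' →ₗ[k] C' ⊗[k] A'}
    (hx : Intertwines x x' f g) (hy : Intertwines y y' f h) :
    Intertwines (crossR x y) (crossR x' y') f (TensorProduct.map g h) :=
  map_comp_crossR hx hy

theorem crossL {f : C →ₗ[k] C'} {g : A →ₗ[k] A'} {h : B →ₗ[k] B'}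
    {x : A ⊗[k] C →ₗ[k] C ⊗[k] A} {x' : A' ⊗[k] C' →ₗ[k] C' ⊗[k] A'}
    {y : B ⊗[k] C →ₗ[k] C ⊗[k] B} {y' : B' ⊗[k] C' →ₗ[k] C' ⊗[k] B'}
    (hx : Intertwines x x' g f) (hy : Intertwines y y' h f) :
    Intertwines (crossL x y) (crossL x' y') (TensorProduct.map g h) f :=
  map_comp_crossL hx hy

theorem assoc_right (x : A ⊗[k] B →ₗ[k] B ⊗[k] A) (y : A ⊗[k] C →ₗ[k] C ⊗[k] A)
    (z : A ⊗[k] D →ₗ[k] D ⊗[k] A) :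
    Intertwines (BraidedTrees.crossR (BraidedTrees.crossR x y) z)
      (BraidedTrees.crossR x (BraidedTrees.crossR y z))
      LinearMap.id (TensorProduct.assoc k B C D).toLinearMap := by
  refine TensorProduct.ext' fun a w => ?_
  induction w using TensorProduct.induction_on with
  | zero => simp
  | add p q hp hq => simp only [map_add, TensorProduct.tmul_add, hp, hq]
  | tmul w d =>
  induction w using TensorProduct.induction_on with
  | zero => simp
  | add p q hp hq => simp only [map_add, TensorProduct.tmul_add, TensorProduct.add_tmul, hp, hq]
  | tmul b c =>
    simp only [LinearMap.comp_apply, TensorProduct.map_tmul, LinearEquiv.coe_coe, crossR_tmul,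
      TensorProduct.assoc_tmul, LinearMap.id_apply]
    induction x (a ⊗ₜ b) using TensorProduct.induction_on with
    | zero => simp
    | add p q hp hq => simp only [map_add, hp, hq]
    | tmul p q =>
      simp only [crossRSnd_tmul, crossR_tmul]
      induction y (q ⊗ₜ c) using TensorProduct.induction_on with
      | zero => simp
      | add p q hp hq => simp only [map_add, TensorProduct.tmul_add, hp, hq]
      | tmul r s =>
        simp only [crossRSnd_tmul, TensorProduct.assoc_symm_tmul]
        induction z (s ⊗ₜ d) using TensorProduct.induction_on with
        | zero => simp
        | add p q hp hq => simp only [map_add, TensorProduct.tmul_add, hp, hq]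
        | tmul r s => simp

theorem assoc_left (x : A ⊗[k] D →ₗ[k] D ⊗[k] A) (y : B ⊗[k] D →ₗ[k] D ⊗[k] B)
    (z : C ⊗[k] D →ₗ[k] D ⊗[k] C) :
    Intertwines (BraidedTrees.crossL (BraidedTrees.crossL x y) z)
      (BraidedTrees.crossL x (BraidedTrees.crossL y z))
      (TensorProduct.assoc k A B C).toLinearMap LinearMap.id := by
  refine TensorProduct.ext' fun w d => ?_
  induction w using TensorProduct.induction_on with
  | zero => simp
  | add p q hp hq => simp only [map_add, TensorProduct.add_tmul, hp, hq]
  | tmul w c =>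
  induction w using TensorProduct.induction_on with
  | zero => simp
  | add p q hp hq => simp only [map_add, TensorProduct.add_tmul, hp, hq]
  | tmul a b =>
    simp only [LinearMap.comp_apply, TensorProduct.map_tmul, LinearEquiv.coe_coe, crossL_tmul,
      TensorProduct.assoc_tmul, LinearMap.id_apply]
    induction z (c ⊗ₜ d) using TensorProduct.induction_on with
    | zero => simp
    | add p q hp hq => simp only [map_add, hp, hq]
    | tmul p q =>
      simp only [crossLSnd_tmul, crossL_tmul]
      induction y (b ⊗ₜ p) using TensorProduct.induction_on with
      | zero => simp
      | add p q hp hq => simp only [map_add, TensorProduct.add_tmul, hp, hq]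
      | tmul r s =>
        simp only [crossLSnd_tmul, TensorProduct.assoc_tmul]
        induction x (a ⊗ₜ r) using TensorProduct.induction_on with
        | zero => simp
        | add p q hp hq => simp only [map_add, TensorProduct.add_tmul, hp, hq]
        | tmul r s => simp

theorem rid_right (x : A ⊗[k] B →ₗ[k] B ⊗[k] A) :
    Intertwines (BraidedTrees.crossR x (TensorProduct.comm k A k).toLinearMap) x
      LinearMap.id (TensorProduct.rid k B).toLinearMap := by
  refine tensor_ext_right fun a b r => ?_
  simp only [LinearMap.comp_apply, crossR_tmul, TensorProduct.map_tmul, LinearMap.id_apply,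
    LinearEquiv.coe_coe, TensorProduct.rid_tmul, TensorProduct.tmul_smul, map_smul]
  induction x (a ⊗ₜ b) using TensorProduct.induction_on with
  | zero => simp
  | add p q hp hq => simp only [map_add, smul_add, hp, hq]
  | tmul p q => simp [crossRSnd_tmul, TensorProduct.smul_tmul']

theorem lid_right (x : A ⊗[k] B →ₗ[k] B ⊗[k] A) :
    Intertwines (BraidedTrees.crossR (TensorProduct.comm k A k).toLinearMap x) x
      LinearMap.id (TensorProduct.lid k B).toLinearMap := by
  refine tensor_ext_right fun a r b => ?_
  simp only [LinearMap.comp_apply, crossR_tmul, TensorProduct.map_tmul, LinearMap.id_apply,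
    LinearEquiv.coe_coe, TensorProduct.lid_tmul, TensorProduct.tmul_smul, map_smul,
    TensorProduct.comm_tmul, crossRSnd_tmul]
  induction x (a ⊗ₜ b) using TensorProduct.induction_on with
  | zero => simp
  | add p q hp hq => simp only [map_add, smul_add, TensorProduct.tmul_add, hp, hq]
  | tmul p q => simp [TensorProduct.smul_tmul']

theorem rid_left (x : A ⊗[k] B →ₗ[k] B ⊗[k] A) :
    Intertwines (BraidedTrees.crossL x (TensorProduct.comm k k B).toLinearMap) x
      (TensorProduct.rid k A).toLinearMap LinearMap.id := by
  refine tensor_ext_left fun a r b => ?_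
  simp only [LinearMap.comp_apply, crossL_tmul, TensorProduct.map_tmul, LinearMap.id_apply,
    LinearEquiv.coe_coe, TensorProduct.rid_tmul, ← TensorProduct.smul_tmul', map_smul,
    TensorProduct.comm_tmul, crossLSnd_tmul]
  induction x (a ⊗ₜ b) using TensorProduct.induction_on with
  | zero => simp
  | add p q hp hq => simp only [map_add, smul_add, TensorProduct.add_tmul, hp, hq]
  | tmul p q => simp

theorem lid_left (x : A ⊗[k] B →ₗ[k] B ⊗[k] A) :
    Intertwines (BraidedTrees.crossL (TensorProduct.comm k k B).toLinearMap x) x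
      (TensorProduct.lid k A).toLinearMap LinearMap.id := by
  refine tensor_ext_left fun r a b => ?_
  simp only [LinearMap.comp_apply, crossL_tmul, TensorProduct.map_tmul, LinearMap.id_apply,
    LinearEquiv.coe_coe, TensorProduct.lid_tmul, ← TensorProduct.smul_tmul', map_smul]
  induction x (a ⊗ₜ b) using TensorProduct.induction_on with
  | zero => simp
  | add p q hp hq => simp only [map_add, smul_add, hp, hq]
  | tmul p q => simp [crossLSnd_tmul]

/-- Naturality of `onFirst`, in the right slot. -/
theorem onFirst_right {a : A ⊗[k] B →ₗ[k] B ⊗[k] A} {b : A ⊗[k] C →ₗ[k] C ⊗[k] A}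
    {a' : A ⊗[k] B' →ₗ[k] B' ⊗[k] A} {b' : A ⊗[k] C' →ₗ[k] C' ⊗[k] A}
    (c : A ⊗[k] D →ₗ[k] D ⊗[k] A) {f : B ⊗[k] C →ₗ[k] B' ⊗[k] C'}
    (hf : Intertwines (BraidedTrees.crossR a b) (BraidedTrees.crossR a' b') LinearMap.id f) :
    Intertwines (BraidedTrees.crossR a (BraidedTrees.crossR b c))
      (BraidedTrees.crossR a' (BraidedTrees.crossR b' c)) LinearMap.id (onFirst D f) :=
  (assoc_right a' b' c).comp_right ((hf.crossR id).comp_right (assoc_right a b c).symm_right)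

theorem onFirst_left {a : A ⊗[k] D →ₗ[k] D ⊗[k] A} {b : B ⊗[k] D →ₗ[k] D ⊗[k] B}
    {a' : A' ⊗[k] D →ₗ[k] D ⊗[k] A'} {b' : B' ⊗[k] D →ₗ[k] D ⊗[k] B'}
    (c : C ⊗[k] D →ₗ[k] D ⊗[k] C) {f : A ⊗[k] B →ₗ[k] A' ⊗[k] B'}
    (hf : Intertwines (BraidedTrees.crossL a b) (BraidedTrees.crossL a' b') f LinearMap.id) :
    Intertwines (BraidedTrees.crossL a (BraidedTrees.crossL b c))
      (BraidedTrees.crossL a' (BraidedTrees.crossL b' c)) (onFirst C f) LinearMap.id :=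
  (assoc_left a' b' c).comp_left ((hf.crossL id).comp_left (assoc_left a b c).symm_left)

theorem onMiddle_right {E : Type*} [AddCommGroup E] [Module k E]
    (e : A ⊗[k] E →ₗ[k] E ⊗[k] A)
    {a : A ⊗[k] B →ₗ[k] B ⊗[k] A} {b : A ⊗[k] C →ₗ[k] C ⊗[k] A}
    {a' : A ⊗[k] B' →ₗ[k] B' ⊗[k] A} {b' : A ⊗[k] C' →ₗ[k] C' ⊗[k] A}
    (c : A ⊗[k] D →ₗ[k] D ⊗[k] A) {f : B ⊗[k] C →ₗ[k] B' ⊗[k] C'}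
    (hf : Intertwines (BraidedTrees.crossR a b) (BraidedTrees.crossR a' b') LinearMap.id f) :
    Intertwines (BraidedTrees.crossR (BraidedTrees.crossR e a) (BraidedTrees.crossR b c))
      (BraidedTrees.crossR (BraidedTrees.crossR e a') (BraidedTrees.crossR b' c))
      LinearMap.id (onMiddle E D f) :=
  (assoc_right e a' _).symm_right.comp_right
    ((id.crossR (hf.onFirst_right c)).comp_right (assoc_right e a _))

theorem onMiddle_left {E : Type*} [AddCommGroup E] [Module k E]
    (e : E ⊗[k] D →ₗ[k] D ⊗[k] E)
    {a : A ⊗[k] D →ₗ[k] D ⊗[k] A} {b : B ⊗[k] D →ₗ[k] D ⊗[k] B}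
    {a' : A' ⊗[k] D →ₗ[k] D ⊗[k] A'} {b' : B' ⊗[k] D →ₗ[k] D ⊗[k] B'}
    (c : C ⊗[k] D →ₗ[k] D ⊗[k] C) {f : A ⊗[k] B →ₗ[k] A' ⊗[k] B'}
    (hf : Intertwines (BraidedTrees.crossL a b) (BraidedTrees.crossL a' b') f LinearMap.id) :
    Intertwines (BraidedTrees.crossL (BraidedTrees.crossL e a) (BraidedTrees.crossL b c))
      (BraidedTrees.crossL (BraidedTrees.crossL e a') (BraidedTrees.crossL b' c))
      (onMiddle E C f) LinearMap.id :=
  (assoc_left e a' _).symm_left.comp_left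
    ((id.crossL (hf.onFirst_left c)).comp_left (assoc_left e a _))

end Intertwines

/-- If `T` crosses the crossings `x` and `y`, it crosses `crossR x y`. -/
theorem intertwines_right_crossR {T A₁ A₂ : Type*} [AddCommGroup T] [Module k T]
    [AddCommGroup A₁] [Module k A₁] [AddCommGroup A₂] [Module k A₂]
    {a : T ⊗[k] A →ₗ[k] A ⊗[k] T} {a₁ : T ⊗[k] A₁ →ₗ[k] A₁ ⊗[k] T}
    {a₂ : T ⊗[k] A₂ →ₗ[k] A₂ ⊗[k] T} {b : T ⊗[k] B →ₗ[k] B ⊗[k] T}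
    {b' : T ⊗[k] B' →ₗ[k] B' ⊗[k] T} {c : T ⊗[k] C →ₗ[k] C ⊗[k] T}
    {c' : T ⊗[k] C' →ₗ[k] C' ⊗[k] T}
    {x : A ⊗[k] B →ₗ[k] B' ⊗[k] A₁} {y : A₁ ⊗[k] C →ₗ[k] C' ⊗[k] A₂}
    (hx : Intertwines (crossR a b) (crossR b' a₁) LinearMap.id x)
    (hy : Intertwines (crossR a₁ c) (crossR c' a₂) LinearMap.id y) :
    Intertwines (crossR a (crossR b c)) (crossR (crossR b' c') a₂) LinearMap.id (crossR x y) :=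
  (Intertwines.assoc_right b' c' a₂).symm_right.comp_right
    ((Intertwines.id.crossR hy).comp_right (hx.onFirst_right c))

theorem intertwines_right_crossL {T A₁ A₂ : Type*} [AddCommGroup T] [Module k T]
    [AddCommGroup A₁] [Module k A₁] [AddCommGroup A₂] [Module k A₂]
    {a : T ⊗[k] A →ₗ[k] A ⊗[k] T} {a₁ : T ⊗[k] A₁ →ₗ[k] A₁ ⊗[k] T}
    {a₂ : T ⊗[k] A₂ →ₗ[k] A₂ ⊗[k] T} {b : T ⊗[k] B →ₗ[k] B ⊗[k] T}
    {b' : T ⊗[k] B' →ₗ[k] B' ⊗[k] T} {c : T ⊗[k] C →ₗ[k] C ⊗[k] T}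
    {c' : T ⊗[k] C' →ₗ[k] C' ⊗[k] T}
    {x : B ⊗[k] A₁ →ₗ[k] A₂ ⊗[k] B'} {y : C ⊗[k] A →ₗ[k] A₁ ⊗[k] C'}
    (hx : Intertwines (crossR b a₁) (crossR a₂ b') LinearMap.id x)
    (hy : Intertwines (crossR c a) (crossR a₁ c') LinearMap.id y) :
    Intertwines (crossR (crossR b c) a) (crossR a₂ (crossR b' c')) LinearMap.id (crossL x y) :=
  (hx.onFirst_right c').comp_right
    ((Intertwines.id.crossR hy).comp_right (Intertwines.assoc_right b c a))

theorem intertwines_left_crossL {T A₁ A₂ : Type*} [AddCommGroup T] [Module k T]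
    [AddCommGroup A₁] [Module k A₁] [AddCommGroup A₂] [Module k A₂]
    {a : A ⊗[k] T →ₗ[k] T ⊗[k] A} {a₁ : A₁ ⊗[k] T →ₗ[k] T ⊗[k] A₁}
    {a₂ : A₂ ⊗[k] T →ₗ[k] T ⊗[k] A₂} {b : B ⊗[k] T →ₗ[k] T ⊗[k] B}
    {b' : B' ⊗[k] T →ₗ[k] T ⊗[k] B'} {c : C ⊗[k] T →ₗ[k] T ⊗[k] C}
    {c' : C' ⊗[k] T →ₗ[k] T ⊗[k] C'}
    {x : B ⊗[k] A₁ →ₗ[k] A₂ ⊗[k] B'} {y : C ⊗[k] A →ₗ[k] A₁ ⊗[k] C'}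
    (hx : Intertwines (crossL b a₁) (crossL a₂ b') x LinearMap.id)
    (hy : Intertwines (crossL c a) (crossL a₁ c') y LinearMap.id) :
    Intertwines (crossL (crossL b c) a) (crossL a₂ (crossL b' c')) (crossL x y) LinearMap.id :=
  (hx.onFirst_left c').comp_left
    ((Intertwines.id.crossL hy).comp_left (Intertwines.assoc_left b c a))

/-! ### Induction along truncations -/

/-- The maps `e₁` and `e₂` are jointly surjective, and the endomorphisms `p n` are eventually the
identity on each element. -/
structure Cover {M M₁ M₂ : Type*} [AddCommGroup M] [Module k M] [AddCommGroup M₁] [Module k M₁]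
    [AddCommGroup M₂] [Module k M₂] (e₁ : M₁ →ₗ[k] M) (e₂ : M₂ →ₗ[k] M)
    (p : ℕ → M →ₗ[k] M) : Prop where
  surj : ∀ m, ∃ m₁ m₂, m = e₁ m₁ + e₂ m₂
  zero : p 0 = 0
  eventually : ∀ m, ∃ n, ∀ i, n ≤ i → p i m = m

namespace Cover

variable {M M₁ M₂ : Type*} [AddCommGroup M] [Module k M] [AddCommGroup M₁] [Module k M₁]
    [AddCommGroup M₂] [Module k M₂] {e₁ : M₁ →ₗ[k] M} {e₂ : M₂ →ₗ[k] M}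
    {p : ℕ → M →ₗ[k] M}

theorem rTensor (X : Type*) [AddCommGroup X] [Module k X] (h : Cover e₁ e₂ p) :
    Cover (TensorProduct.map e₁ (LinearMap.id : X →ₗ[k] X))
      (TensorProduct.map e₂ (LinearMap.id : X →ₗ[k] X))
      fun n => TensorProduct.map (p n) (LinearMap.id : X →ₗ[k] X) where
  surj m := by
    induction m using TensorProduct.induction_on with
    | zero => exact ⟨0, 0, by simp⟩
    | add a b ha hb =>
      obtain ⟨a₁, a₂, rfl⟩ := ha
      obtain ⟨b₁, b₂, rfl⟩ := hb
      exact ⟨a₁ + b₁, a₂ + b₂, by simp only [map_add]; abel⟩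
    | tmul m x =>
      obtain ⟨a, b, rfl⟩ := h.surj m
      exact ⟨a ⊗ₜ x, b ⊗ₜ x, by simp [TensorProduct.add_tmul]⟩
  zero := by simp [h.zero, TensorProduct.map_zero_left]
  eventually m := by
    induction m using TensorProduct.induction_on with
    | zero => exact ⟨0, by simp⟩
    | add a b ha hb =>
      obtain ⟨m, hm⟩ := ha
      obtain ⟨n, hn⟩ := hb
      exact ⟨max m n, fun i hi => by
        rw [map_add, hm i (le_trans (le_max_left _ _) hi), hn i (le_trans (le_max_right _ _) hi)]⟩
    | tmul m x =>
      obtain ⟨n, hn⟩ := h.eventually m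
      exact ⟨n, fun i hi => by simp [hn i hi]⟩

theorem lTensor (X : Type*) [AddCommGroup X] [Module k X] (h : Cover e₁ e₂ p) :
    Cover (TensorProduct.map (LinearMap.id : X →ₗ[k] X) e₁)
      (TensorProduct.map (LinearMap.id : X →ₗ[k] X) e₂)
      fun n => TensorProduct.map (LinearMap.id : X →ₗ[k] X) (p n) where
  surj m := by
    induction m using TensorProduct.induction_on with
    | zero => exact ⟨0, 0, by simp⟩
    | add a b ha hb =>
      obtain ⟨a₁, a₂, rfl⟩ := ha
      obtain ⟨b₁, b₂, rfl⟩ := hb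
      exact ⟨a₁ + b₁, a₂ + b₂, by simp only [map_add]; abel⟩
    | tmul x m =>
      obtain ⟨a, b, rfl⟩ := h.surj m
      exact ⟨x ⊗ₜ a, x ⊗ₜ b, by simp [TensorProduct.tmul_add]⟩
  zero := by simp [h.zero, TensorProduct.map_zero_right]
  eventually m := by
    induction m using TensorProduct.induction_on with
    | zero => exact ⟨0, by simp⟩
    | add a b ha hb =>
      obtain ⟨m, hm⟩ := ha
      obtain ⟨n, hn⟩ := hb
      exact ⟨max m n, fun i hi => by
        rw [map_add, hm i (le_trans (le_max_left _ _) hi), hn i (le_trans (le_max_right _ _) hi)]⟩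
    | tmul x m =>
      obtain ⟨n, hn⟩ := h.eventually m
      exact ⟨n, fun i hi => by simp [hn i hi]⟩

theorem intertwines_right_of_surj (h : Cover e₁ e₂ p) {x : A ⊗[k] M →ₗ[k] M ⊗[k] A}
    {x₁ : A ⊗[k] M₁ →ₗ[k] M₁ ⊗[k] A} {x₂ : A ⊗[k] M₂ →ₗ[k] M₂ ⊗[k] A}
    (h₁ : Intertwines x₁ x LinearMap.id e₁) (h₂ : Intertwines x₂ x LinearMap.id e₂)
    {x' : A' ⊗[k] B →ₗ[k] B ⊗[k] A'} {f : A →ₗ[k] A'} {g : M →ₗ[k] B}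
    (hg₁ : Intertwines x₁ x' f (g ∘ₗ e₁)) (hg₂ : Intertwines x₂ x' f (g ∘ₗ e₂)) :
    Intertwines x x' f g := by
  refine TensorProduct.ext' fun a m => ?_
  obtain ⟨m₁, m₂, rfl⟩ := h.surj m
  have q₁ := hg₁.apply (a ⊗ₜ m₁)
  have q₂ := hg₂.apply (a ⊗ₜ m₂)
  have r₁ := h₁.apply (a ⊗ₜ m₁)
  have r₂ := h₂.apply (a ⊗ₜ m₂)
  simp only [TensorProduct.map_tmul, LinearMap.id_apply] at r₁ r₂
  rw [← LinearMap.comp_id f, TensorProduct.map_comp] at q₁ q₂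
  simp only [TensorProduct.map_comp, LinearMap.comp_apply, r₁, r₂] at q₁ q₂
  simp only [LinearMap.comp_apply, TensorProduct.tmul_add, map_add, q₁, q₂]
  simp

theorem intertwines_left_of_surj (h : Cover e₁ e₂ p) {x : M ⊗[k] A →ₗ[k] A ⊗[k] M}
    {x₁ : M₁ ⊗[k] A →ₗ[k] A ⊗[k] M₁} {x₂ : M₂ ⊗[k] A →ₗ[k] A ⊗[k] M₂}
    (h₁ : Intertwines x₁ x e₁ LinearMap.id) (h₂ : Intertwines x₂ x e₂ LinearMap.id)
    {x' : B ⊗[k] A' →ₗ[k] A' ⊗[k] B} {f : A →ₗ[k] A'} {g : M →ₗ[k] B}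
    (hg₁ : Intertwines x₁ x' (g ∘ₗ e₁) f) (hg₂ : Intertwines x₂ x' (g ∘ₗ e₂) f) :
    Intertwines x x' g f := by
  refine TensorProduct.ext' fun m a => ?_
  obtain ⟨m₁, m₂, rfl⟩ := h.surj m
  have q₁ := hg₁.apply (m₁ ⊗ₜ a)
  have q₂ := hg₂.apply (m₂ ⊗ₜ a)
  have r₁ := h₁.apply (m₁ ⊗ₜ a)
  have r₂ := h₂.apply (m₂ ⊗ₜ a)
  simp only [TensorProduct.map_tmul, LinearMap.id_apply] at r₁ r₂
  rw [← LinearMap.comp_id f, TensorProduct.map_comp] at q₁ q₂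
  simp only [TensorProduct.map_comp, LinearMap.comp_apply, r₁, r₂] at q₁ q₂
  simp only [LinearMap.comp_apply, TensorProduct.add_tmul, map_add, q₁, q₂]
  simp

theorem intertwines_right (h : Cover e₁ e₂ p) {x : A ⊗[k] M →ₗ[k] M ⊗[k] A}
    {x₁ : A ⊗[k] M₁ →ₗ[k] M₁ ⊗[k] A} {x₂ : A ⊗[k] M₂ →ₗ[k] M₂ ⊗[k] A}
    (h₁ : Intertwines x₁ x LinearMap.id e₁) (h₂ : Intertwines x₂ x LinearMap.id e₂)
    {x' : A' ⊗[k] B →ₗ[k] B ⊗[k] A'} {f : A →ₗ[k] A'} {g : M →ₗ[k] B}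
    (hg₁ : ∀ n, Intertwines x₁ x' f (g ∘ₗ p (n + 1) ∘ₗ e₁))
    (hg₂ : ∀ n, Intertwines x x' f (g ∘ₗ p n) → Intertwines x₂ x' f (g ∘ₗ p (n + 1) ∘ₗ e₂)) :
    Intertwines x x' f g := by
  have key : ∀ n, Intertwines x x' f (g ∘ₗ p n) := by
    intro n
    induction n with
    | zero => rw [h.zero, LinearMap.comp_zero]; exact Intertwines.zero_right
    | succ n ih => exact h.intertwines_right_of_surj h₁ h₂ (hg₁ n) (hg₂ n ih)
  refine TensorProduct.ext' fun a m => ?_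
  obtain ⟨n₁, hn₁⟩ := h.eventually m
  obtain ⟨n₂, hn₂⟩ := (h.rTensor A).eventually (x (a ⊗ₜ m))
  have q := (key (max n₁ n₂)).apply (a ⊗ₜ m)
  rw [← LinearMap.comp_id f, TensorProduct.map_comp, LinearMap.comp_apply,
    hn₂ _ (le_max_right _ _)] at q
  simpa [hn₁ _ (le_max_left n₁ n₂)] using q

theorem intertwines_left (h : Cover e₁ e₂ p) {x : M ⊗[k] A →ₗ[k] A ⊗[k] M}
    {x₁ : M₁ ⊗[k] A →ₗ[k] A ⊗[k] M₁} {x₂ : M₂ ⊗[k] A →ₗ[k] A ⊗[k] M₂}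
    (h₁ : Intertwines x₁ x e₁ LinearMap.id) (h₂ : Intertwines x₂ x e₂ LinearMap.id)
    {x' : B ⊗[k] A' →ₗ[k] A' ⊗[k] B} {f : A →ₗ[k] A'} {g : M →ₗ[k] B}
    (hg₁ : ∀ n, Intertwines x₁ x' (g ∘ₗ p (n + 1) ∘ₗ e₁) f)
    (hg₂ : ∀ n, Intertwines x x' (g ∘ₗ p n) f → Intertwines x₂ x' (g ∘ₗ p (n + 1) ∘ₗ e₂) f) :
    Intertwines x x' g f := by
  have key : ∀ n, Intertwines x x' (g ∘ₗ p n) f := by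
    intro n
    induction n with
    | zero => rw [h.zero, LinearMap.comp_zero]; exact Intertwines.zero_left
    | succ n ih => exact h.intertwines_left_of_surj h₁ h₂ (hg₁ n) (hg₂ n ih)
  refine TensorProduct.ext' fun m a => ?_
  obtain ⟨n₁, hn₁⟩ := h.eventually m
  obtain ⟨n₂, hn₂⟩ := (h.lTensor A).eventually (x (m ⊗ₜ a))
  have q := (key (max n₁ n₂)).apply (m ⊗ₜ a)
  rw [← LinearMap.comp_id f, TensorProduct.map_comp, LinearMap.comp_apply,
    hn₂ _ (le_max_right _ _)] at q
  simpa [hn₁ _ (le_max_left n₁ n₂)] using q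

end Cover

end Intertwining

section Units

variable {k : Type*} [CommRing k]
  {A B C R : Type*} [AddCommGroup A] [Module k A] [AddCommGroup B] [Module k B]
  [AddCommGroup C] [Module k C] [AddCommGroup R] [Module k R]

/-- The Yang-Baxter equation, as naturality in the second or in the first factor. -/
theorem intertwines_right_iff_left {x : A ⊗[k] B →ₗ[k] B ⊗[k] A} {y : A ⊗[k] C →ₗ[k] C ⊗[k] A}
    {z : B ⊗[k] C →ₗ[k] C ⊗[k] B} :
    Intertwines (crossR x y) (crossR y x) LinearMap.id z ↔
      Intertwines (crossL y z) (crossL z y) x LinearMap.id := by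
  have h1 : Intertwines (crossR x y) (crossR y x) LinearMap.id z ↔
      onFirst A z ∘ₗ y.lTensor B ∘ₗ onFirst C x = x.lTensor C ∘ₗ onFirst B y ∘ₗ z.lTensor A := by
    rw [Intertwines, ← LinearMap.cancel_left (f := (TensorProduct.assoc k C B A).toLinearMap)
      (TensorProduct.assoc k C B A).injective]
    refine Eq.congr rfl ?_
    ext
    simp [crossR, LinearMap.lTensor]
  have h2 : Intertwines (crossL y z) (crossL z y) x LinearMap.id ↔
      x.lTensor C ∘ₗ onFirst B y ∘ₗ z.lTensor A = onFirst A z ∘ₗ y.lTensor B ∘ₗ onFirst C x := by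
    refine Iff.trans ?_ (LinearMap.cancel_right
      (g := (TensorProduct.assoc k A B C).toLinearMap) (TensorProduct.assoc k A B C).surjective)
    refine Eq.congr rfl ?_
    refine tensor_ext_left fun a b c => ?_
    simp [crossL, onFirst, LinearMap.rTensor]
  rw [h1, h2, eq_comm]

theorem isBraiding_iff {σ : A ⊗[k] A →ₗ[k] A ⊗[k] A} :
    IsBraiding σ ↔ Intertwines (crossR σ σ) (crossR σ σ) LinearMap.id σ := by
  rw [Intertwines, ← LinearMap.cancel_left (f := (TensorProduct.assoc k A A A).toLinearMap)
      (TensorProduct.assoc k A A A).injective, IsBraiding]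
  refine Eq.congr rfl ?_
  ext; simp [crossR, LinearMap.lTensor]

/-- The map `a ↦ a ⊗ e`. -/
def appendElt (A : Type*) [AddCommGroup A] [Module k A] (e : R) : A →ₗ[k] A ⊗[k] R :=
  TensorProduct.map LinearMap.id (LinearMap.toSpanSingleton k R e) ∘ₗ
    (TensorProduct.rid k A).symm.toLinearMap

/-- The map `a ↦ e ⊗ a`. -/
def prependElt (A : Type*) [AddCommGroup A] [Module k A] (e : R) : A →ₗ[k] R ⊗[k] A :=
  TensorProduct.map (LinearMap.toSpanSingleton k R e) LinearMap.id ∘ₗ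
    (TensorProduct.lid k A).symm.toLinearMap

@[simp]
theorem appendElt_apply (e : R) (a : A) : appendElt A e a = a ⊗ₜ[k] e := by
  simp [appendElt]

@[simp]
theorem prependElt_apply (e : R) (a : A) : prependElt A e a = e ⊗ₜ[k] a := by
  simp [prependElt]

theorem Intertwines.append_right {x : A ⊗[k] B →ₗ[k] B ⊗[k] A} {y : A ⊗[k] R →ₗ[k] R ⊗[k] A}
    {e : R} (h : Intertwines (TensorProduct.comm k A k).toLinearMap y LinearMap.id
      (LinearMap.toSpanSingleton k R e)) :
    Intertwines x (BraidedTrees.crossR x y) LinearMap.id (appendElt B e) :=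
  (Intertwines.id.crossR h).comp_right (rid_right x).symm_right

theorem Intertwines.prepend_right {x : A ⊗[k] B →ₗ[k] B ⊗[k] A} {y : A ⊗[k] R →ₗ[k] R ⊗[k] A}
    {e : R} (h : Intertwines (TensorProduct.comm k A k).toLinearMap y LinearMap.id
      (LinearMap.toSpanSingleton k R e)) :
    Intertwines x (BraidedTrees.crossR y x) LinearMap.id (prependElt B e) :=
  (h.crossR Intertwines.id).comp_right (lid_right x).symm_right

theorem Intertwines.append_left {x : A ⊗[k] B →ₗ[k] B ⊗[k] A} {y : R ⊗[k] B →ₗ[k] B ⊗[k] R}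
    {e : R} (h : Intertwines (TensorProduct.comm k k B).toLinearMap y
      (LinearMap.toSpanSingleton k R e) LinearMap.id) :
    Intertwines x (BraidedTrees.crossL x y) (appendElt A e) LinearMap.id :=
  (Intertwines.id.crossL h).comp_left (rid_left x).symm_left

theorem Intertwines.prepend_left {x : A ⊗[k] B →ₗ[k] B ⊗[k] A} {y : R ⊗[k] B →ₗ[k] B ⊗[k] R}
    {e : R} (h : Intertwines (TensorProduct.comm k k B).toLinearMap y
      (LinearMap.toSpanSingleton k R e) LinearMap.id) :
    Intertwines x (BraidedTrees.crossL y x) (prependElt A e) LinearMap.id :=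
  (h.crossL Intertwines.id).comp_left (lid_left x).symm_left

end Units

/-! ### Forests, abstractly -/

/-- The product of a braided tensor product of algebras: `(μ ⊗ μ) σ₂`. -/
def BraidedData.mul₂ {k R : Type*} [CommRing k] [AddCommGroup R] [Module k R]
    (D : BraidedData k R) : (R ⊗[k] R) ⊗[k] (R ⊗[k] R) →ₗ[k] R ⊗[k] R :=
  TensorProduct.map D.mul D.mul ∘ₗ onMiddle R R D.braiding

/-- A module `R` that is generated from `one` by the operation `cons : (v, F, G) ↦ B⁺_v(F) · G`,
with structure maps that are recursively determined by this operation. -/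
structure ForestModel {k V : Type*} (R : Type*) [CommRing k] [AddCommGroup V] [Module k V]
    [AddCommGroup R] [Module k R] (σ : V ⊗[k] V →ₗ[k] V ⊗[k] V) where
  D : BraidedData k R
  τ : V ⊗[k] R →ₗ[k] R ⊗[k] V
  cons : V ⊗[k] (R ⊗[k] R) →ₗ[k] R
  p : ℕ → R →ₗ[k] R
  cover : Cover (LinearMap.toSpanSingleton k R D.one) cons p
  p_one : ∀ n, p (n + 1) D.one = D.one
  p_cons : ∀ n, p (n + 1) ∘ₗ cons =
    cons ∘ₗ TensorProduct.map LinearMap.id (TensorProduct.map (p n) (p n))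
  braid : IsBraiding σ
  τ_one : ∀ u, τ (u ⊗ₜ D.one) = D.one ⊗ₜ u
  τ_cons : Intertwines (crossR σ (crossR τ τ)) τ LinearMap.id cons
  braiding_one : ∀ x, D.braiding (D.one ⊗ₜ x) = x ⊗ₜ D.one
  braiding_cons : Intertwines (crossL τ (crossL D.braiding D.braiding)) D.braiding cons
    LinearMap.id
  one_mul : ∀ x, D.mul (D.one ⊗ₜ x) = x
  cons_mul : ∀ v F G x, D.mul (cons (v ⊗ₜ (F ⊗ₜ G)) ⊗ₜ x) = cons (v ⊗ₜ (F ⊗ₜ D.mul (G ⊗ₜ x)))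
  comul_one : D.comul D.one = D.one ⊗ₜ D.one
  comul_cons : ∀ v F G, D.comul (cons (v ⊗ₜ (F ⊗ₜ G))) =
    D.mul₂ ((cons (v ⊗ₜ (F ⊗ₜ D.one)) ⊗ₜ D.one +
      (cons ∘ₗ (appendElt R D.one).lTensor V).lTensor R
        (onFirst R τ (v ⊗ₜ D.comul F))) ⊗ₜ D.comul G)
  counit_one : D.counit D.one = 1
  counit_cons : ∀ z, D.counit (cons z) = 0

namespace ForestModel

variable {k V R : Type*} [CommRing k] [AddCommGroup V] [Module k V]
    [AddCommGroup R] [Module k R] {σ : V ⊗[k] V →ₗ[k] V ⊗[k] V} (M : ForestModel R σ)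

/-- The grafting operator. -/
def graft : V ⊗[k] R →ₗ[k] R := M.cons ∘ₗ TensorProduct.map LinearMap.id (appendElt R M.D.one)

theorem graft_tmul (v : V) (F : R) : M.graft (v ⊗ₜ F) = M.cons (v ⊗ₜ (F ⊗ₜ M.D.one)) := by
  simp [graft]

theorem graft_mul (v : V) (F G : R) :
    M.D.mul (M.graft (v ⊗ₜ F) ⊗ₜ G) = M.cons (v ⊗ₜ (F ⊗ₜ G)) := by
  rw [graft_tmul, M.cons_mul, M.one_mul]

/-- `v ⊗ F ⊗ G ↦ F ⊗ B⁺_v(G)`, with `v` crossing `F`. -/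
def graft₂ : V ⊗[k] (R ⊗[k] R) →ₗ[k] R ⊗[k] R :=
  TensorProduct.map LinearMap.id M.graft ∘ₗ onFirst R M.τ

theorem comul_cons' (v : V) (F G : R) : M.D.comul (M.cons (v ⊗ₜ (F ⊗ₜ G))) =
    M.D.mul₂ ((M.graft (v ⊗ₜ F) ⊗ₜ M.D.one + M.graft₂ (v ⊗ₜ M.D.comul F)) ⊗ₜ M.D.comul G) := by
  rw [M.comul_cons, graft_tmul]; rfl

theorem induction {P : R → Prop} (hadd : ∀ x y, P x → P y → P (x + y))
    (hsmul : ∀ (r : k) x, P x → P (r • x)) (hone : P M.D.one)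
    (hcons : ∀ v F G, P F → P G → P (M.cons (v ⊗ₜ (F ⊗ₜ G)))) (x : R) : P x := by
  have h0 : P 0 := by simpa using hsmul 0 _ hone
  have key : ∀ n x, P (M.p n x) := by
    intro n
    induction n with
    | zero => intro x; rw [M.cover.zero]; exact h0
    | succ n ih =>
      intro x
      obtain ⟨r, z, rfl⟩ := M.cover.surj x
      rw [map_add]
      refine hadd _ _ ?_ ?_
      · rw [LinearMap.toSpanSingleton_apply, map_smul, M.p_one]; exact hsmul _ _ hone
      · rw [← LinearMap.comp_apply, M.p_cons, LinearMap.comp_apply]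
        induction z using TensorProduct.induction_on with
        | zero => simpa using h0
        | add a b ha hb => rw [map_add, map_add]; exact hadd _ _ ha hb
        | tmul v z =>
        induction z using TensorProduct.induction_on with
        | zero => simpa using h0
        | add a b ha hb => rw [TensorProduct.tmul_add, map_add, map_add]; exact hadd _ _ ha hb
        | tmul F G => exact hcons _ _ _ (ih F) (ih G)
  obtain ⟨n, hn⟩ := M.cover.eventually x
  rw [← hn n le_rfl]
  exact key n x

/-- The unit, as a linear map. -/
abbrev unit : k →ₗ[k] R := LinearMap.toSpanSingleton k R M.D.one

theorem p_comp_unit (n : ℕ) : M.p (n + 1) ∘ₗ M.unit = M.unit := by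
  ext; simp [M.p_one]

/-! #### Crossings by `V` -/

theorem unit_V : Intertwines (TensorProduct.comm k V k).toLinearMap M.τ LinearMap.id M.unit :=
  TensorProduct.ext' fun u r => by simp [M.τ_one, TensorProduct.smul_tmul']

theorem p_V (n : ℕ) : Intertwines M.τ M.τ LinearMap.id (M.p n) := by
  induction n with
  | zero => rw [M.cover.zero]; exact Intertwines.zero_right
  | succ n ih =>
    refine M.cover.intertwines_right_of_surj M.unit_V M.τ_cons ?_ ?_
    · rw [p_comp_unit]; exact M.unit_V
    · rw [M.p_cons]
      exact M.τ_cons.comp_right (Intertwines.id.crossR (ih.crossR ih))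

theorem τ_V : Intertwines (crossR σ M.τ) (crossR M.τ σ) LinearMap.id M.τ := by
  refine (M.cover.lTensor V).intertwines_right (x₁ := crossR σ
    (TensorProduct.comm k V k).toLinearMap)
    (x₂ := crossR σ (crossR σ (crossR M.τ M.τ))) (Intertwines.id.crossR M.unit_V)
    (Intertwines.id.crossR M.τ_cons) (fun n => ?_) (fun n ih => ?_)
  · have h : M.τ ∘ₗ TensorProduct.map LinearMap.id (M.p (n + 1)) ∘ₗ
        TensorProduct.map LinearMap.id M.unit =
        prependElt V M.D.one ∘ₗ (TensorProduct.rid k V).toLinearMap :=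
      TensorProduct.ext' fun u r => by
        simp [M.p_one, M.τ_one]
    rw [h]
    exact M.unit_V.prepend_right.comp_right (Intertwines.rid_right σ)
  · have h : M.τ ∘ₗ TensorProduct.map LinearMap.id (M.p (n + 1)) ∘ₗ
        TensorProduct.map LinearMap.id M.cons = TensorProduct.map M.cons LinearMap.id ∘ₗ
        crossR σ (crossR (M.τ ∘ₗ TensorProduct.map LinearMap.id (M.p n))
          (M.τ ∘ₗ TensorProduct.map LinearMap.id (M.p n))) := by
      have e2 := map_comp_crossR (f := LinearMap.id) (f₁ := LinearMap.id) (f₂ := LinearMap.id)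
        (g := M.p n) (h := M.p n) (g₁ := LinearMap.id) (h₁ := LinearMap.id)
        (x := M.τ ∘ₗ TensorProduct.map LinearMap.id (M.p n))
        (y := M.τ ∘ₗ TensorProduct.map LinearMap.id (M.p n)) (x' := M.τ) (y' := M.τ)
        (by simp) (by simp)
      have e1 := map_comp_crossR (f := LinearMap.id) (f₁ := LinearMap.id) (f₂ := LinearMap.id)
        (g := LinearMap.id) (g₁ := LinearMap.id) (h₁ := LinearMap.id) (x := σ) (x' := σ)
        (by simp) (by simpa using e2)
      simp only [TensorProduct.map_id, LinearMap.id_comp] at e1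
      rw [e1, ← LinearMap.comp_assoc _ _
        (TensorProduct.map M.cons LinearMap.id), M.τ_cons, LinearMap.comp_assoc,
        ← TensorProduct.map_comp,
        ← TensorProduct.map_comp, M.p_cons]
    rw [h]
    exact (M.τ_cons.crossR Intertwines.id).comp_right (intertwines_right_crossR
      (isBraiding_iff.1 M.braid)
      (intertwines_right_crossR ih ih))

theorem braiding_p_cons (n : ℕ) :
    M.D.braiding ∘ₗ TensorProduct.map (M.p (n + 1)) LinearMap.id ∘ₗ
        TensorProduct.map M.cons LinearMap.id = TensorProduct.map LinearMap.id M.cons ∘ₗ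
        crossL M.τ (crossL (M.D.braiding ∘ₗ TensorProduct.map (M.p n) LinearMap.id)
          (M.D.braiding ∘ₗ TensorProduct.map (M.p n) LinearMap.id)) := by
  have e2 := map_comp_crossL (f := LinearMap.id) (f₁ := LinearMap.id) (f₂ := LinearMap.id)
    (g := M.p n) (h := M.p n) (g₁ := LinearMap.id) (h₁ := LinearMap.id)
    (x := M.D.braiding ∘ₗ TensorProduct.map (M.p n) LinearMap.id)
    (y := M.D.braiding ∘ₗ TensorProduct.map (M.p n) LinearMap.id)
    (x' := M.D.braiding) (y' := M.D.braiding) (by simp) (by simp)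
  have e1 := map_comp_crossL (f := LinearMap.id) (f₁ := LinearMap.id) (f₂ := LinearMap.id)
    (g := LinearMap.id) (g₁ := LinearMap.id) (h₁ := LinearMap.id) (x := M.τ) (x' := M.τ)
    (by simp) (by simpa using e2)
  simp only [TensorProduct.map_id, LinearMap.id_comp] at e1
  rw [e1, ← LinearMap.comp_assoc _ _
    (TensorProduct.map LinearMap.id M.cons), M.braiding_cons, LinearMap.comp_assoc,
    ← TensorProduct.map_comp, ← TensorProduct.map_comp, M.p_cons]

theorem braiding_p_unit (n : ℕ) :
    M.D.braiding ∘ₗ TensorProduct.map (M.p (n + 1)) LinearMap.id ∘ₗ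
        TensorProduct.map M.unit LinearMap.id =
      appendElt R M.D.one ∘ₗ (TensorProduct.lid k R).toLinearMap :=
  TensorProduct.ext' fun r u => by
    simp [M.p_one, ← TensorProduct.smul_tmul', M.braiding_one]

theorem braiding_V : Intertwines (crossR M.τ M.τ) (crossR M.τ M.τ) LinearMap.id M.D.braiding := by
  refine (M.cover.rTensor R).intertwines_right
    (x₁ := crossR (TensorProduct.comm k V k).toLinearMap M.τ)
    (x₂ := crossR (crossR σ (crossR M.τ M.τ)) M.τ) (M.unit_V.crossR Intertwines.id)
    (M.τ_cons.crossR Intertwines.id) (fun n => ?_) (fun n ih => ?_)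
  · rw [braiding_p_unit]
    exact M.unit_V.append_right.comp_right (Intertwines.lid_right M.τ)
  · rw [braiding_p_cons]
    exact (Intertwines.id.crossR M.τ_cons).comp_right (intertwines_right_crossL M.τ_V
      (intertwines_right_crossL ih ih))

theorem mul_p_cons (n : ℕ) :
    M.D.mul ∘ₗ TensorProduct.map (M.p (n + 1)) LinearMap.id ∘ₗ
        TensorProduct.map M.cons LinearMap.id =
      M.cons ∘ₗ TensorProduct.map LinearMap.id (TensorProduct.map (M.p n)
        (M.D.mul ∘ₗ TensorProduct.map (M.p n) LinearMap.id)) ∘ₗ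
        TensorProduct.map LinearMap.id (TensorProduct.assoc k R R R).toLinearMap ∘ₗ
        (TensorProduct.assoc k V (R ⊗[k] R) R).toLinearMap := by
  rw [← TensorProduct.map_comp, M.p_cons]
  refine TensorProduct.ext' fun z x => ?_
  induction z using TensorProduct.induction_on with
  | zero => simp
  | add a b ha hb => simp only [TensorProduct.add_tmul, map_add, ha, hb]
  | tmul v z =>
  induction z using TensorProduct.induction_on with
  | zero => simp
  | add a b ha hb => simp only [TensorProduct.tmul_add, TensorProduct.add_tmul, map_add, ha, hb]
  | tmul F G => simp [M.cons_mul]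

theorem mul_p_unit (n : ℕ) :
    M.D.mul ∘ₗ TensorProduct.map (M.p (n + 1)) LinearMap.id ∘ₗ
        TensorProduct.map M.unit LinearMap.id = (TensorProduct.lid k R).toLinearMap :=
  TensorProduct.ext' fun r u => by
    simp [M.p_one, ← TensorProduct.smul_tmul', M.one_mul]

theorem mul_V : Intertwines (crossR M.τ M.τ) M.τ LinearMap.id M.D.mul := by
  refine (M.cover.rTensor R).intertwines_right
    (x₁ := crossR (TensorProduct.comm k V k).toLinearMap M.τ)
    (x₂ := crossR (crossR σ (crossR M.τ M.τ)) M.τ) (M.unit_V.crossR Intertwines.id)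
    (M.τ_cons.crossR Intertwines.id) (fun n => ?_) (fun n ih => ?_)
  · rw [mul_p_unit]
    exact Intertwines.lid_right M.τ
  · rw [mul_p_cons]
    exact M.τ_cons.comp_right ((Intertwines.id.crossR ((M.p_V n).crossR ih)).comp_right
      ((Intertwines.id.crossR (Intertwines.assoc_right _ _ _)).comp_right
        (Intertwines.assoc_right _ _ _)))

theorem graft_V : Intertwines (crossR σ M.τ) M.τ LinearMap.id M.graft :=
  M.τ_cons.comp_right (Intertwines.id.crossR M.unit_V.append_right)

/-! #### Crossings over `R` -/

theorem unit_R : Intertwines (TensorProduct.comm k k R).toLinearMap M.D.braiding M.unit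
    LinearMap.id :=
  TensorProduct.ext' fun r u => by simp [M.braiding_one, ← TensorProduct.smul_tmul']

theorem p_R (n : ℕ) : Intertwines M.D.braiding M.D.braiding (M.p n) LinearMap.id := by
  induction n with
  | zero => rw [M.cover.zero]; exact Intertwines.zero_left
  | succ n ih =>
    refine M.cover.intertwines_left_of_surj M.unit_R M.braiding_cons ?_ ?_
    · rw [p_comp_unit]; exact M.unit_R
    · rw [M.p_cons]
      exact M.braiding_cons.comp_left (Intertwines.id.crossL (ih.crossL ih))

theorem τ_R : Intertwines (crossL M.τ M.D.braiding) (crossL M.D.braiding M.τ) M.τ LinearMap.id :=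
  intertwines_right_iff_left.1 M.braiding_V

theorem braiding_R : Intertwines (crossL M.D.braiding M.D.braiding)
    (crossL M.D.braiding M.D.braiding) M.D.braiding LinearMap.id := by
  refine (M.cover.rTensor R).intertwines_left
    (x₁ := crossL (TensorProduct.comm k k R).toLinearMap M.D.braiding)
    (x₂ := crossL (crossL M.τ (crossL M.D.braiding M.D.braiding)) M.D.braiding)
    (M.unit_R.crossL Intertwines.id)
    (M.braiding_cons.crossL Intertwines.id) (fun n => ?_) (fun n ih => ?_)
  · rw [braiding_p_unit]
    exact M.unit_R.append_left.comp_left (Intertwines.lid_left _)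
  · rw [braiding_p_cons]
    exact (Intertwines.id.crossL M.braiding_cons).comp_left (intertwines_left_crossL M.τ_R
      (intertwines_left_crossL ih ih))

theorem mul_R : Intertwines (crossL M.D.braiding M.D.braiding) M.D.braiding M.D.mul
    LinearMap.id := by
  refine (M.cover.rTensor R).intertwines_left
    (x₁ := crossL (TensorProduct.comm k k R).toLinearMap M.D.braiding)
    (x₂ := crossL (crossL M.τ (crossL M.D.braiding M.D.braiding)) M.D.braiding)
    (M.unit_R.crossL Intertwines.id)
    (M.braiding_cons.crossL Intertwines.id) (fun n => ?_) (fun n ih => ?_)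
  · rw [mul_p_unit]
    exact Intertwines.lid_left _
  · rw [mul_p_cons]
    exact M.braiding_cons.comp_left ((Intertwines.id.crossL ((M.p_R n).crossL ih)).comp_left
      ((Intertwines.id.crossL (Intertwines.assoc_left _ _ _)).comp_left
        (Intertwines.assoc_left _ _ _)))

theorem graft_R : Intertwines (crossL M.τ M.D.braiding) M.D.braiding M.graft LinearMap.id :=
  M.braiding_cons.comp_left (Intertwines.id.crossL M.unit_R.append_left)

/-- A map crossed by `V` is crossed by `R`. -/
theorem lift_V {A B : Type*} [AddCommGroup A] [Module k A] [AddCommGroup B] [Module k B]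
    {t : V ⊗[k] A →ₗ[k] A ⊗[k] V} {t' : V ⊗[k] B →ₗ[k] B ⊗[k] V}
    {s : R ⊗[k] A →ₗ[k] A ⊗[k] R} {s' : R ⊗[k] B →ₗ[k] B ⊗[k] R}
    (hs₁ : Intertwines (TensorProduct.comm k k A).toLinearMap s M.unit LinearMap.id)
    (hs₂ : Intertwines (crossL t (crossL s s)) s M.cons LinearMap.id)
    (hs₁' : Intertwines (TensorProduct.comm k k B).toLinearMap s' M.unit LinearMap.id)
    (hs₂' : Intertwines (crossL t' (crossL s' s')) s' M.cons LinearMap.id)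
    {f : A →ₗ[k] B} (hf : Intertwines t t' LinearMap.id f) :
    Intertwines s s' LinearMap.id f := by
  refine M.cover.intertwines_left hs₁ hs₂ (fun n => ?_) (fun n ih => ?_)
  · rw [LinearMap.id_comp, p_comp_unit]
    have : Intertwines (TensorProduct.comm k k A).toLinearMap (TensorProduct.comm k k B).toLinearMap
        LinearMap.id f := TensorProduct.ext' fun r a => by simp
    have h := hs₁'.comp_left this
    rwa [LinearMap.comp_id] at h
  · rw [LinearMap.id_comp, M.p_cons]
    rw [LinearMap.id_comp] at ih
    exact hs₂'.comp_left (hf.crossL (ih.crossL ih))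

theorem crossR_unit : Intertwines (TensorProduct.comm k k (R ⊗[k] R)).toLinearMap
    (crossR M.D.braiding M.D.braiding) M.unit LinearMap.id :=
  tensor_ext_right fun r a b => by
    simp [← TensorProduct.smul_tmul', crossR_tmul, M.braiding_one, crossRSnd_tmul]

theorem crossR_cons : Intertwines (crossL (crossR M.τ M.τ)
      (crossL (crossR M.D.braiding M.D.braiding) (crossR M.D.braiding M.D.braiding)))
    (crossR M.D.braiding M.D.braiding) M.cons LinearMap.id := by
  have h := M.braiding_cons.crossR M.braiding_cons
  rw [crossR_crossL, crossR_crossL, TensorProduct.map_id] at h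
  exact h

theorem mul_L : Intertwines (crossR M.D.braiding M.D.braiding) M.D.braiding LinearMap.id M.D.mul :=
  M.lift_V M.crossR_unit M.crossR_cons M.unit_R M.braiding_cons M.mul_V

/-! #### The coproduct -/

theorem comul_p_cons (n : ℕ) : M.D.comul ∘ₗ M.p (n + 1) ∘ₗ M.cons =
    M.D.mul₂ ∘ₗ TensorProduct.map
      (appendElt R M.D.one ∘ₗ M.graft ∘ₗ TensorProduct.map LinearMap.id (M.p n) +
        M.graft₂ ∘ₗ TensorProduct.map LinearMap.id (M.D.comul ∘ₗ M.p n)) (M.D.comul ∘ₗ M.p n) ∘ₗ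
      (TensorProduct.assoc k V R R).symm.toLinearMap := by
  rw [M.p_cons]
  refine tensor_ext_right fun v F G => ?_
  simp [comul_cons']

theorem comul_p_unit (n : ℕ) : M.D.comul ∘ₗ M.p (n + 1) ∘ₗ M.unit =
    appendElt R M.D.one ∘ₗ M.unit := by
  ext; simp [M.p_one, M.comul_one]

theorem graft₂_V : Intertwines (crossR σ (crossR M.τ M.τ)) (crossR M.τ M.τ) LinearMap.id M.graft₂ :=
  (Intertwines.id.crossR M.graft_V).comp_right (M.τ_V.onFirst_right M.τ)

theorem graft₂_R : Intertwines (crossL M.τ (crossL M.D.braiding M.D.braiding))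
    (crossL M.D.braiding M.D.braiding) M.graft₂ LinearMap.id :=
  (Intertwines.id.crossL M.graft_R).comp_left (M.τ_R.onFirst_left M.D.braiding)

theorem mul₂_V : Intertwines (crossR (crossR M.τ M.τ) (crossR M.τ M.τ)) (crossR M.τ M.τ)
    LinearMap.id M.D.mul₂ :=
  (M.mul_V.crossR M.mul_V).comp_right (M.braiding_V.onMiddle_right M.τ M.τ)

theorem mul₂_R : Intertwines (crossL (crossL M.D.braiding M.D.braiding)
      (crossL M.D.braiding M.D.braiding)) (crossL M.D.braiding M.D.braiding)
    M.D.mul₂ LinearMap.id :=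
  (M.mul_R.crossL M.mul_R).comp_left (M.braiding_R.onMiddle_left M.D.braiding M.D.braiding)

theorem comul_V : Intertwines M.τ (crossR M.τ M.τ) LinearMap.id M.D.comul := by
  refine M.cover.intertwines_right M.unit_V M.τ_cons (fun n => ?_) (fun n ih => ?_)
  · rw [comul_p_unit]
    exact M.unit_V.append_right.comp_right M.unit_V
  · rw [comul_p_cons]
    refine M.mul₂_V.comp_right ((Intertwines.crossR (Intertwines.add_right ?_ ?_) ih).comp_right
      (Intertwines.assoc_right _ _ _).symm_right)
    · exact M.unit_V.append_right.comp_right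
        (M.graft_V.comp_right (Intertwines.id.crossR (M.p_V n)))
    · exact M.graft₂_V.comp_right (Intertwines.id.crossR ih)

theorem comul_R : Intertwines M.D.braiding (crossL M.D.braiding M.D.braiding) M.D.comul
    LinearMap.id := by
  refine M.cover.intertwines_left M.unit_R M.braiding_cons (fun n => ?_) (fun n ih => ?_)
  · rw [comul_p_unit]
    exact M.unit_R.append_left.comp_left M.unit_R
  · rw [comul_p_cons]
    refine M.mul₂_R.comp_left ((Intertwines.crossL (Intertwines.add_left ?_ ?_) ih).comp_left
      (Intertwines.assoc_left _ _ _).symm_left)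
    · exact M.unit_R.append_left.comp_left
        (M.graft_R.comp_left (Intertwines.id.crossL (M.p_R n)))
    · exact M.graft₂_R.comp_left (Intertwines.id.crossL ih)

theorem comul_L : Intertwines M.D.braiding (crossR M.D.braiding M.D.braiding) LinearMap.id
    M.D.comul :=
  M.lift_V M.unit_R M.braiding_cons M.crossR_unit M.crossR_cons M.comul_V

theorem counit_V : Intertwines M.τ (TensorProduct.comm k V k).toLinearMap LinearMap.id
    M.D.counit := by
  refine M.cover.intertwines_right_of_surj M.unit_V M.τ_cons ?_ ?_
  · have : M.D.counit ∘ₗ M.unit = LinearMap.id := by ext; simp [M.counit_one]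
    rw [this]; exact Intertwines.id
  · have : M.D.counit ∘ₗ M.cons = 0 := by ext1; ext; simp [M.counit_cons]
    rw [this]; exact Intertwines.zero_right

theorem counit_R : Intertwines M.D.braiding (TensorProduct.comm k k R).toLinearMap M.D.counit
    LinearMap.id := by
  refine M.cover.intertwines_left_of_surj M.unit_R M.braiding_cons ?_ ?_
  · have : M.D.counit ∘ₗ M.unit = LinearMap.id := by ext; simp [M.counit_one]
    rw [this]; exact Intertwines.id
  · have : M.D.counit ∘ₗ M.cons = 0 := by ext1; ext; simp [M.counit_cons]
    rw [this]; exact Intertwines.zero_left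

theorem comm_cons : Intertwines (crossL (TensorProduct.comm k V k).toLinearMap
      (crossL (TensorProduct.comm k R k).toLinearMap (TensorProduct.comm k R k).toLinearMap))
    (TensorProduct.comm k R k).toLinearMap M.cons LinearMap.id := by
  refine TensorProduct.ext' fun z r => ?_
  induction z using TensorProduct.induction_on with
  | zero => simp
  | add a b ha hb => simp only [TensorProduct.add_tmul, map_add, ha, hb]
  | tmul v z =>
  induction z using TensorProduct.induction_on with
  | zero => simp
  | add a b ha hb => simp only [TensorProduct.tmul_add, TensorProduct.add_tmul, map_add, ha, hb]
  | tmul F G => simp [crossL_tmul, crossLSnd_tmul]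

theorem counit_L : Intertwines M.D.braiding (TensorProduct.comm k R k).toLinearMap LinearMap.id
    M.D.counit :=
  M.lift_V M.unit_R M.braiding_cons (TensorProduct.ext' fun r s => by simp) M.comm_cons M.counit_V

end ForestModel

/-! ### Twisted tensor products -/

section Twisted

variable {k : Type*} [CommRing k] {A B N A' B' N' : Type*}
  [AddCommGroup A] [Module k A] [AddCommGroup B] [Module k B] [AddCommGroup N] [Module k N]
  [AddCommGroup A'] [Module k A'] [AddCommGroup B'] [Module k B'] [AddCommGroup N'] [Module k N']

/-- The action of `A ⊗ B` on `A ⊗ N`, where `A` is an algebra and `B` acts on `N`, by means of a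
crossing `x` of `B` over `A`. -/
def twistedAct (μ : A ⊗[k] A →ₗ[k] A) (act : B ⊗[k] N →ₗ[k] N) (x : B ⊗[k] A →ₗ[k] A ⊗[k] B) :
    (A ⊗[k] B) ⊗[k] (A ⊗[k] N) →ₗ[k] A ⊗[k] N :=
  TensorProduct.map μ act ∘ₗ onMiddle A N x

/-- `a' ⊗ b' ↦ a a' ⊗ b' n`. -/
def sandwich (μ : A ⊗[k] A →ₗ[k] A) (act : B ⊗[k] N →ₗ[k] N) (a : A) (n : N) :
    A ⊗[k] B →ₗ[k] A ⊗[k] N :=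
  TensorProduct.map (μ ∘ₗ TensorProduct.mk k A A a) (act ∘ₗ (TensorProduct.mk k B N).flip n)

@[simp]
theorem sandwich_tmul (μ : A ⊗[k] A →ₗ[k] A) (act : B ⊗[k] N →ₗ[k] N) (a a' : A) (n : N) (b : B) :
    sandwich μ act a n (a' ⊗ₜ b) = μ (a ⊗ₜ a') ⊗ₜ act (b ⊗ₜ n) := by
  simp [sandwich]

theorem onMiddle_tmul {C D E F : Type*} [AddCommGroup C] [Module k C] [AddCommGroup D] [Module k D]
    [AddCommGroup E] [Module k E] [AddCommGroup F] [Module k F]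
    (f : B ⊗[k] C →ₗ[k] D ⊗[k] E) (a : A) (b : B) (c : C) (e : F) :
    onMiddle A F f ((a ⊗ₜ b) ⊗ₜ (c ⊗ₜ e)) =
      TensorProduct.map (TensorProduct.mk k A D a) ((TensorProduct.mk k E F).flip e)
        (f (b ⊗ₜ c)) := by
  simp only [onMiddle, LinearMap.comp_apply, LinearEquiv.coe_coe, TensorProduct.assoc_tmul,
    LinearMap.lTensor_tmul, onFirst_tmul]
  induction f (b ⊗ₜ c) using TensorProduct.induction_on with
  | zero => simp
  | add p q hp hq => simp only [map_add, TensorProduct.add_tmul, TensorProduct.tmul_add, hp, hq]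
  | tmul p q => simp

theorem twistedAct_tmul (μ : A ⊗[k] A →ₗ[k] A) (act : B ⊗[k] N →ₗ[k] N)
    (x : B ⊗[k] A →ₗ[k] A ⊗[k] B) (a a' : A) (b : B) (n : N) :
    twistedAct μ act x ((a ⊗ₜ b) ⊗ₜ (a' ⊗ₜ n)) = sandwich μ act a n (x (b ⊗ₜ a')) := by
  rw [twistedAct, LinearMap.comp_apply, onMiddle_tmul, ← LinearMap.comp_apply,
    ← TensorProduct.map_comp]
  rfl

theorem twistedAct_assoc {μ : A ⊗[k] A →ₗ[k] A} {ν : B ⊗[k] B →ₗ[k] B} {act : B ⊗[k] N →ₗ[k] N}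
    {x : B ⊗[k] A →ₗ[k] A ⊗[k] B}
    (hμ : ∀ a b c, μ (μ (a ⊗ₜ b) ⊗ₜ c) = μ (a ⊗ₜ μ (b ⊗ₜ c)))
    (hact : ∀ a b n, act (ν (a ⊗ₜ b) ⊗ₜ n) = act (a ⊗ₜ act (b ⊗ₜ n)))
    (hxμ : Intertwines (crossR x x) x LinearMap.id μ)
    (hxν : Intertwines (crossL x x) x ν LinearMap.id) (X Y : A ⊗[k] B) (Z : A ⊗[k] N) :
    twistedAct μ act x (twistedAct μ ν x (X ⊗ₜ Y) ⊗ₜ Z) =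
      twistedAct μ act x (X ⊗ₜ twistedAct μ act x (Y ⊗ₜ Z)) := by
  induction X using TensorProduct.induction_on with
  | zero => simp
  | add p q hp hq => simp only [map_add, TensorProduct.add_tmul, hp, hq]
  | tmul a b =>
  induction Y using TensorProduct.induction_on with
  | zero => simp
  | add p q hp hq => simp only [map_add, TensorProduct.add_tmul, TensorProduct.tmul_add, hp, hq]
  | tmul a₁ b₁ =>
  induction Z using TensorProduct.induction_on with
  | zero => simp
  | add p q hp hq => simp only [map_add, TensorProduct.tmul_add, hp, hq]
  | tmul a₂ n =>
  rw [twistedAct_tmul, twistedAct_tmul]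
  have h1 : ∀ z, twistedAct μ act x (sandwich μ ν a b₁ z ⊗ₜ (a₂ ⊗ₜ n)) =
      sandwich μ act a n (twistedAct μ ν x (z ⊗ₜ x (b₁ ⊗ₜ a₂))) := by
    intro z
    induction z using TensorProduct.induction_on with
    | zero => simp
    | add p q hp hq => simp only [map_add, TensorProduct.add_tmul, hp, hq]
    | tmul p q =>
      have := hxν.apply ((q ⊗ₜ b₁) ⊗ₜ a₂)
      rw [TensorProduct.map_tmul, LinearMap.id_apply, crossL_tmul] at this
      rw [sandwich_tmul, twistedAct_tmul, ← this]
      induction x (b₁ ⊗ₜ a₂) using TensorProduct.induction_on with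
      | zero => simp
      | add p q hp hq => simp only [map_add, TensorProduct.tmul_add, hp, hq]
      | tmul r s =>
        rw [crossLSnd_tmul, twistedAct_tmul]
        induction x (q ⊗ₜ r) using TensorProduct.induction_on with
        | zero => simp
        | add p q hp hq => simp only [map_add, TensorProduct.add_tmul, hp, hq]
        | tmul r s => simp [hμ, hact]
  have h2 : ∀ w, twistedAct μ act x ((a ⊗ₜ b) ⊗ₜ sandwich μ act a₁ n w) =
      sandwich μ act a n (twistedAct μ ν x (x (b ⊗ₜ a₁) ⊗ₜ w)) := by
    intro w
    induction w using TensorProduct.induction_on with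
    | zero => simp
    | add p q hp hq => simp only [map_add, TensorProduct.tmul_add, hp, hq]
    | tmul r s =>
      have := hxμ.apply (b ⊗ₜ (a₁ ⊗ₜ r))
      rw [TensorProduct.map_tmul, LinearMap.id_apply, crossR_tmul] at this
      rw [sandwich_tmul, twistedAct_tmul, ← this]
      induction x (b ⊗ₜ a₁) using TensorProduct.induction_on with
      | zero => simp
      | add p q hp hq => simp only [map_add, TensorProduct.add_tmul, hp, hq]
      | tmul p q =>
        rw [crossRSnd_tmul, twistedAct_tmul]
        induction x (q ⊗ₜ r) using TensorProduct.induction_on with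
        | zero => simp
        | add p q hp hq => simp only [map_add, TensorProduct.tmul_add, hp, hq]
        | tmul r s => simp [hact]
  rw [h1, h2]

theorem map_twistedAct {μ : A ⊗[k] A →ₗ[k] A} {act : B ⊗[k] N →ₗ[k] N}
    {x : B ⊗[k] A →ₗ[k] A ⊗[k] B} {μ' : A' ⊗[k] A' →ₗ[k] A'} {act' : B' ⊗[k] N' →ₗ[k] N'}
    {x' : B' ⊗[k] A' →ₗ[k] A' ⊗[k] B'} {f : A →ₗ[k] A'} {g : B →ₗ[k] B'} {h : N →ₗ[k] N'}
    (hμ : ∀ a b, f (μ (a ⊗ₜ b)) = μ' (f a ⊗ₜ f b))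
    (hact : ∀ b n, h (act (b ⊗ₜ n)) = act' (g b ⊗ₜ h n))
    (hx : Intertwines x x' g f) (X : A ⊗[k] B) (Y : A ⊗[k] N) :
    TensorProduct.map f h (twistedAct μ act x (X ⊗ₜ Y)) =
      twistedAct μ' act' x' (TensorProduct.map f g X ⊗ₜ TensorProduct.map f h Y) := by
  induction X using TensorProduct.induction_on with
  | zero => simp
  | add p q hp hq => simp only [map_add, TensorProduct.add_tmul, hp, hq]
  | tmul a b =>
  induction Y using TensorProduct.induction_on with
  | zero => simp
  | add p q hp hq => simp only [map_add, TensorProduct.tmul_add, hp, hq]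
  | tmul a' n =>
  have := hx.apply (b ⊗ₜ a')
  rw [TensorProduct.map_tmul] at this
  rw [TensorProduct.map_tmul, TensorProduct.map_tmul, twistedAct_tmul, twistedAct_tmul, ← this]
  induction x (b ⊗ₜ a') using TensorProduct.induction_on with
  | zero => simp
  | add p q hp hq => simp only [map_add, hp, hq]
  | tmul p q => simp [hμ, hact]

end Twisted

namespace ForestModel

variable {k V R : Type*} [CommRing k] [AddCommGroup V] [Module k V]
    [AddCommGroup R] [Module k R] {σ : V ⊗[k] V →ₗ[k] V ⊗[k] V} (M : ForestModel R σ)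

theorem mul_assoc (a b c : R) : M.D.mul (M.D.mul (a ⊗ₜ b) ⊗ₜ c) =
    M.D.mul (a ⊗ₜ M.D.mul (b ⊗ₜ c)) := by
  induction a using M.induction with
  | hadd x y hx hy => simp only [TensorProduct.add_tmul, map_add, hx, hy]
  | hsmul r x hx => simp only [← TensorProduct.smul_tmul', map_smul, hx]
  | hone => simp only [M.one_mul]
  | hcons v F G hF hG => simp only [M.cons_mul, hG]

theorem mul_one (a : R) : M.D.mul (a ⊗ₜ M.D.one) = a := by
  induction a using M.induction with
  | hadd x y hx hy => simp only [TensorProduct.add_tmul, map_add, hx, hy]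
  | hsmul r x hx => simp only [← TensorProduct.smul_tmul', map_smul, hx]
  | hone => simp only [M.one_mul]
  | hcons v F G hF hG => simp only [M.cons_mul, hG]

theorem braiding_one_right (a : R) : M.D.braiding (a ⊗ₜ M.D.one) = M.D.one ⊗ₜ a := by
  have h : Intertwines (TensorProduct.comm k R k).toLinearMap M.D.braiding LinearMap.id M.unit :=
    M.lift_V (TensorProduct.ext' fun r s => by simp) M.comm_cons M.unit_R M.braiding_cons M.unit_V
  have := h.apply (a ⊗ₜ 1)
  simpa using this.symm

theorem isBraidedAlgebra : IsBraidedAlgebra M.D where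
  braid := isBraiding_iff.2 (intertwines_right_iff_left.2 M.braiding_R)
  mul_assoc := tensor_ext_left fun a b c => by simpa using M.mul_assoc a b c
  one_mul := M.one_mul
  mul_one := M.mul_one
  braiding_mul_right := M.mul_L.symm
  braiding_mul_left := tensor_ext_right fun a b c => by
    have := M.mul_R.apply ((a ⊗ₜ b) ⊗ₜ c)
    simp only [crossL, LinearMap.comp_apply, LinearEquiv.coe_coe, TensorProduct.assoc_tmul] at this
    simp only [LinearMap.comp_apply, LinearEquiv.coe_coe, TensorProduct.assoc_symm_tmul]
    exact this.symm
  braiding_one_right := M.braiding_one_right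
  braiding_one_left := M.braiding_one

theorem mul₂_tmul (a b c d : R) : M.D.mul₂ ((a ⊗ₜ b) ⊗ₜ (c ⊗ₜ d)) =
    sandwich M.D.mul M.D.mul a d (M.D.braiding (b ⊗ₜ c)) :=
  twistedAct_tmul _ _ _ _ _ _ _

theorem mul₂_assoc (X Y Z : R ⊗[k] R) : M.D.mul₂ (M.D.mul₂ (X ⊗ₜ Y) ⊗ₜ Z) =
    M.D.mul₂ (X ⊗ₜ M.D.mul₂ (Y ⊗ₜ Z)) :=
  twistedAct_assoc M.mul_assoc M.mul_assoc M.mul_L M.mul_R X Y Z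

theorem one_mul₂ (X : R ⊗[k] R) : M.D.mul₂ ((M.D.one ⊗ₜ M.D.one) ⊗ₜ X) = X := by
  induction X using TensorProduct.induction_on with
  | zero => simp
  | add p q hp hq => simp only [map_add, TensorProduct.tmul_add, hp, hq]
  | tmul a b => rw [mul₂_tmul, M.braiding_one, sandwich_tmul, M.one_mul, M.one_mul]

theorem mul₂_one (X : R ⊗[k] R) : M.D.mul₂ (X ⊗ₜ (M.D.one ⊗ₜ M.D.one)) = X := by
  induction X using TensorProduct.induction_on with
  | zero => simp
  | add p q hp hq => simp only [map_add, TensorProduct.add_tmul, hp, hq]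
  | tmul a b => rw [mul₂_tmul, M.braiding_one_right, sandwich_tmul, M.mul_one, M.mul_one]

/-- The coproduct of a tree. -/
def treeCoprod (v : V) (F : R) : R ⊗[k] R :=
  M.graft (v ⊗ₜ F) ⊗ₜ M.D.one + M.graft₂ (v ⊗ₜ M.D.comul F)

theorem comul_cons_eq (v : V) (F G : R) : M.D.comul (M.cons (v ⊗ₜ (F ⊗ₜ G))) =
    M.D.mul₂ (M.treeCoprod v F ⊗ₜ M.D.comul G) := M.comul_cons' v F G

theorem comul_graft (v : V) (F : R) : M.D.comul (M.graft (v ⊗ₜ F)) = M.treeCoprod v F := by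
  rw [graft_tmul, comul_cons_eq, M.comul_one, mul₂_one]

theorem comul_mul (x y : R) : M.D.comul (M.D.mul (x ⊗ₜ y)) =
    M.D.mul₂ (M.D.comul x ⊗ₜ M.D.comul y) := by
  induction x using M.induction with
  | hadd x y hx hy => simp only [TensorProduct.add_tmul, map_add, hx, hy]
  | hsmul r x hx => simp only [← TensorProduct.smul_tmul', map_smul, hx]
  | hone => rw [M.one_mul, M.comul_one, one_mul₂]
  | hcons v F G hF hG => rw [M.cons_mul, comul_cons_eq, hG, comul_cons_eq, mul₂_assoc]

theorem counit_mul (x y : R) : M.D.counit (M.D.mul (x ⊗ₜ y)) = M.D.counit x * M.D.counit y := by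
  induction x using M.induction with
  | hadd x y hx hy => simp only [TensorProduct.add_tmul, map_add, hx, hy, add_mul]
  | hsmul r x hx => simp only [← TensorProduct.smul_tmul', map_smul, hx, smul_mul_assoc]
  | hone => rw [M.one_mul, M.counit_one, _root_.one_mul]
  | hcons v F G hF hG => rw [M.cons_mul, M.counit_cons, M.counit_cons, zero_mul]

/-! #### Coassociativity -/

/-- The product of `R ⊗ (R ⊗ R)`. -/
def mul₃ : (R ⊗[k] (R ⊗[k] R)) ⊗[k] (R ⊗[k] (R ⊗[k] R)) →ₗ[k] R ⊗[k] (R ⊗[k] R) :=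
  twistedAct M.D.mul M.D.mul₂ (crossL M.D.braiding M.D.braiding)

/-- The product of `(R ⊗ R) ⊗ R`. -/
def mul₃' : ((R ⊗[k] R) ⊗[k] R) ⊗[k] ((R ⊗[k] R) ⊗[k] R) →ₗ[k] (R ⊗[k] R) ⊗[k] R :=
  twistedAct M.D.mul₂ M.D.mul (crossR M.D.braiding M.D.braiding)

theorem lTensor_comul_mul₂ (X Y : R ⊗[k] R) :
    TensorProduct.map LinearMap.id M.D.comul (M.D.mul₂ (X ⊗ₜ Y)) =
      M.mul₃ (TensorProduct.map LinearMap.id M.D.comul X ⊗ₜ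
        TensorProduct.map LinearMap.id M.D.comul Y) :=
  map_twistedAct (fun _ _ => rfl) M.comul_mul M.comul_R X Y

theorem rTensor_comul_mul₂ (X Y : R ⊗[k] R) :
    TensorProduct.map M.D.comul LinearMap.id (M.D.mul₂ (X ⊗ₜ Y)) =
      M.mul₃' (TensorProduct.map M.D.comul LinearMap.id X ⊗ₜ
        TensorProduct.map M.D.comul LinearMap.id Y) :=
  map_twistedAct M.comul_mul (fun _ _ => rfl) M.comul_L X Y

theorem assoc_mul₃' (X Y : (R ⊗[k] R) ⊗[k] R) :
    TensorProduct.assoc k R R R (M.mul₃' (X ⊗ₜ Y)) =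
      M.mul₃ (TensorProduct.assoc k R R R X ⊗ₜ TensorProduct.assoc k R R R Y) := by
  induction X using TensorProduct.induction_on with
  | zero => simp
  | add p q hp hq => simp only [map_add, TensorProduct.add_tmul, hp, hq]
  | tmul ab c =>
  induction ab using TensorProduct.induction_on with
  | zero => simp
  | add p q hp hq => simp only [map_add, TensorProduct.add_tmul, hp, hq]
  | tmul a b =>
  induction Y using TensorProduct.induction_on with
  | zero => simp
  | add p q hp hq => simp only [map_add, TensorProduct.tmul_add, hp, hq]
  | tmul ab' c' =>
  induction ab' using TensorProduct.induction_on with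
  | zero => simp
  | add p q hp hq => simp only [map_add, TensorProduct.add_tmul, TensorProduct.tmul_add, hp, hq]
  | tmul a' b' =>
  rw [mul₃', mul₃, twistedAct_tmul, TensorProduct.assoc_tmul, TensorProduct.assoc_tmul,
    twistedAct_tmul, crossR_tmul, crossL_tmul]
  induction M.D.braiding (c ⊗ₜ a') using TensorProduct.induction_on with
  | zero => simp
  | add p q hp hq => simp only [map_add, hp, hq]
  | tmul p q =>
    rw [crossRSnd_tmul, crossLSnd_tmul]
    let J : R ⊗[k] R → (R →ₗ[k] R ⊗[k] R) := fun u =>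
      TensorProduct.map M.D.mul (M.D.mul ∘ₗ (TensorProduct.mk k R R).flip c') ∘ₗ
        (TensorProduct.assoc k R R R).symm.toLinearMap ∘ₗ (TensorProduct.mk k R (R ⊗[k] R)).flip u
    have hJ : ∀ u y, sandwich M.D.mul M.D.mul y c' u = J u y := by
      intro u y
      induction u using TensorProduct.induction_on with
      | zero => simp [J]
      | add p q hp hq => rw [map_add, hp, hq]; simp only [J, map_add, LinearMap.comp_add,
          LinearMap.add_apply]
      | tmul r s => simp [J]
    have h1 : ∀ w, sandwich M.D.mul M.D.mul₂ a (b' ⊗ₜ c') (TensorProduct.assoc k R R R (w ⊗ₜ q)) =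
        TensorProduct.map (M.D.mul ∘ₗ TensorProduct.mk k R R a) (J (M.D.braiding (q ⊗ₜ b'))) w := by
      intro w
      induction w using TensorProduct.induction_on with
      | zero => simp
      | add p q hp hq => simp only [map_add, TensorProduct.add_tmul, hp, hq]
      | tmul t y =>
        rw [TensorProduct.assoc_tmul, sandwich_tmul, mul₂_tmul, hJ]
        simp
    rw [h1]
    induction M.D.braiding (q ⊗ₜ b') using TensorProduct.induction_on with
    | zero => simp [J]
    | add p q hp hq =>
      have : J (p + q) = J p + J q := by simp only [J, map_add, LinearMap.comp_add]
      rw [this, TensorProduct.map_add_right, LinearMap.add_apply, ← hp, ← hq]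
      simp only [map_add, TensorProduct.tmul_add]
    | tmul r s =>
      rw [TensorProduct.assoc_symm_tmul, sandwich_tmul, mul₂_tmul]
      induction M.D.braiding (b ⊗ₜ p) using TensorProduct.induction_on with
      | zero => simp
      | add p q hp hq => simp only [map_add, TensorProduct.add_tmul, hp, hq]
      | tmul t y => simp [J]

/-- `v ⊗ F ⊗ G ⊗ H ↦ F ⊗ G ⊗ B⁺_v(H)`, with `v` crossing `F` and `G`. -/
def graft₃ : V ⊗[k] (R ⊗[k] (R ⊗[k] R)) →ₗ[k] R ⊗[k] (R ⊗[k] R) :=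
  TensorProduct.map LinearMap.id M.graft₂ ∘ₗ onFirst (R ⊗[k] R) M.τ

theorem graft₂_tmul (v : V) (a b : R) : M.graft₂ (v ⊗ₜ (a ⊗ₜ b)) =
    TensorProduct.map LinearMap.id (M.graft ∘ₗ (TensorProduct.mk k V R).flip b)
      (M.τ (v ⊗ₜ a)) := by
  rw [graft₂, LinearMap.comp_apply, onFirst_tmul]
  induction M.τ (v ⊗ₜ a) using TensorProduct.induction_on with
  | zero => simp
  | add p q hp hq => simp only [map_add, TensorProduct.add_tmul, hp, hq]
  | tmul p q => simp

theorem graft₃_tmul (v : V) (a : R) (z : R ⊗[k] R) : M.graft₃ (v ⊗ₜ (a ⊗ₜ z)) =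
    TensorProduct.map LinearMap.id (M.graft₂ ∘ₗ (TensorProduct.mk k V (R ⊗[k] R)).flip z)
      (M.τ (v ⊗ₜ a)) := by
  rw [graft₃, LinearMap.comp_apply, onFirst_tmul]
  induction M.τ (v ⊗ₜ a) using TensorProduct.induction_on with
  | zero => simp
  | add p q hp hq => simp only [map_add, TensorProduct.add_tmul, hp, hq]
  | tmul p q => simp

theorem graft₃_assoc (v : V) (z : R ⊗[k] R) (b : R) :
    M.graft₃ (v ⊗ₜ TensorProduct.assoc k R R R (z ⊗ₜ b)) =
      TensorProduct.assoc k R R R (TensorProduct.map LinearMap.id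
        (M.graft ∘ₗ (TensorProduct.mk k V R).flip b) (crossR M.τ M.τ (v ⊗ₜ z))) := by
  induction z using TensorProduct.induction_on with
  | zero => simp
  | add p q hp hq => simp only [map_add, TensorProduct.add_tmul, TensorProduct.tmul_add, hp, hq]
  | tmul a c =>
    rw [TensorProduct.assoc_tmul, graft₃_tmul, crossR_tmul]
    induction M.τ (v ⊗ₜ a) using TensorProduct.induction_on with
    | zero => simp
    | add p q hp hq => simp only [map_add, hp, hq]
    | tmul p q =>
      simp only [TensorProduct.map_tmul, LinearMap.comp_apply, LinearMap.flip_apply,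
        TensorProduct.mk_apply, graft₂_tmul, crossRSnd_tmul, LinearMap.id_apply]
      induction M.τ (q ⊗ₜ c) using TensorProduct.induction_on with
      | zero => simp
      | add p q hp hq => simp only [map_add, TensorProduct.tmul_add, hp, hq]
      | tmul p q => simp

theorem rTensor_comul_graft₂ (v : V) (z : R ⊗[k] R) :
    TensorProduct.assoc k R R R (TensorProduct.map M.D.comul LinearMap.id (M.graft₂ (v ⊗ₜ z))) =
      M.graft₃ (v ⊗ₜ TensorProduct.assoc k R R R (TensorProduct.map M.D.comul LinearMap.id z)) := by
  induction z using TensorProduct.induction_on with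
  | zero => simp
  | add p q hp hq => simp only [map_add, TensorProduct.tmul_add, hp, hq]
  | tmul a b =>
    have h := M.comul_V.apply (v ⊗ₜ a)
    rw [TensorProduct.map_tmul, LinearMap.id_apply] at h
    rw [TensorProduct.map_tmul, LinearMap.id_apply, graft₃_assoc, ← h, graft₂_tmul]
    induction M.τ (v ⊗ₜ a) using TensorProduct.induction_on with
    | zero => simp
    | add p q hp hq => simp only [map_add, hp, hq]
    | tmul p q => simp

theorem lTensor_comul_graft₂ (v : V) (z : R ⊗[k] R) :
    TensorProduct.map LinearMap.id M.D.comul (M.graft₂ (v ⊗ₜ z)) =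
      TensorProduct.assoc k R R R (M.graft₂ (v ⊗ₜ z) ⊗ₜ M.D.one) +
      M.graft₃ (v ⊗ₜ TensorProduct.map LinearMap.id M.D.comul z) := by
  induction z using TensorProduct.induction_on with
  | zero => simp
  | add p q hp hq =>
    simp only [map_add, TensorProduct.tmul_add, TensorProduct.add_tmul, hp, hq]; abel
  | tmul a b =>
    rw [graft₂_tmul, TensorProduct.map_tmul, graft₃_tmul, LinearMap.id_apply]
    induction M.τ (v ⊗ₜ a) using TensorProduct.induction_on with
    | zero => simp
    | add p q hp hq => simp only [map_add, TensorProduct.add_tmul, hp, hq]; abel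
    | tmul p q => simp [comul_graft, treeCoprod, TensorProduct.tmul_add]

theorem coassoc (x : R) :
    TensorProduct.assoc k R R R (TensorProduct.map M.D.comul LinearMap.id (M.D.comul x)) =
      TensorProduct.map LinearMap.id M.D.comul (M.D.comul x) := by
  induction x using M.induction with
  | hadd x y hx hy => simp only [map_add, hx, hy]
  | hsmul r x hx => simp only [map_smul, hx]
  | hone => simp [M.comul_one]
  | hcons v F G hF hG =>
    rw [comul_cons_eq, rTensor_comul_mul₂, lTensor_comul_mul₂, assoc_mul₃', hG]
    congr 2
    rw [treeCoprod, map_add, map_add, map_add, rTensor_comul_graft₂, lTensor_comul_graft₂, hF,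
      ← add_assoc]
    congr 1
    simp only [TensorProduct.map_tmul, comul_graft, treeCoprod, LinearMap.id_apply, M.comul_one,
      TensorProduct.add_tmul, map_add, TensorProduct.assoc_tmul]

/-! #### The counit -/

/-- `ε ⊗ id`. -/
def counitLeft : R ⊗[k] R →ₗ[k] R :=
  (TensorProduct.lid k R).toLinearMap ∘ₗ TensorProduct.map M.D.counit LinearMap.id

/-- `id ⊗ ε`. -/
def counitRight : R ⊗[k] R →ₗ[k] R :=
  (TensorProduct.rid k R).toLinearMap ∘ₗ TensorProduct.map LinearMap.id M.D.counit

@[simp]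
theorem counitLeft_tmul (a b : R) : M.counitLeft (a ⊗ₜ b) = M.D.counit a • b := by
  simp [counitLeft]

@[simp]
theorem counitRight_tmul (a b : R) : M.counitRight (a ⊗ₜ b) = M.D.counit b • a := by
  simp [counitRight]

theorem counitLeft_braiding (a b : R) :
    M.counitLeft (M.D.braiding (a ⊗ₜ b)) = M.D.counit b • a := by
  rw [counitLeft, LinearMap.comp_apply, M.counit_L.apply]
  simp

theorem counitRight_braiding (a b : R) :
    M.counitRight (M.D.braiding (a ⊗ₜ b)) = M.D.counit a • b := by
  rw [counitRight, LinearMap.comp_apply, M.counit_R.apply]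
  simp

theorem counitLeft_mul₂ (X Y : R ⊗[k] R) :
    M.counitLeft (M.D.mul₂ (X ⊗ₜ Y)) = M.D.mul (M.counitLeft X ⊗ₜ M.counitLeft Y) := by
  induction X using TensorProduct.induction_on with
  | zero => simp
  | add p q hp hq => simp only [map_add, TensorProduct.add_tmul, hp, hq]
  | tmul a b =>
  induction Y using TensorProduct.induction_on with
  | zero => simp
  | add p q hp hq => simp only [map_add, TensorProduct.tmul_add, hp, hq]
  | tmul c d =>
    have h : ∀ z, M.counitLeft (sandwich M.D.mul M.D.mul a d z) =
        M.D.counit a • M.D.mul (M.counitLeft z ⊗ₜ d) := by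
      intro z
      induction z using TensorProduct.induction_on with
      | zero => simp
      | add p q hp hq => simp only [map_add, TensorProduct.add_tmul, smul_add, hp, hq]
      | tmul p q => simp [counit_mul, mul_smul, ← TensorProduct.smul_tmul']
    rw [mul₂_tmul, h, counitLeft_braiding]
    simp [← TensorProduct.smul_tmul', smul_comm (M.D.counit a)]

theorem counitRight_mul₂ (X Y : R ⊗[k] R) :
    M.counitRight (M.D.mul₂ (X ⊗ₜ Y)) = M.D.mul (M.counitRight X ⊗ₜ M.counitRight Y) := by
  induction X using TensorProduct.induction_on with
  | zero => simp
  | add p q hp hq => simp only [map_add, TensorProduct.add_tmul, hp, hq]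
  | tmul a b =>
  induction Y using TensorProduct.induction_on with
  | zero => simp
  | add p q hp hq => simp only [map_add, TensorProduct.tmul_add, hp, hq]
  | tmul c d =>
    have h : ∀ z, M.counitRight (sandwich M.D.mul M.D.mul a d z) =
        M.D.counit d • M.D.mul (a ⊗ₜ M.counitRight z) := by
      intro z
      induction z using TensorProduct.induction_on with
      | zero => simp
      | add p q hp hq => simp only [map_add, TensorProduct.tmul_add, smul_add, hp, hq]
      | tmul p q => simp [counit_mul, mul_smul, smul_comm (M.D.counit q)]
    rw [mul₂_tmul, h, counitRight_braiding]
    simp [← TensorProduct.smul_tmul']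

theorem counit_graft (v : V) (F : R) : M.D.counit (M.graft (v ⊗ₜ F)) = 0 := by
  rw [graft_tmul, M.counit_cons]

theorem counitLeft_graft₂ (v : V) (z : R ⊗[k] R) :
    M.counitLeft (M.graft₂ (v ⊗ₜ z)) = M.graft (v ⊗ₜ M.counitLeft z) := by
  induction z using TensorProduct.induction_on with
  | zero => simp
  | add p q hp hq => simp only [map_add, TensorProduct.tmul_add, hp, hq]
  | tmul a b =>
    have h1 : ∀ z, M.counitLeft (TensorProduct.map LinearMap.id
        (M.graft ∘ₗ (TensorProduct.mk k V R).flip b) z) =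
        M.graft (TensorProduct.lid k V (TensorProduct.map M.D.counit LinearMap.id z) ⊗ₜ b) := by
      intro z
      induction z using TensorProduct.induction_on with
      | zero => simp
      | add p q hp hq => simp only [map_add, TensorProduct.add_tmul, hp, hq]
      | tmul p q => simp [← TensorProduct.smul_tmul']
    rw [graft₂_tmul, h1, M.counit_V.apply]
    simp [← TensorProduct.smul_tmul']

theorem counitRight_graft₂ (v : V) (z : R ⊗[k] R) : M.counitRight (M.graft₂ (v ⊗ₜ z)) = 0 := by
  induction z using TensorProduct.induction_on with
  | zero => simp
  | add p q hp hq => simp only [map_add, TensorProduct.tmul_add, hp, hq, add_zero]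
  | tmul a b =>
    rw [graft₂_tmul]
    induction M.τ (v ⊗ₜ a) using TensorProduct.induction_on with
    | zero => simp
    | add p q hp hq => simp only [map_add, hp, hq, add_zero]
    | tmul p q => simp [counit_graft]

theorem counitLeft_comul (x : R) : M.counitLeft (M.D.comul x) = x := by
  induction x using M.induction with
  | hadd x y hx hy => simp only [map_add, hx, hy]
  | hsmul r x hx => simp only [map_smul, hx]
  | hone => simp [M.comul_one, M.counit_one]
  | hcons v F G hF hG =>
    rw [comul_cons_eq, counitLeft_mul₂, hG, treeCoprod, map_add, counitLeft_graft₂, hF,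
      counitLeft_tmul, counit_graft, zero_smul, zero_add, graft_mul]

theorem counitRight_comul (x : R) : M.counitRight (M.D.comul x) = x := by
  induction x using M.induction with
  | hadd x y hx hy => simp only [map_add, hx, hy]
  | hsmul r x hx => simp only [map_smul, hx]
  | hone => simp [M.comul_one, M.counit_one]
  | hcons v F G hF hG =>
    rw [comul_cons_eq, counitRight_mul₂, hG, treeCoprod, map_add, counitRight_graft₂,
      counitRight_tmul, M.counit_one, one_smul, add_zero, graft_mul]

theorem isBraidedBialgebra : IsBraidedBialgebra M.D where
  toIsBraidedAlgebra := M.isBraidedAlgebra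
  coassoc := LinearMap.ext M.coassoc
  counit_left := M.counitLeft_comul
  counit_right := M.counitRight_comul
  comul_left_braiding := M.comul_R.symm
  comul_right_braiding := by
    refine LinearMap.ext fun z => ?_
    have := M.comul_L.apply z
    rw [crossR, LinearMap.comp_apply, LinearEquiv.coe_coe, LinearEquiv.eq_symm_apply] at this
    exact this.symm
  counit_left_braiding := M.counitLeft_braiding
  counit_right_braiding := M.counitRight_braiding
  comul_mul := TensorProduct.ext' M.comul_mul
  comul_one := M.comul_one
  counit_mul := M.counit_mul
  counit_one := M.counit_one

end ForestModel

/-! ### Antipodes of connected graded braided bialgebras -/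

section Antipode

variable {k H : Type*} [CommRing k] [AddCommGroup H] [Module k H]

theorem tensorSub_le_iff {p q : Submodule k H} {S : Submodule k (H ⊗[k] H)} :
    tensorSub p q ≤ S ↔ ∀ a ∈ p, ∀ b ∈ q, a ⊗ₜ b ∈ S := by
  constructor
  · intro h a ha b hb
    exact h ⟨(⟨a, ha⟩ : p) ⊗ₜ (⟨b, hb⟩ : q), by simp [TensorProduct.mapIncl]⟩
  · rintro h _ ⟨z, rfl⟩
    induction z using TensorProduct.induction_on with
    | zero => simp
    | add x y hx hy => rw [map_add]; exact S.add_mem hx hy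
    | tmul a b => simpa [TensorProduct.mapIncl] using h a a.2 b b.2

theorem tmul_mem_tensorSub {p q : Submodule k H} {a b : H} (ha : a ∈ p) (hb : b ∈ q) :
    a ⊗ₜ[k] b ∈ tensorSub p q :=
  tensorSub_le_iff.1 le_rfl a ha b hb

namespace BraidedData

variable (D : BraidedData k H)

/-- The convolution product of endomorphisms. -/
def conv (f g : H →ₗ[k] H) : H →ₗ[k] H := D.mul ∘ₗ TensorProduct.map f g ∘ₗ D.comul

/-- The unit of the convolution product. -/
def convOne : H →ₗ[k] H := LinearMap.toSpanSingleton k H D.one ∘ₗ D.counit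

theorem convOne_apply (x : H) : D.convOne x = D.counit x • D.one := rfl

theorem conv_add (f g h : H →ₗ[k] H) : D.conv f (g + h) = D.conv f g + D.conv f h := by
  simp only [conv, TensorProduct.map_add_right, LinearMap.add_comp, LinearMap.comp_add]

theorem add_conv (f g h : H →ₗ[k] H) : D.conv (f + g) h = D.conv f h + D.conv g h := by
  simp only [conv, TensorProduct.map_add_left, LinearMap.add_comp, LinearMap.comp_add]

variable {D}

theorem conv_assoc (hD : IsBraidedBialgebra D) (f g h : H →ₗ[k] H) :
    D.conv (D.conv f g) h = D.conv f (D.conv g h) := by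
  ext x
  have h1 : ∀ z, D.mul (TensorProduct.map (D.conv f g) h z) =
      D.mul (D.mul.lTensor H (TensorProduct.map f (TensorProduct.map g h)
        (TensorProduct.assoc k H H H (D.comul.rTensor H z)))) := by
    intro z
    induction z using TensorProduct.induction_on with
    | zero => simp
    | add p q hp hq => simp only [map_add, hp, hq]
    | tmul a b =>
      simp only [TensorProduct.map_tmul, conv, LinearMap.comp_apply, LinearMap.rTensor_tmul]
      induction D.comul a using TensorProduct.induction_on with
      | zero => simp
      | add p q hp hq => simp only [map_add, TensorProduct.add_tmul, hp, hq]
      | tmul c d => simpa using LinearMap.congr_fun hD.mul_assoc ((f c ⊗ₜ g d) ⊗ₜ h b)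
  have h2 : ∀ z, D.mul (TensorProduct.map f (D.conv g h) z) =
      D.mul (D.mul.lTensor H (TensorProduct.map f (TensorProduct.map g h)
        (D.comul.lTensor H z))) := by
    intro z
    induction z using TensorProduct.induction_on with
    | zero => simp
    | add p q hp hq => simp only [map_add, hp, hq]
    | tmul a b => simp [conv]
  have h3 := LinearMap.congr_fun hD.coassoc x
  simp only [LinearMap.comp_apply, LinearEquiv.coe_coe] at h3
  change D.mul (TensorProduct.map (D.conv f g) h (D.comul x)) =
    D.mul (TensorProduct.map f (D.conv g h) (D.comul x))
  rw [h1, h2, h3]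

theorem convOne_conv (hD : IsBraidedBialgebra D) (f : H →ₗ[k] H) : D.conv D.convOne f = f := by
  ext x
  have h1 : ∀ z, D.mul (TensorProduct.map D.convOne f z) =
      f (TensorProduct.lid k H (D.counit.rTensor H z)) := by
    intro z
    induction z using TensorProduct.induction_on with
    | zero => simp
    | add p q hp hq => simp only [map_add, hp, hq]
    | tmul a b => simp [convOne_apply, ← TensorProduct.smul_tmul', hD.one_mul]
  exact (h1 _).trans (by rw [hD.counit_left])

theorem conv_convOne (hD : IsBraidedBialgebra D) (f : H →ₗ[k] H) : D.conv f D.convOne = f := by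
  ext x
  have h1 : ∀ z, D.mul (TensorProduct.map f D.convOne z) =
      f (TensorProduct.rid k H (D.counit.lTensor H z)) := by
    intro z
    induction z using TensorProduct.induction_on with
    | zero => simp
    | add p q hp hq => simp only [map_add, hp, hq]
    | tmul a b => simp [convOne_apply, hD.mul_one]
  exact (h1 _).trans (by rw [hD.counit_right])

theorem isAntipode_iff {S : H →ₗ[k] H} :
    IsAntipode D S ↔ D.conv S LinearMap.id = D.convOne ∧ D.conv LinearMap.id S = D.convOne := by
  simp only [IsAntipode, LinearMap.ext_iff]; rfl

theorem isAntipode_unique (hD : IsBraidedBialgebra D) {S S' : H →ₗ[k] H} (h : IsAntipode D S)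
    (h' : IsAntipode D S') : S = S' := by
  rw [isAntipode_iff] at h h'
  rw [← conv_convOne hD S, ← h'.2, ← conv_assoc hD, h.1, convOne_conv hD]

variable (D) in
/-- The convolution powers of `η ε - id`. -/
def convPow : ℕ → (H →ₗ[k] H)
  | 0 => D.convOne
  | n + 1 => D.conv (D.convOne - LinearMap.id) (convPow n)

theorem convPow_conv (hD : IsBraidedBialgebra D) (n : ℕ) :
    D.conv (D.convPow n) (D.convOne - LinearMap.id) = D.convPow (n + 1) := by
  induction n with
  | zero => rw [convPow, convPow, convPow, convOne_conv hD, conv_convOne hD]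
  | succ n ih => rw [convPow, conv_assoc hD, ih]; rfl

variable (D) in
/-- The partial sums of the geometric series of `η ε - id`. -/
def convSum (n : ℕ) : H →ₗ[k] H := ∑ i ∈ Finset.range (n + 1), D.convPow i

theorem convSum_succ (n : ℕ) : D.convSum (n + 1) = D.convSum n + D.convPow (n + 1) :=
  Finset.sum_range_succ _ _

theorem convSum_conv_id (hD : IsBraidedBialgebra D) (n : ℕ) :
    D.conv (D.convSum n) LinearMap.id + D.convPow (n + 1) = D.convOne := by
  have h : ∀ f, D.conv f LinearMap.id + D.conv f (D.convOne - LinearMap.id) = f := fun f => by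
    rw [← conv_add, add_sub_cancel, conv_convOne hD]
  induction n with
  | zero =>
    have h0 := h (D.convPow 0)
    rw [convPow_conv hD] at h0
    simpa [convSum, convPow] using h0
  | succ n ih =>
    rw [convSum_succ, add_conv, add_assoc, ← convPow_conv hD (n + 1), h, ih]

theorem id_conv_convSum (hD : IsBraidedBialgebra D) (n : ℕ) :
    D.conv LinearMap.id (D.convSum n) + D.convPow (n + 1) = D.convOne := by
  have h : ∀ f, D.conv LinearMap.id f + D.conv (D.convOne - LinearMap.id) f = f := fun f => by
    rw [← add_conv, add_sub_cancel, convOne_conv hD]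
  induction n with
  | zero =>
    have h0 := h (D.convPow 0)
    simpa [convSum, convPow] using h0
  | succ n ih =>
    rw [convSum_succ, conv_add, add_assoc]
    exact (congrArg _ (h _)).trans ih

/-- The part of a graded braided bialgebra that does not mention the antipode, with `H₀ = k 1`. -/
structure IsConnectedGraded (D : BraidedData k H) : Prop extends IsBraidedBialgebra D where
  isInternal : DirectSum.IsInternal D.grading
  mul_graded : ∀ m n, (tensorSub (D.grading m) (D.grading n)).map D.mul ≤ D.grading (m + n)
  one_graded : D.one ∈ D.grading 0
  comul_graded : ∀ n, (D.grading n).map D.comul ≤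
    ⨆ p ∈ Finset.HasAntidiagonal.antidiagonal n, tensorSub (D.grading p.1) (D.grading p.2)
  counit_graded : ∀ n, n ≠ 0 → D.grading n ≤ LinearMap.ker D.counit
  braiding_graded : ∀ m n, (tensorSub (D.grading m) (D.grading n)).map D.braiding ≤
    tensorSub (D.grading n) (D.grading m)
  connected : ∀ x ∈ D.grading 0, D.counit x • D.one = x

namespace IsConnectedGraded

variable (hD : D.IsConnectedGraded)
include hD

theorem comul_mem {n : ℕ} {x : H} (hx : x ∈ D.grading n) {S : Submodule k (H ⊗[k] H)}
    (hS : ∀ i j, i + j = n → ∀ a ∈ D.grading i, ∀ b ∈ D.grading j, a ⊗ₜ b ∈ S) :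
    D.comul x ∈ S := by
  refine (hD.comul_graded n).trans ?_ (Submodule.mem_map_of_mem hx)
  refine iSup₂_le fun p hp => tensorSub_le_iff.2 ?_
  exact hS p.1 p.2 (Finset.HasAntidiagonal.mem_antidiagonal.1 hp)

theorem comul_congr {P : Type*} [AddCommGroup P] [Module k P] {f g : H ⊗[k] H →ₗ[k] P} {n : ℕ}
    (h : ∀ i j, i + j = n → ∀ a ∈ D.grading i, ∀ b ∈ D.grading j, f (a ⊗ₜ b) = g (a ⊗ₜ b))
    {x : H} (hx : x ∈ D.grading n) : f (D.comul x) = g (D.comul x) :=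
  hD.comul_mem hx (S := LinearMap.eqLocus f g) h

theorem mul_mem {i j : ℕ} {a b : H} (ha : a ∈ D.grading i) (hb : b ∈ D.grading j) :
    D.mul (a ⊗ₜ b) ∈ D.grading (i + j) :=
  hD.mul_graded i j (Submodule.mem_map_of_mem (tmul_mem_tensorSub ha hb))

theorem conv_mem {f g : H →ₗ[k] H} (hf : ∀ n, ∀ x ∈ D.grading n, f x ∈ D.grading n)
    (hg : ∀ n, ∀ x ∈ D.grading n, g x ∈ D.grading n) (n : ℕ) (x : H) (hx : x ∈ D.grading n) :
    D.conv f g x ∈ D.grading n := by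
  refine hD.comul_mem hx (S := (D.grading n).comap (D.mul ∘ₗ TensorProduct.map f g)) ?_
  rintro i j rfl a ha b hb
  exact hD.mul_mem (hf i a ha) (hg j b hb)

theorem convOne_mem (n : ℕ) (x : H) (hx : x ∈ D.grading n) : D.convOne x ∈ D.grading n := by
  rcases eq_or_ne n 0 with rfl | hn
  · exact Submodule.smul_mem _ _ hD.one_graded
  · rw [convOne_apply, LinearMap.mem_ker.1 (hD.counit_graded n hn hx), zero_smul]
    exact Submodule.zero_mem _

theorem convPow_mem (i : ℕ) : ∀ n, ∀ x ∈ D.grading n, D.convPow i x ∈ D.grading n := by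
  induction i with
  | zero => exact hD.convOne_mem
  | succ i ih =>
    exact hD.conv_mem (fun n x hx => Submodule.sub_mem _ (hD.convOne_mem n x hx) hx) ih

theorem convPow_eq_zero (i : ℕ) : ∀ n < i, ∀ x ∈ D.grading n, D.convPow i x = 0 := by
  induction i with
  | zero => intro n hn; omega
  | succ i ih =>
    intro n hn x hx
    refine (hD.comul_congr (f := D.mul ∘ₗ TensorProduct.map (D.convOne - LinearMap.id)
      (D.convPow i))
      (g := 0) ?_ hx).trans (by simp)
    intro a b hab y hy z hz
    rcases eq_or_ne a 0 with rfl | ha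
    · simp [convOne_apply, hD.connected y hy]
    · simp [ih b (by omega) z hz]

theorem convSum_eq {m n : ℕ} (h : m ≤ n) {x : H} (hx : x ∈ D.grading m) :
    D.convSum n x = D.convSum m x := by
  induction n, h using Nat.le_induction with
  | base => rfl
  | succ n hn ih =>
    rw [convSum_succ, LinearMap.add_apply, ih,
      hD.convPow_eq_zero (n + 1) m (by omega) x hx, add_zero]

theorem exists_antipode : ∃ S : H →ₗ[k] H, IsAntipode D S ∧
    ∀ n, (D.grading n).map S ≤ D.grading n := by
  classical
  let e := LinearEquiv.ofBijective (DirectSum.coeLinearMap D.grading) hD.isInternal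
  let S : H →ₗ[k] H := (DirectSum.toModule k ℕ H fun n => D.convSum n ∘ₗ (D.grading n).subtype) ∘ₗ
    e.symm.toLinearMap
  have hS : ∀ n, ∀ x ∈ D.grading n, S x = D.convSum n x := by
    intro n x hx
    have h : e.symm x = DirectSum.lof k ℕ (fun i => D.grading i) n ⟨x, hx⟩ := by
      rw [LinearEquiv.symm_apply_eq]
      exact (DirectSum.coeLinearMap_lof D.grading n ⟨x, hx⟩).symm
    simp [S, h]
  have hext : ∀ f g : H →ₗ[k] H, (∀ n, ∀ x ∈ D.grading n, f x = g x) → f = g := by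
    intro f g h
    have : (⊤ : Submodule k H) ≤ LinearMap.eqLocus f g := by
      rw [← hD.isInternal.submodule_iSup_eq_top]
      exact iSup_le fun n x hx => h n x hx
    exact LinearMap.ext fun x => this trivial
  refine ⟨S, isAntipode_iff.2 ⟨hext _ _ fun n x hx => ?_, hext _ _ fun n x hx => ?_⟩, ?_⟩
  · have h1 : D.conv S LinearMap.id x = D.conv (D.convSum n) LinearMap.id x := by
      refine hD.comul_congr (f := D.mul ∘ₗ TensorProduct.map S LinearMap.id)
        (g := D.mul ∘ₗ TensorProduct.map (D.convSum n) LinearMap.id) ?_ hx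
      intro i j hij a ha b hb
      simp [hS i a ha, hD.convSum_eq (show i ≤ n by omega) ha]
    have h2 := LinearMap.congr_fun (convSum_conv_id hD.toIsBraidedBialgebra n) x
    rw [LinearMap.add_apply, hD.convPow_eq_zero (n + 1) n (by omega) x hx, add_zero] at h2
    rw [h1, h2]
  · have h1 : D.conv LinearMap.id S x = D.conv LinearMap.id (D.convSum n) x := by
      refine hD.comul_congr (f := D.mul ∘ₗ TensorProduct.map LinearMap.id S)
        (g := D.mul ∘ₗ TensorProduct.map LinearMap.id (D.convSum n)) ?_ hx
      intro i j hij a ha b hb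
      simp [hS j b hb, hD.convSum_eq (show j ≤ n by omega) hb]
    have h2 := LinearMap.congr_fun (id_conv_convSum hD.toIsBraidedBialgebra n) x
    rw [LinearMap.add_apply, hD.convPow_eq_zero (n + 1) n (by omega) x hx, add_zero] at h2
    rw [h1, h2]
  · rintro n _ ⟨x, hx, rfl⟩
    rw [hS n x hx, convSum, LinearMap.sum_apply]
    exact Submodule.sum_mem _ fun i _ => hD.convPow_mem i n x hx

theorem isGradedBraidedHopf : IsGradedBraidedHopf D :=
  { hD with antipode := hD.exists_antipode }

end IsConnectedGraded

end BraidedData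

end Antipode

/-! ### Transport of structure -/

section Transport

variable {k H H' : Type*} [CommRing k] [AddCommGroup H] [Module k H] [AddCommGroup H'] [Module k H']

/-- The compatibilities of a linear equivalence that imply all others. -/
structure IsDataEquiv (D : BraidedData k H) (D' : BraidedData k H') (e : H ≃ₗ[k] H') : Prop where
  one : e D.one = D'.one
  mul : ∀ z, e (D.mul z) = D'.mul (TensorProduct.map e.toLinearMap e.toLinearMap z)
  comul : ∀ a, TensorProduct.map e.toLinearMap e.toLinearMap (D.comul a) = D'.comul (e a)
  counit : ∀ a, D'.counit (e a) = D.counit a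
  braiding : ∀ z, TensorProduct.map e.toLinearMap e.toLinearMap (D.braiding z) =
    D'.braiding (TensorProduct.map e.toLinearMap e.toLinearMap z)
  grading : ∀ n a, e a ∈ D'.grading n ↔ a ∈ D.grading n

namespace IsDataEquiv

variable {D : BraidedData k H} {D' : BraidedData k H'} {e : H ≃ₗ[k] H'}

theorem injective₂ (e : H ≃ₗ[k] H') : Function.Injective
      (TensorProduct.map e.toLinearMap e.toLinearMap) :=
  (TensorProduct.congr e e).injective

theorem injective₃ (e : H ≃ₗ[k] H') : Function.Injective
      (TensorProduct.map e.toLinearMap (TensorProduct.map e.toLinearMap e.toLinearMap)) :=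
  (TensorProduct.congr e (TensorProduct.congr e e)).injective

theorem map_lTensor₂ {f : H ⊗[k] H →ₗ[k] H ⊗[k] H} {f' : H' ⊗[k] H' →ₗ[k] H' ⊗[k] H'}
    (h : ∀ z, (TensorProduct.map e.toLinearMap e.toLinearMap) (f z) =
      f' ((TensorProduct.map e.toLinearMap e.toLinearMap) z)) (z : H ⊗[k] (H ⊗[k] H)) :
    (TensorProduct.map e.toLinearMap (TensorProduct.map e.toLinearMap e.toLinearMap))
      (f.lTensor H z) =
        f'.lTensor H' ((TensorProduct.map e.toLinearMap
          (TensorProduct.map e.toLinearMap e.toLinearMap)) z) := by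
  induction z using TensorProduct.induction_on with
  | zero => simp
  | add p q hp hq => simp only [map_add, hp, hq]
  | tmul a b => simp [h]

theorem map_assoc (z : (H ⊗[k] H) ⊗[k] H) :
    (TensorProduct.map e.toLinearMap (TensorProduct.map e.toLinearMap e.toLinearMap))
      (TensorProduct.assoc k H H H z) =
      TensorProduct.assoc k H' H' H' (TensorProduct.map
        (TensorProduct.map e.toLinearMap e.toLinearMap) e.toLinearMap z) := by
  rw [TensorProduct.map_map_assoc]

theorem map_assoc_symm (z : H ⊗[k] (H ⊗[k] H)) :
    TensorProduct.map (TensorProduct.map e.toLinearMap e.toLinearMap) e.toLinearMap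
      ((TensorProduct.assoc k H H H).symm z) =
      (TensorProduct.assoc k H' H' H').symm ((TensorProduct.map e.toLinearMap
        (TensorProduct.map e.toLinearMap e.toLinearMap)) z) := by
  rw [LinearEquiv.eq_symm_apply, ← map_assoc, LinearEquiv.apply_symm_apply]

theorem map_onFirst {f : H ⊗[k] H →ₗ[k] H ⊗[k] H} {f' : H' ⊗[k] H' →ₗ[k] H' ⊗[k] H'}
    (h : ∀ z, (TensorProduct.map e.toLinearMap e.toLinearMap) (f z) =
      f' ((TensorProduct.map e.toLinearMap e.toLinearMap) z)) (z : H ⊗[k] (H ⊗[k] H)) :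
    (TensorProduct.map e.toLinearMap (TensorProduct.map e.toLinearMap e.toLinearMap))
      (onFirst H f z) =
        onFirst H' f' ((TensorProduct.map e.toLinearMap
          (TensorProduct.map e.toLinearMap e.toLinearMap)) z) := by
  have h1 : ∀ w, TensorProduct.map (TensorProduct.map e.toLinearMap e.toLinearMap) e.toLinearMap
    (f.rTensor H w) =
      f'.rTensor H' (TensorProduct.map
        (TensorProduct.map e.toLinearMap e.toLinearMap) e.toLinearMap w) := by
    intro w
    induction w using TensorProduct.induction_on with
    | zero => simp
    | add p q hp hq => simp only [map_add, hp, hq]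
    | tmul a b => simp [h]
  simp only [onFirst, LinearMap.comp_apply, LinearEquiv.coe_coe, map_assoc, h1, map_assoc_symm]

theorem map_lTensor_mul (h : IsDataEquiv D D' e) (z : H ⊗[k] (H ⊗[k] H)) :
    TensorProduct.map e.toLinearMap e.toLinearMap (D.mul.lTensor H z) =
      D'.mul.lTensor H' ((TensorProduct.map e.toLinearMap
        (TensorProduct.map e.toLinearMap e.toLinearMap)) z) := by
  induction z using TensorProduct.induction_on with
  | zero => simp
  | add p q hp hq => simp only [map_add, hp, hq]
  | tmul a b => simp [h.mul]

theorem map_rTensor_mul (h : IsDataEquiv D D' e) (z : (H ⊗[k] H) ⊗[k] H) :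
    TensorProduct.map e.toLinearMap e.toLinearMap (D.mul.rTensor H z) =
      D'.mul.rTensor H' (TensorProduct.map
        (TensorProduct.map e.toLinearMap e.toLinearMap) e.toLinearMap z) := by
  induction z using TensorProduct.induction_on with
  | zero => simp
  | add p q hp hq => simp only [map_add, hp, hq]
  | tmul a b => simp [h.mul]

theorem map_lTensor_comul (h : IsDataEquiv D D' e) (z : H ⊗[k] H) :
    (TensorProduct.map e.toLinearMap (TensorProduct.map e.toLinearMap e.toLinearMap))
      (D.comul.lTensor H z) =
        D'.comul.lTensor H' ((TensorProduct.map e.toLinearMap e.toLinearMap) z) := by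
  induction z using TensorProduct.induction_on with
  | zero => simp
  | add p q hp hq => simp only [map_add, hp, hq]
  | tmul a b => simp [h.comul]

theorem map_rTensor_comul (h : IsDataEquiv D D' e) (z : H ⊗[k] H) :
    TensorProduct.map (TensorProduct.map e.toLinearMap e.toLinearMap) e.toLinearMap
      (D.comul.rTensor H z) =
        D'.comul.rTensor H' ((TensorProduct.map e.toLinearMap e.toLinearMap) z) := by
  induction z using TensorProduct.induction_on with
  | zero => simp
  | add p q hp hq => simp only [map_add, hp, hq]
  | tmul a b => simp [h.comul]

theorem map_counit_left (h : IsDataEquiv D D' e) (z : H ⊗[k] H) :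
    e (TensorProduct.lid k H (D.counit.rTensor H z)) =
      TensorProduct.lid k H' (D'.counit.rTensor H'
        ((TensorProduct.map e.toLinearMap e.toLinearMap) z)) := by
  induction z using TensorProduct.induction_on with
  | zero => simp
  | add p q hp hq => simp only [map_add, hp, hq]
  | tmul a b => simp [h.counit]

theorem map_counit_right (h : IsDataEquiv D D' e) (z : H ⊗[k] H) :
    e (TensorProduct.rid k H (D.counit.lTensor H z)) =
      TensorProduct.rid k H' (D'.counit.lTensor H'
        ((TensorProduct.map e.toLinearMap e.toLinearMap) z)) := by
  induction z using TensorProduct.induction_on with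
  | zero => simp
  | add p q hp hq => simp only [map_add, hp, hq]
  | tmul a b => simp [h.counit]

theorem map_mul₂ (h : IsDataEquiv D D' e) (X Y : H ⊗[k] H) :
    TensorProduct.map e.toLinearMap e.toLinearMap (D.mul₂ (X ⊗ₜ Y)) =
      D'.mul₂ ((TensorProduct.map e.toLinearMap e.toLinearMap) X ⊗ₜ
        (TensorProduct.map e.toLinearMap e.toLinearMap) Y) :=
  map_twistedAct (fun a b => by simpa using h.mul (a ⊗ₜ b))
    (fun a b => by simpa using h.mul (a ⊗ₜ b)) (LinearMap.ext h.braiding) X Y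

theorem isBraidedBialgebra (h : IsDataEquiv D D' e) (hD : IsBraidedBialgebra D') :
    IsBraidedBialgebra D := by
  have hb : IsBraiding D.braiding := LinearMap.ext fun z => injective₃ e <| by
    simp only [LinearMap.comp_apply, map_lTensor₂ h.braiding, map_onFirst h.braiding]
    exact LinearMap.congr_fun hD.braid ((TensorProduct.map e.toLinearMap
      (TensorProduct.map e.toLinearMap e.toLinearMap)) z)
  exact {
    braid := hb
    mul_assoc := LinearMap.ext fun z => e.injective <| by
      simp only [LinearMap.comp_apply, LinearEquiv.coe_coe, h.mul, h.map_rTensor_mul,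
        h.map_lTensor_mul, map_assoc]
      exact LinearMap.congr_fun hD.mul_assoc _
    one_mul := fun a => e.injective <| by
      simp [h.mul, h.one, hD.one_mul]
    mul_one := fun a => e.injective <| by
      simp [h.mul, h.one, hD.mul_one]
    braiding_mul_right := LinearMap.ext fun z => injective₂ e <| by
      simp only [LinearMap.comp_apply, LinearEquiv.coe_coe, h.map_rTensor_mul, h.braiding,
        h.map_lTensor_mul, map_assoc_symm, map_lTensor₂ h.braiding, map_onFirst h.braiding]
      exact LinearMap.congr_fun hD.braiding_mul_right _
    braiding_mul_left := LinearMap.ext fun z => injective₂ e <| by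
      simp only [LinearMap.comp_apply, LinearEquiv.coe_coe, h.map_rTensor_mul, h.braiding,
        h.map_lTensor_mul, map_assoc_symm, map_lTensor₂ h.braiding, map_onFirst h.braiding]
      exact LinearMap.congr_fun hD.braiding_mul_left _
    braiding_one_right := fun a => injective₂ e <| by
      simp [h.braiding, h.one, hD.braiding_one_right]
    braiding_one_left := fun a => injective₂ e <| by
      simp [h.braiding, h.one, hD.braiding_one_left]
    coassoc := LinearMap.ext fun z => injective₃ e <| by
      simp only [LinearMap.comp_apply, LinearEquiv.coe_coe, map_assoc, h.map_rTensor_comul,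
        h.map_lTensor_comul, h.comul]
      exact LinearMap.congr_fun hD.coassoc _
    counit_left := fun a => e.injective <| by
      rw [h.map_counit_left, h.comul, hD.counit_left]
    counit_right := fun a => e.injective <| by
      rw [h.map_counit_right, h.comul, hD.counit_right]
    comul_left_braiding := LinearMap.ext fun z => injective₃ e <| by
      simp only [LinearMap.comp_apply, LinearEquiv.coe_coe, map_assoc, h.map_rTensor_comul,
        h.map_lTensor_comul, h.braiding, map_lTensor₂ h.braiding, map_onFirst h.braiding]
      exact LinearMap.congr_fun hD.comul_left_braiding _
    comul_right_braiding := LinearMap.ext fun z => injective₃ e <| by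
      simp only [LinearMap.comp_apply, LinearEquiv.coe_coe, map_assoc, h.map_rTensor_comul,
        h.map_lTensor_comul, h.braiding, map_lTensor₂ h.braiding, map_onFirst h.braiding]
      exact LinearMap.congr_fun hD.comul_right_braiding _
    counit_left_braiding := fun a b => e.injective <| by
      rw [h.map_counit_left, h.braiding, TensorProduct.map_tmul, LinearEquiv.coe_coe,
        hD.counit_left_braiding, h.counit, map_smul]
    counit_right_braiding := fun a b => e.injective <| by
      rw [h.map_counit_right, h.braiding, TensorProduct.map_tmul, LinearEquiv.coe_coe,
        hD.counit_right_braiding, h.counit, map_smul]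
    comul_mul := TensorProduct.ext' fun a b => injective₂ e <| by
      refine Eq.trans ?_ (h.map_mul₂ (D.comul a) (D.comul b)).symm
      rw [LinearMap.comp_apply, h.comul, h.mul, TensorProduct.map_tmul, h.comul, h.comul]
      exact LinearMap.congr_fun hD.comul_mul (e a ⊗ₜ e b)
    comul_one := injective₂ e <| by simp [h.comul, h.one, hD.comul_one]
    counit_mul := fun a b => by
      rw [← h.counit, h.mul, TensorProduct.map_tmul, LinearEquiv.coe_coe, hD.counit_mul, h.counit,
        h.counit]
    counit_one := by rw [← h.counit, h.one, hD.counit_one] }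

theorem mem_tensorSub (h : IsDataEquiv D D' e) {m n : ℕ} {z : H ⊗[k] H} :
    z ∈ tensorSub (D.grading m) (D.grading n) ↔
      (TensorProduct.map e.toLinearMap e.toLinearMap) z ∈ tensorSub (D'.grading m)
        (D'.grading n) := by
  constructor
  · intro hz
    refine (tensorSub_le_iff (S := (tensorSub (D'.grading m) (D'.grading n)).comap
      (TensorProduct.map e.toLinearMap e.toLinearMap))).2 ?_ hz
    intro a ha b hb
    exact tmul_mem_tensorSub ((h.grading m a).2 ha) ((h.grading n b).2 hb)
  · intro hz
    have h1 : tensorSub (D'.grading m) (D'.grading n) ≤ (tensorSub (D.grading m)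
        (D.grading n)).comap (TensorProduct.congr e e).symm.toLinearMap := by
      refine tensorSub_le_iff.2 fun a ha b hb => ?_
      exact tmul_mem_tensorSub ((h.grading m _).1 (by simpa using ha))
        ((h.grading n _).1 (by simpa using hb))
    have h2 := h1 hz
    rw [Submodule.mem_comap] at h2
    convert h2
    exact ((TensorProduct.congr e e).symm_apply_apply z).symm

theorem grading_map (h : IsDataEquiv D D' e) (n : ℕ) :
    (D.grading n).map e.toLinearMap = D'.grading n := by
  ext x
  constructor
  · rintro ⟨a, ha, rfl⟩; exact (h.grading n a).2 ha
  · intro hx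
    exact ⟨e.symm x, (h.grading n _).1 (by simpa using hx), by simp⟩

theorem isConnectedGraded (h : IsDataEquiv D D' e) (hD : D'.IsConnectedGraded)
    (hI : DirectSum.IsInternal D.grading) : D.IsConnectedGraded where
  toIsBraidedBialgebra := h.isBraidedBialgebra hD.toIsBraidedBialgebra
  isInternal := hI
  mul_graded m n := by
    rintro _ ⟨z, hz, rfl⟩
    rw [← h.grading, h.mul]
    exact hD.mul_graded m n (Submodule.mem_map_of_mem (h.mem_tensorSub.1 hz))
  one_graded := by rw [← h.grading, h.one]; exact hD.one_graded
  comul_graded n := by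
    rintro _ ⟨x, hx, rfl⟩
    have h1 := hD.comul_mem ((h.grading n x).2 hx) (S := (⨆ p ∈
      Finset.HasAntidiagonal.antidiagonal n, tensorSub (D.grading p.1) (D.grading p.2)).comap
        (TensorProduct.congr e e).symm.toLinearMap) ?_
    · rw [Submodule.mem_comap] at h1
      convert h1
      rw [← h.comul]
      exact ((TensorProduct.congr e e).symm_apply_apply _).symm
    · intro i j hij a ha b hb
      refine Submodule.mem_iSup_of_mem (i, j) (Submodule.mem_iSup_of_mem (by simpa using hij) ?_)
      exact tmul_mem_tensorSub ((h.grading _ _).1 (by simpa using ha))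
        ((h.grading _ _).1 (by simpa using hb))
  counit_graded n hn x hx := by
    rw [LinearMap.mem_ker, ← h.counit]
    exact hD.counit_graded n hn ((h.grading n x).2 hx)
  braiding_graded m n := by
    rintro _ ⟨z, hz, rfl⟩
    rw [h.mem_tensorSub, h.braiding]
    exact hD.braiding_graded m n (Submodule.mem_map_of_mem (h.mem_tensorSub.1 hz))
  connected x hx := e.injective <| by
    rw [map_smul, h.one, ← h.counit, hD.connected _ ((h.grading 0 x).2 hx)]

theorem isGradedBraidedHopfIso (h : IsDataEquiv D D' e) (hD : IsBraidedBialgebra D') :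
    IsGradedBraidedHopfIso D D' e.toLinearMap where
  map_one := h.one
  map_mul := LinearMap.ext h.mul
  bijective := e.bijective
  map_comul := LinearMap.ext fun a => (h.comul a).symm
  map_counit := LinearMap.ext h.counit
  map_braiding := LinearMap.ext h.braiding
  map_grading := h.grading_map
  map_antipode S S' hS hS' := by
    have h1 : IsAntipode D (e.symm.toLinearMap ∘ₗ S' ∘ₗ e.toLinearMap) := by
      constructor
      · intro a
        apply e.injective
        have h2 : ∀ z : H ⊗[k] H, (TensorProduct.map e.toLinearMap e.toLinearMap)
          ((e.symm.toLinearMap ∘ₗ S' ∘ₗ e.toLinearMap).rTensor H z) =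
            S'.rTensor H' ((TensorProduct.map e.toLinearMap e.toLinearMap) z) := by
          intro z
          induction z using TensorProduct.induction_on with
          | zero => simp
          | add p q hp hq => simp only [map_add, hp, hq]
          | tmul a b => simp
        rw [h.mul, h2, h.comul, hS'.1, map_smul, h.one, h.counit]
      · intro a
        apply e.injective
        have h2 : ∀ z : H ⊗[k] H, (TensorProduct.map e.toLinearMap e.toLinearMap)
          ((e.symm.toLinearMap ∘ₗ S' ∘ₗ e.toLinearMap).lTensor H z) =
            S'.lTensor H' ((TensorProduct.map e.toLinearMap e.toLinearMap) z) := by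
          intro z
          induction z using TensorProduct.induction_on with
          | zero => simp
          | add p q hp hq => simp only [map_add, hp, hq]
          | tmul a b => simp
        rw [h.mul, h2, h.comul, hS'.2, map_smul, h.one, h.counit]
    rw [BraidedData.isAntipode_unique (h.isBraidedBialgebra hD) hS h1]
    ext; simp

end IsDataEquiv

end Transport

/-! ### Binary trees, abstractly -/

/-- A module `Y` that is generated from `one` by the operation `vee : (a, v, b) ↦ a ∨_v b`, with
structure maps that are recursively determined by this operation. -/
structure TreeModel {k V : Type*} (Y : Type*) [CommRing k] [AddCommGroup V] [Module k V]
    [AddCommGroup Y] [Module k Y] (σ : V ⊗[k] V →ₗ[k] V ⊗[k] V) where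
  D : BraidedData k Y
  τ : V ⊗[k] Y →ₗ[k] Y ⊗[k] V
  vee : Y ⊗[k] (V ⊗[k] Y) →ₗ[k] Y
  p : ℕ → Y →ₗ[k] Y
  cover : Cover (LinearMap.toSpanSingleton k Y D.one) vee p
  p_one : ∀ n, p (n + 1) D.one = D.one
  p_vee : ∀ n, p (n + 1) ∘ₗ vee =
    vee ∘ₗ TensorProduct.map (p n) (TensorProduct.map LinearMap.id (p n))
  τ_one : ∀ u, τ (u ⊗ₜ D.one) = D.one ⊗ₜ u
  τ_vee : Intertwines (crossR τ (crossR σ τ)) τ LinearMap.id vee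
  braiding_one : ∀ x, D.braiding (D.one ⊗ₜ x) = x ⊗ₜ D.one
  braiding_vee : Intertwines (crossL D.braiding (crossL τ D.braiding)) D.braiding vee
    LinearMap.id
  one_mul : ∀ x, D.mul (D.one ⊗ₜ x) = x
  mul_one : ∀ x, D.mul (x ⊗ₜ D.one) = x
  vee_mul_vee : ∀ a u b a' v b', D.mul (vee (a ⊗ₜ (u ⊗ₜ b)) ⊗ₜ vee (a' ⊗ₜ (v ⊗ₜ b'))) =
    vee (a ⊗ₜ (u ⊗ₜ D.mul (b ⊗ₜ vee (a' ⊗ₜ (v ⊗ₜ b'))))) +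
      vee (D.mul (vee (a ⊗ₜ (u ⊗ₜ b)) ⊗ₜ a') ⊗ₜ (v ⊗ₜ b'))
  comul_one : D.comul D.one = D.one ⊗ₜ D.one
  comul_vee : ∀ a v b, D.comul (vee (a ⊗ₜ (v ⊗ₜ b))) = vee (a ⊗ₜ (v ⊗ₜ b)) ⊗ₜ D.one +
    TensorProduct.map D.mul vee (onMiddle Y (V ⊗[k] Y) D.braiding
      (D.comul a ⊗ₜ onFirst Y τ (v ⊗ₜ D.comul b)))
  counit_one : D.counit D.one = 1
  counit_vee : ∀ z, D.counit (vee z) = 0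

namespace TreeModel

variable {k V Y : Type*} [CommRing k] [AddCommGroup V] [Module k V]
    [AddCommGroup Y] [Module k Y] {σ : V ⊗[k] V →ₗ[k] V ⊗[k] V} (T : TreeModel Y σ)

theorem induction {P : Y → Prop} (hadd : ∀ x y, P x → P y → P (x + y))
    (hsmul : ∀ (r : k) x, P x → P (r • x)) (hone : P T.D.one)
    (hvee : ∀ a v b, P a → P b → P (T.vee (a ⊗ₜ (v ⊗ₜ b)))) (x : Y) : P x := by
  have h0 : P 0 := by simpa using hsmul 0 _ hone
  have key : ∀ n x, P (T.p n x) := by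
    intro n
    induction n with
    | zero => intro x; rw [T.cover.zero]; exact h0
    | succ n ih =>
      intro x
      obtain ⟨r, z, rfl⟩ := T.cover.surj x
      rw [map_add]
      refine hadd _ _ ?_ ?_
      · rw [LinearMap.toSpanSingleton_apply, map_smul, T.p_one]; exact hsmul _ _ hone
      · rw [← LinearMap.comp_apply, T.p_vee, LinearMap.comp_apply]
        induction z using TensorProduct.induction_on with
        | zero => simpa using h0
        | add a b ha hb => rw [map_add, map_add]; exact hadd _ _ ha hb
        | tmul a z =>
        induction z using TensorProduct.induction_on with
        | zero => simpa using h0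
        | add a b ha hb => rw [TensorProduct.tmul_add, map_add, map_add]; exact hadd _ _ ha hb
        | tmul v b => exact hvee _ _ _ (ih a) (ih b)
  obtain ⟨n, hn⟩ := T.cover.eventually x
  rw [← hn n le_rfl]
  exact key n x

theorem mul_assoc (x y z : Y) : T.D.mul (T.D.mul (x ⊗ₜ y) ⊗ₜ z) =
    T.D.mul (x ⊗ₜ T.D.mul (y ⊗ₜ z)) := by
  induction x using T.induction generalizing y z with
  | hadd a b ha hb => simp only [TensorProduct.add_tmul, map_add, ha, hb]
  | hsmul r a ha => simp only [← TensorProduct.smul_tmul', map_smul, ha]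
  | hone => simp only [T.one_mul]
  | hvee a u b _ hb =>
  induction z using T.induction generalizing y with
  | hadd c d hc hd => simp only [TensorProduct.tmul_add, map_add, hc, hd]
  | hsmul r c hc => simp only [TensorProduct.tmul_smul, map_smul, hc]
  | hone => simp only [T.mul_one]
  | hvee a'' w b'' ha'' _ =>
  induction y using T.induction with
  | hadd c d hc hd => simp only [TensorProduct.add_tmul, TensorProduct.tmul_add, map_add, hc, hd]
  | hsmul r c hc =>
    simp only [← TensorProduct.smul_tmul', TensorProduct.tmul_smul, map_smul, hc]
  | hone => simp only [T.one_mul, T.mul_one]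
  | hvee a' v b' _ _ =>
    have h1 := hb (T.vee (a' ⊗ₜ (v ⊗ₜ b'))) (T.vee (a'' ⊗ₜ (w ⊗ₜ b'')))
    have h2 := ha'' (T.vee (a' ⊗ₜ (v ⊗ₜ b')))
    rw [T.vee_mul_vee a' v b' a'' w b''] at h1 ⊢
    rw [TensorProduct.tmul_add, map_add, T.vee_mul_vee, T.vee_mul_vee a u b _ w b'',
      TensorProduct.add_tmul, map_add, T.vee_mul_vee, T.vee_mul_vee, ← h2,
      T.vee_mul_vee a u b a' v b', h1,
      T.vee_mul_vee a u b a' v (T.D.mul _)]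
    simp only [TensorProduct.add_tmul, TensorProduct.tmul_add, map_add]
    abel

end TreeModel

/-! ### The isomorphism, abstractly -/

namespace ForestModel

variable {k V R : Type*} [CommRing k] [AddCommGroup V] [Module k V]
    [AddCommGroup R] [Module k R] {σ : V ⊗[k] V →ₗ[k] V ⊗[k] V} (M : ForestModel R σ)

/-- The left dendriform action `≻` of the algebra `R` on itself. -/
structure IsDendriform (act : R ⊗[k] R →ₗ[k] R) : Prop where
  one : ∀ x, act (M.D.one ⊗ₜ x) = x
  cons : ∀ u A C x, act (M.cons (u ⊗ₜ (A ⊗ₜ C)) ⊗ₜ x) =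
    M.cons (u ⊗ₜ (A ⊗ₜ act (C ⊗ₜ x))) - M.graft (u ⊗ₜ M.D.mul (A ⊗ₜ act (C ⊗ₜ x)))

variable {M} {act : R ⊗[k] R →ₗ[k] R}

namespace IsDendriform

variable (h : M.IsDendriform act)
include h

theorem mul (x y z : R) : act (M.D.mul (x ⊗ₜ y) ⊗ₜ z) = act (x ⊗ₜ act (y ⊗ₜ z)) := by
  induction x using M.induction with
  | hadd a b ha hb => simp only [TensorProduct.add_tmul, map_add, ha, hb]
  | hsmul r a ha => simp only [← TensorProduct.smul_tmul', map_smul, ha]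
  | hone => rw [M.one_mul, h.one]
  | hcons v F G _ hG => rw [M.cons_mul, h.cons, h.cons, hG]

theorem graft (u : V) (A x : R) : act (M.graft (u ⊗ₜ A) ⊗ₜ x) =
    M.cons (u ⊗ₜ (A ⊗ₜ x)) - M.graft (u ⊗ₜ M.D.mul (A ⊗ₜ x)) := by
  rw [M.graft_tmul, h.cons, h.one]

theorem act_graft_mul (x : R) (u : V) (y z : R) :
    M.D.mul (act (x ⊗ₜ M.graft (u ⊗ₜ y)) ⊗ₜ z) =
      act (x ⊗ₜ M.graft (u ⊗ₜ M.D.mul (y ⊗ₜ z))) +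
        act (act (x ⊗ₜ M.graft (u ⊗ₜ y)) ⊗ₜ z) := by
  induction x using M.induction with
  | hadd a b ha hb =>
    simp only [TensorProduct.add_tmul, map_add, ha, hb]; abel
  | hsmul r a ha => simp only [← TensorProduct.smul_tmul', map_smul, ha, smul_add]
  | hone => rw [h.one, h.one, h.graft, M.graft_mul]; abel
  | hcons w A C _ hC =>
    rw [h.cons, h.cons, TensorProduct.sub_tmul, map_sub, map_sub,
      M.cons_mul, h.cons, h.graft, M.graft_mul, hC, M.mul_assoc A, hC]
    simp only [TensorProduct.tmul_add, map_add]
    abel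

/-! #### Naturality of the action -/

theorem p_cons (n : ℕ) :
    act ∘ₗ TensorProduct.map (M.p (n + 1)) LinearMap.id ∘ₗ
        TensorProduct.map M.cons LinearMap.id =
      (M.cons - M.graft ∘ₗ TensorProduct.map LinearMap.id M.D.mul) ∘ₗ
        TensorProduct.map LinearMap.id (TensorProduct.map (M.p n)
          (act ∘ₗ TensorProduct.map (M.p n) LinearMap.id)) ∘ₗ
        TensorProduct.map LinearMap.id (TensorProduct.assoc k R R R).toLinearMap ∘ₗ
        (TensorProduct.assoc k V (R ⊗[k] R) R).toLinearMap := by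
  rw [← TensorProduct.map_comp, M.p_cons]
  refine TensorProduct.ext' fun z x => ?_
  induction z using TensorProduct.induction_on with
  | zero => simp
  | add a b ha hb => simp only [TensorProduct.add_tmul, map_add, ha, hb]
  | tmul v z =>
  induction z using TensorProduct.induction_on with
  | zero => simp
  | add a b ha hb => simp only [TensorProduct.tmul_add, TensorProduct.add_tmul, map_add, ha, hb]
  | tmul F G => simp [h.cons]

theorem p_unit (n : ℕ) :
    act ∘ₗ TensorProduct.map (M.p (n + 1)) LinearMap.id ∘ₗ
        TensorProduct.map M.unit LinearMap.id = (TensorProduct.lid k R).toLinearMap :=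
  TensorProduct.ext' fun r u => by
    simp [M.p_one, ← TensorProduct.smul_tmul', h.one]

theorem act_V : Intertwines (crossR M.τ M.τ) M.τ LinearMap.id act := by
  refine (M.cover.rTensor R).intertwines_right
    (x₁ := crossR (TensorProduct.comm k V k).toLinearMap M.τ)
    (x₂ := crossR (crossR σ (crossR M.τ M.τ)) M.τ) (M.unit_V.crossR Intertwines.id)
    (M.τ_cons.crossR Intertwines.id) (fun n => ?_) (fun n ih => ?_)
  · rw [h.p_unit]
    exact Intertwines.lid_right M.τ
  · rw [h.p_cons]
    exact (M.τ_cons.sub_right (M.graft_V.comp_right (Intertwines.id.crossR M.mul_V))).comp_right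
      ((Intertwines.id.crossR ((M.p_V n).crossR ih)).comp_right
      ((Intertwines.id.crossR (Intertwines.assoc_right _ _ _)).comp_right
        (Intertwines.assoc_right _ _ _)))

theorem act_R : Intertwines (crossL M.D.braiding M.D.braiding) M.D.braiding act
    LinearMap.id := by
  refine (M.cover.rTensor R).intertwines_left
    (x₁ := crossL (TensorProduct.comm k k R).toLinearMap M.D.braiding)
    (x₂ := crossL (crossL M.τ (crossL M.D.braiding M.D.braiding)) M.D.braiding)
    (M.unit_R.crossL Intertwines.id)
    (M.braiding_cons.crossL Intertwines.id) (fun n => ?_) (fun n ih => ?_)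
  · rw [h.p_unit]
    exact Intertwines.lid_left _
  · rw [h.p_cons]
    exact (M.braiding_cons.sub_left
      (M.graft_R.comp_left (Intertwines.id.crossL M.mul_R))).comp_left
      ((Intertwines.id.crossL ((M.p_R n).crossL ih)).comp_left
      ((Intertwines.id.crossL (Intertwines.assoc_left _ _ _)).comp_left
        (Intertwines.assoc_left _ _ _)))

omit h in
/-- The operation on `R` that corresponds to `∨`. -/
def _root_.BraidedTrees.ForestModel.veeOp (M : ForestModel R σ) (act : R ⊗[k] R →ₗ[k] R) :
    R ⊗[k] (V ⊗[k] R) →ₗ[k] R := act ∘ₗ TensorProduct.map LinearMap.id M.graft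

theorem veeOp_V : Intertwines (crossR M.τ (crossR σ M.τ)) M.τ LinearMap.id (M.veeOp act) :=
  h.act_V.comp_right (Intertwines.id.crossR M.graft_V)

theorem veeOp_R : Intertwines (crossL M.D.braiding (crossL M.τ M.D.braiding)) M.D.braiding
    (M.veeOp act) LinearMap.id :=
  h.act_R.comp_left (Intertwines.id.crossL M.graft_R)

/-! #### The coproduct and the action -/

theorem act₂_assoc (X Y Z : R ⊗[k] R) :
    twistedAct M.D.mul act M.D.braiding (M.D.mul₂ (X ⊗ₜ Y) ⊗ₜ Z) =
      twistedAct M.D.mul act M.D.braiding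
        (X ⊗ₜ twistedAct M.D.mul act M.D.braiding (Y ⊗ₜ Z)) :=
  twistedAct_assoc M.mul_assoc h.mul M.mul_L M.mul_R X Y Z

theorem one_act₂ (a : R) (Y : R ⊗[k] R) :
    twistedAct M.D.mul act M.D.braiding ((a ⊗ₜ M.D.one) ⊗ₜ Y) =
      M.D.mul₂ ((a ⊗ₜ M.D.one) ⊗ₜ Y) := by
  induction Y using TensorProduct.induction_on with
  | zero => simp
  | add p q hp hq => simp only [TensorProduct.tmul_add, map_add, hp, hq]
  | tmul c d =>
    rw [twistedAct_tmul, M.mul₂_tmul, M.braiding_one]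
    simp [h.one, M.one_mul]

end IsDendriform

theorem twistedAct_graft₂ (ν : R ⊗[k] R →ₗ[k] R) (u : V) (a b c d : R) :
    twistedAct M.D.mul ν M.D.braiding (M.graft₂ (u ⊗ₜ (a ⊗ₜ b)) ⊗ₜ (c ⊗ₜ d)) =
      TensorProduct.map LinearMap.id (ν ∘ₗ (TensorProduct.mk k R R).flip d ∘ₗ M.graft)
        (TensorProduct.map M.D.mul LinearMap.id
          (onMiddle R R M.τ (M.τ (u ⊗ₜ a) ⊗ₜ M.D.braiding (b ⊗ₜ c)))) := by
  rw [M.graft₂_tmul]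
  induction M.τ (u ⊗ₜ a) using TensorProduct.induction_on with
  | zero => simp
  | add p q hp hq => simp only [map_add, TensorProduct.add_tmul, hp, hq]
  | tmul a' u' =>
    have hR := M.graft_R.apply ((u' ⊗ₜ b) ⊗ₜ c)
    rw [TensorProduct.map_tmul, LinearMap.id_apply, crossL_tmul] at hR
    rw [TensorProduct.map_tmul, LinearMap.comp_apply, LinearMap.flip_apply, TensorProduct.mk_apply,
      LinearMap.id_apply, twistedAct_tmul, ← hR]
    induction M.D.braiding (b ⊗ₜ c) using TensorProduct.induction_on with
    | zero => simp
    | add p q hp hq => simp only [map_add, TensorProduct.tmul_add, hp, hq]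
    | tmul c' b' =>
      rw [crossLSnd_tmul, onMiddle_tmul]
      induction M.τ (u' ⊗ₜ c') using TensorProduct.induction_on with
      | zero => simp
      | add p q hp hq => simp only [map_add, TensorProduct.add_tmul, hp, hq]
      | tmul p q => simp

theorem graft₂_mul₂ (u : V) (a b c d : R) :
    M.graft₂ (u ⊗ₜ M.D.mul₂ ((a ⊗ₜ b) ⊗ₜ (c ⊗ₜ d))) =
      TensorProduct.map LinearMap.id
        (M.graft ∘ₗ TensorProduct.map LinearMap.id (M.D.mul ∘ₗ (TensorProduct.mk k R R).flip d))
        (TensorProduct.map M.D.mul LinearMap.id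
          (onMiddle R R M.τ (M.τ (u ⊗ₜ a) ⊗ₜ M.D.braiding (b ⊗ₜ c)))) := by
  rw [M.mul₂_tmul]
  induction M.D.braiding (b ⊗ₜ c) using TensorProduct.induction_on with
  | zero => simp
  | add p q hp hq => simp only [map_add, TensorProduct.tmul_add, hp, hq]
  | tmul c' b' =>
    have hV := M.mul_V.apply (u ⊗ₜ (a ⊗ₜ c'))
    rw [TensorProduct.map_tmul, LinearMap.id_apply, crossR_tmul] at hV
    rw [sandwich_tmul, M.graft₂_tmul, ← hV]
    induction M.τ (u ⊗ₜ a) using TensorProduct.induction_on with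
    | zero => simp
    | add p q hp hq => simp only [map_add, TensorProduct.add_tmul, hp, hq]
    | tmul a' u' =>
      rw [crossRSnd_tmul, onMiddle_tmul]
      induction M.τ (u' ⊗ₜ c') using TensorProduct.induction_on with
      | zero => simp
      | add p q hp hq => simp only [map_add, TensorProduct.tmul_add, hp, hq]
      | tmul p q => simp

theorem graft₂_mul₂_one (u : V) (X : R ⊗[k] R) (c : R) :
    M.graft₂ (u ⊗ₜ M.D.mul₂ (X ⊗ₜ (c ⊗ₜ M.D.one))) =
      M.D.mul₂ (M.graft₂ (u ⊗ₜ X) ⊗ₜ (c ⊗ₜ M.D.one)) := by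
  induction X using TensorProduct.induction_on with
  | zero => simp
  | add p q hp hq => simp only [map_add, TensorProduct.add_tmul, TensorProduct.tmul_add, hp, hq]
  | tmul a b =>
    refine (graft₂_mul₂ u a b c M.D.one).trans ((twistedAct_graft₂ M.D.mul u a b c M.D.one).trans
      ?_).symm
    congr 2
    refine TensorProduct.ext' fun v F => ?_
    simp [M.mul_one]

theorem IsDendriform.act₂_graft₂ (h : M.IsDendriform act) (u : V) (X Y : R ⊗[k] R) :
    twistedAct M.D.mul act M.D.braiding (M.graft₂ (u ⊗ₜ X) ⊗ₜ Y) =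
      M.D.mul₂ (M.graft₂ (u ⊗ₜ X) ⊗ₜ Y) - M.graft₂ (u ⊗ₜ M.D.mul₂ (X ⊗ₜ Y)) := by
  induction X using TensorProduct.induction_on with
  | zero => simp
  | add p q hp hq =>
    simp only [map_add, TensorProduct.add_tmul, TensorProduct.tmul_add, hp, hq]; abel
  | tmul a b =>
  induction Y using TensorProduct.induction_on with
  | zero => simp
  | add p q hp hq =>
    simp only [map_add, TensorProduct.tmul_add, hp, hq]; abel
  | tmul c d =>
    rw [graft₂_mul₂, twistedAct_graft₂]
    refine Eq.trans ?_ (congrArg₂ _ (twistedAct_graft₂ M.D.mul u a b c d).symm rfl)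
    rw [← LinearMap.sub_apply]
    have hsub : ∀ f g : V ⊗[k] R →ₗ[k] R, TensorProduct.map (LinearMap.id (M := R)) f -
        TensorProduct.map LinearMap.id g = TensorProduct.map LinearMap.id (f - g) :=
      fun f g => TensorProduct.ext' fun a b => by simp [TensorProduct.tmul_sub]
    rw [hsub]
    congr 2
    refine TensorProduct.ext' fun v F => ?_
    simp [h.graft, M.graft_mul]

theorem IsDendriform.comul_act (h : M.IsDendriform act) (x : R) (v : V) (y : R) :
    M.D.comul (act (x ⊗ₜ M.graft (v ⊗ₜ y))) = act (x ⊗ₜ M.graft (v ⊗ₜ y)) ⊗ₜ M.D.one +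
      twistedAct M.D.mul act M.D.braiding (M.D.comul x ⊗ₜ M.graft₂ (v ⊗ₜ M.D.comul y)) := by
  induction x using M.induction with
  | hadd a b ha hb => simp only [TensorProduct.add_tmul, map_add, ha, hb]; abel
  | hsmul r a ha => simp only [← TensorProduct.smul_tmul', map_smul, ha, smul_add]
  | hone => rw [h.one, M.comul_one, h.one_act₂, M.one_mul₂, M.comul_graft]; rfl
  | hcons u A C _ hC =>
    have h1 : M.D.mul₂ ((M.graft (u ⊗ₜ A) ⊗ₜ M.D.one) ⊗ₜ
        (act (C ⊗ₜ M.graft (v ⊗ₜ y)) ⊗ₜ M.D.one)) =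
        M.cons (u ⊗ₜ (A ⊗ₜ act (C ⊗ₜ M.graft (v ⊗ₜ y)))) ⊗ₜ M.D.one := by
      rw [M.mul₂_tmul, M.braiding_one, sandwich_tmul, M.graft_mul, M.mul_one]
    rw [h.cons, map_sub, M.comul_graft, M.comul_cons_eq, M.comul_cons_eq, h.act₂_assoc,
      treeCoprod, treeCoprod, M.comul_mul, hC]
    simp only [TensorProduct.add_tmul, TensorProduct.tmul_add, map_add, h1, h.one_act₂,
      h.act₂_graft₂, graft₂_mul₂_one, TensorProduct.sub_tmul]
    abel

theorem IsDendriform.counit_act (h : M.IsDendriform act) (x : R) (v : V) (y : R) :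
    M.D.counit (act (x ⊗ₜ M.graft (v ⊗ₜ y))) = 0 := by
  induction x using M.induction with
  | hadd a b ha hb => simp only [TensorProduct.add_tmul, map_add, ha, hb, add_zero]
  | hsmul r a ha => simp only [← TensorProduct.smul_tmul', map_smul, ha, smul_zero]
  | hone => rw [h.one, M.counit_graft]
  | hcons u A C _ hC => rw [h.cons, map_sub, M.counit_cons, M.counit_graft, sub_zero]

end ForestModel

section Theta

variable {k V R Y : Type*} [CommRing k] [AddCommGroup V] [Module k V]
    [AddCommGroup R] [Module k R] [AddCommGroup Y] [Module k Y]
    {σ : V ⊗[k] V →ₗ[k] V ⊗[k] V}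

/-- The recursive description of the isomorphism `Θ` and of its inverse `Ψ`. -/
structure ThetaSystem (M : ForestModel R σ) (T : TreeModel Y σ) where
  act : R ⊗[k] R →ₗ[k] R
  dendriform : M.IsDendriform act
  Θ : Y →ₗ[k] R
  Θ_one : Θ T.D.one = M.D.one
  Θ_vee : ∀ a v b, Θ (T.vee (a ⊗ₜ (v ⊗ₜ b))) = act (Θ a ⊗ₜ M.graft (v ⊗ₜ Θ b))
  Ψ : R →ₗ[k] Y
  Ψ_one : Ψ M.D.one = T.D.one
  Ψ_cons : ∀ v F G, Ψ (M.cons (v ⊗ₜ (F ⊗ₜ G))) =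
    T.D.mul (T.vee (T.D.one ⊗ₜ (v ⊗ₜ Ψ F)) ⊗ₜ Ψ G)

namespace ThetaSystem

variable {M : ForestModel R σ} {T : TreeModel Y σ} (S : ThetaSystem M T)

theorem Θ_mul (a b : Y) : S.Θ (T.D.mul (a ⊗ₜ b)) = M.D.mul (S.Θ a ⊗ₜ S.Θ b) := by
  induction a using T.induction generalizing b with
  | hadd x y hx hy => simp only [TensorProduct.add_tmul, map_add, hx, hy]
  | hsmul r x hx => simp only [← TensorProduct.smul_tmul', map_smul, hx]
  | hone => rw [T.one_mul, S.Θ_one, M.one_mul]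
  | hvee a₁ u a₂ _ ha₂ =>
  induction b using T.induction with
  | hadd x y hx hy => simp only [TensorProduct.tmul_add, map_add, hx, hy]
  | hsmul r x hx => simp only [TensorProduct.tmul_smul, map_smul, hx]
  | hone => rw [T.mul_one, S.Θ_one, M.mul_one]
  | hvee b₁ v b₂ hb₁ _ =>
    rw [T.vee_mul_vee, map_add, S.Θ_vee, S.Θ_vee, ha₂, hb₁, S.dendriform.mul, ← S.Θ_vee b₁,
      S.Θ_vee a₁, ← S.dendriform.act_graft_mul]

theorem Θ_one_vee (v : V) (b : Y) :
    S.Θ (T.vee (T.D.one ⊗ₜ (v ⊗ₜ b))) = M.graft (v ⊗ₜ S.Θ b) := by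
  rw [S.Θ_vee, S.Θ_one, S.dendriform.one]

theorem Ψ_mul (x y : R) : S.Ψ (M.D.mul (x ⊗ₜ y)) = T.D.mul (S.Ψ x ⊗ₜ S.Ψ y) := by
  induction x using M.induction with
  | hadd x y hx hy => simp only [TensorProduct.add_tmul, map_add, hx, hy]
  | hsmul r x hx => simp only [← TensorProduct.smul_tmul', map_smul, hx]
  | hone => rw [M.one_mul, S.Ψ_one, T.one_mul]
  | hcons v F G _ hG => rw [M.cons_mul, S.Ψ_cons, hG, S.Ψ_cons, T.mul_assoc]

theorem Ψ_graft (v : V) (F : R) : S.Ψ (M.graft (v ⊗ₜ F)) =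
    T.vee (T.D.one ⊗ₜ (v ⊗ₜ S.Ψ F)) := by
  rw [M.graft_tmul, S.Ψ_cons, S.Ψ_one, T.mul_one]

theorem Ψ_act (x : R) (v : V) (y : R) : S.Ψ (S.act (x ⊗ₜ M.graft (v ⊗ₜ y))) =
    T.vee (S.Ψ x ⊗ₜ (v ⊗ₜ S.Ψ y)) := by
  induction x using M.induction with
  | hadd a b ha hb => simp only [TensorProduct.add_tmul, map_add, ha, hb]
  | hsmul r x hx => simp only [← TensorProduct.smul_tmul', map_smul, hx]
  | hone => rw [S.dendriform.one, S.Ψ_graft, S.Ψ_one]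
  | hcons u A C _ hC =>
    rw [S.dendriform.cons, map_sub, S.Ψ_cons, S.Ψ_graft, S.Ψ_mul, hC, T.vee_mul_vee,
      add_sub_cancel_left, S.Ψ_cons]

theorem Ψ_Θ (a : Y) : S.Ψ (S.Θ a) = a := by
  induction a using T.induction with
  | hadd x y hx hy => simp only [map_add, hx, hy]
  | hsmul r x hx => simp only [map_smul, hx]
  | hone => rw [S.Θ_one, S.Ψ_one]
  | hvee a v b ha hb => rw [S.Θ_vee, S.Ψ_act, ha, hb]

/-- An algebra homomorphism that is compatible with the grafting operators is inverse to `Ψ`. -/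
theorem apply_Ψ {Θ' : Y →ₗ[k] R} (h₁ : Θ' T.D.one = M.D.one)
    (h₂ : ∀ a b, Θ' (T.D.mul (a ⊗ₜ b)) = M.D.mul (Θ' a ⊗ₜ Θ' b))
    (h₃ : ∀ v b, Θ' (T.vee (T.D.one ⊗ₜ (v ⊗ₜ b))) = M.graft (v ⊗ₜ Θ' b)) (x : R) :
    Θ' (S.Ψ x) = x := by
  induction x using M.induction with
  | hadd x y hx hy => simp only [map_add, hx, hy]
  | hsmul r x hx => simp only [map_smul, hx]
  | hone => rw [S.Ψ_one, h₁]
  | hcons v F G hF hG => rw [S.Ψ_cons, h₂, h₃, hF, hG, M.graft_mul]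

theorem Θ_Ψ (x : R) : S.Θ (S.Ψ x) = x := S.apply_Ψ S.Θ_one S.Θ_mul S.Θ_one_vee x

theorem eq_Θ {Θ' : Y →ₗ[k] R} (h₁ : Θ' T.D.one = M.D.one)
    (h₂ : ∀ a b, Θ' (T.D.mul (a ⊗ₜ b)) = M.D.mul (Θ' a ⊗ₜ Θ' b))
    (h₃ : ∀ v b, Θ' (T.vee (T.D.one ⊗ₜ (v ⊗ₜ b))) = M.graft (v ⊗ₜ Θ' b)) : Θ' = S.Θ :=
  LinearMap.ext fun a => by rw [← S.Ψ_Θ a, S.apply_Ψ h₁ h₂ h₃, S.Θ_Ψ]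

/-- `Θ`, as a linear equivalence. -/
def equiv : Y ≃ₗ[k] R :=
  LinearEquiv.ofLinearMap S.Θ S.Ψ (LinearMap.ext S.Θ_Ψ) (LinearMap.ext S.Ψ_Θ)

theorem Θ_p_unit (n : ℕ) :
    S.Θ ∘ₗ T.p (n + 1) ∘ₗ LinearMap.toSpanSingleton k Y T.D.one = M.unit := by
  ext; simp [T.p_one, S.Θ_one]

theorem Θ_p_vee (n : ℕ) : S.Θ ∘ₗ T.p (n + 1) ∘ₗ T.vee =
    M.veeOp S.act ∘ₗ TensorProduct.map (S.Θ ∘ₗ T.p n)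
      (TensorProduct.map LinearMap.id (S.Θ ∘ₗ T.p n)) := by
  rw [T.p_vee]
  refine tensor_ext_right fun a v b => ?_
  simp [ForestModel.veeOp, S.Θ_vee]

theorem Θ_V : Intertwines T.τ M.τ LinearMap.id S.Θ := by
  refine T.cover.intertwines_right (x₁ := (TensorProduct.comm k V k).toLinearMap)
    ?_ T.τ_vee (fun n => ?_) (fun n ih => ?_)
  · exact TensorProduct.ext' fun u r => by simp [T.τ_one, TensorProduct.smul_tmul']
  · rw [S.Θ_p_unit]; exact M.unit_V
  · rw [S.Θ_p_vee]
    exact S.dendriform.veeOp_V.comp_right (ih.crossR (Intertwines.id.crossR ih))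

theorem Θ_braiding : Intertwines T.D.braiding M.D.braiding S.Θ S.Θ := by
  refine T.cover.intertwines_left (x₁ := (TensorProduct.comm k k Y).toLinearMap)
    ?_ T.braiding_vee (fun n => ?_) (fun n ih => ?_)
  · exact TensorProduct.ext' fun r u => by simp [T.braiding_one, ← TensorProduct.smul_tmul']
  · rw [S.Θ_p_unit]
    exact TensorProduct.ext' fun r u => by simp [M.braiding_one, ← TensorProduct.smul_tmul']
  · rw [S.Θ_p_vee]
    exact S.dendriform.veeOp_R.comp_left (ih.crossL (S.Θ_V.crossL ih))

theorem Θ_mulVee (P Q : Y ⊗[k] Y) (v : V) :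
    TensorProduct.map S.Θ S.Θ (TensorProduct.map T.D.mul T.vee
      (onMiddle Y (V ⊗[k] Y) T.D.braiding (P ⊗ₜ onFirst Y T.τ (v ⊗ₜ Q)))) =
      twistedAct M.D.mul S.act M.D.braiding (TensorProduct.map S.Θ S.Θ P ⊗ₜ
        M.graft₂ (v ⊗ₜ TensorProduct.map S.Θ S.Θ Q)) := by
  induction P using TensorProduct.induction_on with
  | zero => simp
  | add p q hp hq => simp only [map_add, TensorProduct.add_tmul, hp, hq]
  | tmul a b =>
  induction Q using TensorProduct.induction_on with
  | zero => simp
  | add p q hp hq => simp only [map_add, TensorProduct.tmul_add, hp, hq]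
  | tmul c d =>
    have hV := S.Θ_V.apply (v ⊗ₜ c)
    rw [TensorProduct.map_tmul, LinearMap.id_apply] at hV
    rw [onFirst_tmul, TensorProduct.map_tmul, TensorProduct.map_tmul, M.graft₂_tmul, ← hV]
    induction T.τ (v ⊗ₜ c) using TensorProduct.induction_on with
    | zero => simp
    | add p q hp hq => simp only [map_add, TensorProduct.add_tmul, TensorProduct.tmul_add, hp, hq]
    | tmul c' v' =>
      have hb := S.Θ_braiding.apply (b ⊗ₜ c')
      rw [TensorProduct.map_tmul] at hb
      simp only [TensorProduct.assoc_tmul, onMiddle_tmul, TensorProduct.map_tmul,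
        LinearMap.id_apply, LinearMap.comp_apply, LinearMap.flip_apply, TensorProduct.mk_apply,
        twistedAct_tmul, ← hb]
      induction T.D.braiding (b ⊗ₜ c') using TensorProduct.induction_on with
      | zero => simp
      | add p q hp hq => simp only [map_add, hp, hq]
      | tmul p q => simp [S.Θ_mul, S.Θ_vee]

theorem Θ_comul (a : Y) : TensorProduct.map S.Θ S.Θ (T.D.comul a) = M.D.comul (S.Θ a) := by
  induction a using T.induction with
  | hadd x y hx hy => simp only [map_add, hx, hy]
  | hsmul r x hx => simp only [map_smul, hx]
  | hone => simp [T.comul_one, S.Θ_one, M.comul_one]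
  | hvee a v b ha hb =>
    rw [T.comul_vee, map_add, S.Θ_mulVee, ha, hb, S.Θ_vee, S.dendriform.comul_act,
      TensorProduct.map_tmul, S.Θ_vee, S.Θ_one]

theorem Θ_counit (a : Y) : M.D.counit (S.Θ a) = T.D.counit a := by
  induction a using T.induction with
  | hadd x y hx hy => simp only [map_add, hx, hy]
  | hsmul r x hx => simp only [map_smul, hx]
  | hone => rw [S.Θ_one, M.counit_one, T.counit_one]
  | hvee a v b ha hb => rw [S.Θ_vee, S.dendriform.counit_act, T.counit_vee]

theorem isDataEquiv (h₁ : ∀ n, ∀ a ∈ T.D.grading n, S.Θ a ∈ M.D.grading n)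
    (h₂ : ∀ n, ∀ x ∈ M.D.grading n, S.Ψ x ∈ T.D.grading n) : IsDataEquiv T.D M.D S.equiv where
  one := S.Θ_one
  mul z := by
    induction z using TensorProduct.induction_on with
    | zero => simp
    | add p q hp hq => simp only [map_add, hp, hq]
    | tmul a b => exact S.Θ_mul a b
  comul := S.Θ_comul
  counit := S.Θ_counit
  braiding := S.Θ_braiding.apply
  grading n a := ⟨fun h => S.Ψ_Θ a ▸ h₂ n _ h, h₁ n a⟩

end ThetaSystem

end Theta

/-! ### Crossings of tensor powers -/

section Powers

variable {k V : Type*} [Field k] [AddCommGroup V] [Module k V]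

theorem mulEquiv_cast {a a' b b' : ℕ} (h : a = a') (h' : b = b') (x : ⨂[k]^a V) (y : ⨂[k]^b V) :
    TensorPower.mulEquiv (TensorPower.cast k V h x ⊗ₜ[k] TensorPower.cast k V h' y) =
      TensorPower.cast k V (h ▸ h' ▸ rfl) (TensorPower.mulEquiv (x ⊗ₜ[k] y)) := by
  subst h h'; simp

theorem consEquiv_cast {a a' : ℕ} (h : a = a') (v : V) (x : ⨂[k]^a V) :
    consEquiv k V a' (v ⊗ₜ TensorPower.cast k V h x) =
      TensorPower.cast k V (h ▸ rfl) (consEquiv k V a (v ⊗ₜ x)) := by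
  subst h; simp

theorem consEquiv_mul {a b : ℕ} (v : V) (x : ⨂[k]^a V) (y : ⨂[k]^b V) :
    TensorPower.mulEquiv (consEquiv k V a (v ⊗ₜ x) ⊗ₜ[k] y) =
      TensorPower.cast k V (Nat.add_right_comm a b 1)
        (consEquiv k V (a + b) (v ⊗ₜ TensorPower.mulEquiv (x ⊗ₜ[k] y))) := by
  have h := TensorPower.mul_assoc
    ((PiTensorProduct.subsingletonEquiv (R := k) (s := fun _ : Fin 1 => V) 0).symm v) x y
  simp only [TensorPower.gMul_def] at h
  simp only [consEquiv, LinearEquiv.trans_apply, TensorProduct.congr_tmul, LinearEquiv.refl_apply,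
    ← h, TensorPower.cast_cast]
  have key := mulEquiv_cast (k := k) (V := V) (Nat.add_comm 1 a) (rfl : b = b)
    (TensorPower.mulEquiv
      ((PiTensorProduct.subsingletonEquiv (R := k) (s := fun _ : Fin 1 => V) 0).symm v ⊗ₜ[k] x)) y
  rw [TensorPower.cast_refl, LinearEquiv.refl_apply] at key
  exact key

theorem algebraMap₀_mulEquiv {n : ℕ} (r : k) (x : ⨂[k]^n V) :
    TensorPower.mulEquiv ((TensorPower.algebraMap₀ r : ⨂[k]^0 V) ⊗ₜ[k] x) =
      TensorPower.cast k V (Nat.zero_add n).symm (r • x) := by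
  rw [← LinearEquiv.symm_apply_eq, TensorPower.cast_symm]
  exact TensorPower.algebraMap₀_mul r x

theorem mulEquiv_algebraMap₀ {n : ℕ} (r : k) (x : ⨂[k]^n V) :
    TensorPower.mulEquiv (x ⊗ₜ[k] (TensorPower.algebraMap₀ r : ⨂[k]^0 V)) = r • x := by
  have h := TensorPower.mul_algebraMap₀ r x
  rwa [TensorPower.cast_refl] at h

theorem consEquiv_one (v : V) : consEquiv k V 0 (v ⊗ₜ TensorPower.algebraMap₀ 1) =
    (PiTensorProduct.subsingletonEquiv (R := k) (s := fun _ : Fin 1 => V) 0).symm v := by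
  simp only [consEquiv, LinearEquiv.trans_apply, TensorProduct.congr_tmul, LinearEquiv.refl_apply]
  rw [mulEquiv_algebraMap₀, one_smul, TensorPower.cast_refl]
  rfl

variable (σ : V ⊗[k] V →ₗ[k] V ⊗[k] V)

/-- A vector crosses a tensor power. -/
def crossVec : (n : ℕ) → V ⊗[k] (⨂[k]^n V) →ₗ[k] (⨂[k]^n V) ⊗[k] V
  | 0 => (TensorProduct.comm k V (⨂[k]^0 V)).toLinearMap
  | n + 1 => TensorProduct.map (consEquiv k V n).toLinearMap LinearMap.id ∘ₗ
      crossR σ (crossVec n) ∘ₗ TensorProduct.map LinearMap.id (consEquiv k V n).symm.toLinearMap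

/-- A tensor power crosses a tensor power. -/
def crossPow : (m n : ℕ) → (⨂[k]^m V) ⊗[k] (⨂[k]^n V) →ₗ[k] (⨂[k]^n V) ⊗[k] (⨂[k]^m V)
  | 0, n => (TensorProduct.comm k (⨂[k]^0 V) (⨂[k]^n V)).toLinearMap
  | m + 1, n => TensorProduct.map LinearMap.id (consEquiv k V m).toLinearMap ∘ₗ
      crossL (crossVec σ n) (crossPow m n) ∘ₗ
      TensorProduct.map (consEquiv k V m).symm.toLinearMap LinearMap.id

theorem crossVec_zero : Intertwines (TensorProduct.comm k V k).toLinearMap (crossVec σ 0)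
    LinearMap.id (TensorPower.algebraMap₀ : k ≃ₗ[k] ⨂[k]^0 V).toLinearMap :=
  TensorProduct.ext' fun u r => by simp [crossVec]

theorem crossVec_cons (n : ℕ) : Intertwines (crossR σ (crossVec σ n)) (crossVec σ (n + 1))
    LinearMap.id (consEquiv k V n).toLinearMap := by
  rw [Intertwines, crossVec, LinearMap.comp_assoc, LinearMap.comp_assoc, ← TensorProduct.map_comp]
  simp

theorem crossVec_cast {m n : ℕ} (h : m = n) : Intertwines (crossVec σ m) (crossVec σ n)
    LinearMap.id (TensorPower.cast k V h).toLinearMap := by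
  subst h; rw [TensorPower.cast_refl]; exact Intertwines.id

theorem mulEquiv_zero_eq (b : ℕ) :
    (TensorPower.mulEquiv : (⨂[k]^0 V) ⊗[k] (⨂[k]^b V) ≃ₗ[k] _).toLinearMap =
      (TensorPower.cast k V (Nat.zero_add b).symm).toLinearMap ∘ₗ
        (TensorProduct.lid k _).toLinearMap ∘ₗ
        TensorProduct.map (TensorPower.algebraMap₀ : k ≃ₗ[k] ⨂[k]^0 V).symm.toLinearMap
          LinearMap.id := by
  refine TensorProduct.ext' fun a b => ?_
  obtain ⟨r, rfl⟩ := (TensorPower.algebraMap₀ : k ≃ₗ[k] ⨂[k]^0 V).surjective a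
  simp [algebraMap₀_mulEquiv]

theorem mulEquiv_succ_eq (a b : ℕ) :
    (TensorPower.mulEquiv : (⨂[k]^(a + 1) V) ⊗[k] (⨂[k]^b V) ≃ₗ[k] _).toLinearMap =
      (TensorPower.cast k V (Nat.add_right_comm a b 1)).toLinearMap ∘ₗ
        (consEquiv k V (a + b)).toLinearMap ∘ₗ
        TensorProduct.map LinearMap.id TensorPower.mulEquiv.toLinearMap ∘ₗ
        (TensorProduct.assoc k V (⨂[k]^a V) (⨂[k]^b V)).toLinearMap ∘ₗ
        TensorProduct.map (consEquiv k V a).symm.toLinearMap LinearMap.id := by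
  refine TensorProduct.ext' fun z y => ?_
  obtain ⟨z, rfl⟩ := (consEquiv k V a).surjective z
  induction z using TensorProduct.induction_on with
  | zero => simp
  | add p q hp hq => simp only [map_add, TensorProduct.add_tmul, hp, hq]
  | tmul v x =>
    simp only [LinearMap.comp_apply, TensorProduct.map_tmul, LinearEquiv.coe_coe,
      LinearEquiv.symm_apply_apply, LinearMap.id_apply, TensorProduct.assoc_tmul]
    exact consEquiv_mul v x y

theorem crossVec_mul (a b : ℕ) : Intertwines (crossR (crossVec σ a) (crossVec σ b))
    (crossVec σ (a + b)) LinearMap.id TensorPower.mulEquiv.toLinearMap := by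
  induction a with
  | zero =>
    rw [mulEquiv_zero_eq]
    exact (crossVec_cast σ _).comp_right ((Intertwines.lid_right _).comp_right
      ((crossVec_zero σ).symm_right.crossR Intertwines.id))
  | succ a ih =>
    rw [mulEquiv_succ_eq]
    exact (crossVec_cast σ _).comp_right ((crossVec_cons σ _).comp_right
      ((Intertwines.id.crossR ih).comp_right ((Intertwines.assoc_right _ _ _).comp_right
        ((crossVec_cons σ a).symm_right.crossR Intertwines.id))))

theorem crossPow_zero (n : ℕ) : Intertwines (TensorProduct.comm k k (⨂[k]^n V)).toLinearMap
    (crossPow σ 0 n) (TensorPower.algebraMap₀ : k ≃ₗ[k] ⨂[k]^0 V).toLinearMap LinearMap.id :=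
  TensorProduct.ext' fun u r => by simp [crossPow]

theorem crossPow_cons (m n : ℕ) : Intertwines (crossL (crossVec σ n) (crossPow σ m n))
    (crossPow σ (m + 1) n) (consEquiv k V m).toLinearMap LinearMap.id := by
  rw [Intertwines, crossPow, LinearMap.comp_assoc, LinearMap.comp_assoc, ← TensorProduct.map_comp]
  simp

theorem crossPow_mul (a b n : ℕ) : Intertwines (crossL (crossPow σ a n) (crossPow σ b n))
    (crossPow σ (a + b) n) TensorPower.mulEquiv.toLinearMap LinearMap.id := by
  have hc : ∀ {m m' : ℕ} (h : m = m'), Intertwines (crossPow σ m n) (crossPow σ m' n)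
      (TensorPower.cast k V h).toLinearMap LinearMap.id := by
    rintro m _ rfl; rw [TensorPower.cast_refl]; exact Intertwines.id
  induction a with
  | zero =>
    rw [mulEquiv_zero_eq]
    exact (hc _).comp_left ((Intertwines.lid_left _).comp_left
      ((crossPow_zero σ n).symm_left.crossL Intertwines.id))
  | succ a ih =>
    rw [mulEquiv_succ_eq]
    exact (hc _).comp_left ((crossPow_cons σ _ n).comp_left
      ((Intertwines.id.crossL ih).comp_left ((Intertwines.assoc_left _ _ _).comp_left
        ((crossPow_cons σ a n).symm_left.crossL Intertwines.id))))

/-! ### Lifts of permutations, recursively -/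

/-- `σ_{d-1} ⋯ σ_1 σ_0`, which moves the first tensor factor behind the next `d` ones. -/
def moveFirst (n d : ℕ) : ⨂[k]^n V →ₗ[k] ⨂[k]^n V :=
  ((List.range d).reverse.map (sigmaAt σ n)).foldr (fun f g => f ∘ₗ g) LinearMap.id

theorem foldr_comp_append {M : Type*} [AddCommGroup M] [Module k M] (l l' : List (M →ₗ[k] M)) :
    (l ++ l').foldr (fun f g => f ∘ₗ g) LinearMap.id =
      l.foldr (fun f g => f ∘ₗ g) LinearMap.id ∘ₗ l'.foldr (fun f g => f ∘ₗ g) LinearMap.id := by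
  induction l with
  | nil => rfl
  | cons f l ih => simp only [List.cons_append, List.foldr_cons, ih, LinearMap.comp_assoc]

theorem sigmaAt_succ_consEquiv (n i : ℕ) (v : V) (x : ⨂[k]^n V) :
    sigmaAt σ (n + 1) (i + 1) (consEquiv k V n (v ⊗ₜ x)) =
      consEquiv k V n (v ⊗ₜ sigmaAt σ n i x) := by
  cases n <;> simp [sigmaAt]

theorem sigmaAt_zero_consEquiv (n : ℕ) (v u : V) (x : ⨂[k]^n V) :
    sigmaAt σ (n + 2) 0 (consEquiv k V (n + 1) (v ⊗ₜ consEquiv k V n (u ⊗ₜ x))) =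
      consEquiv k V (n + 1) ((consEquiv k V n).toLinearMap.lTensor V
        (TensorProduct.assoc k V V _ (σ (v ⊗ₜ u) ⊗ₜ x))) := by
  simp only [sigmaAt, LinearMap.comp_apply, LinearEquiv.coe_coe, LinearEquiv.trans_symm,
    LinearEquiv.trans_apply, LinearEquiv.symm_apply_apply, TensorProduct.congr_symm_tmul,
    LinearEquiv.refl_symm, LinearEquiv.refl_apply, onFirst_tmul]
  rfl

theorem foldr_sigmaAt_succ (n : ℕ) (l : List ℕ) (v : V) (x : ⨂[k]^n V) :
    ((l.map (· + 1)).map (sigmaAt σ (n + 1))).foldr (fun f g => f ∘ₗ g) LinearMap.id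
        (consEquiv k V n (v ⊗ₜ x)) =
      consEquiv k V n (v ⊗ₜ
        ((l.map (sigmaAt σ n)).foldr (fun f g => f ∘ₗ g) LinearMap.id) x) := by
  induction l with
  | nil => rfl
  | cons i l ih =>
    simp only [List.map_cons, List.foldr_cons, LinearMap.comp_apply, ih, sigmaAt_succ_consEquiv]

theorem braidLift_consEquiv {n : ℕ} (w : Equiv.Perm (Fin (n + 1))) (v : V) (x : ⨂[k]^n V) :
    braidLift σ w (consEquiv k V n (v ⊗ₜ x)) =
      moveFirst σ (n + 1) (w 0) (consEquiv k V n (v ⊗ₜ braidLift σ (deleteZero w) x)) := by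
  rw [braidLift, reducedWord, List.map_append, foldr_comp_append, LinearMap.comp_apply,
    foldr_sigmaAt_succ]
  rfl

theorem moveFirst_zero (n : ℕ) (x : ⨂[k]^n V) : moveFirst σ n 0 x = x := rfl

theorem moveFirst_succ (n d : ℕ) (v u : V) (x : ⨂[k]^n V) :
    moveFirst σ (n + 2) (d + 1) (consEquiv k V (n + 1) (v ⊗ₜ consEquiv k V n (u ⊗ₜ x))) =
      consEquiv k V (n + 1) ((moveFirst σ (n + 1) d ∘ₗ (consEquiv k V n).toLinearMap).lTensor V
        (TensorProduct.assoc k V V _ (σ (v ⊗ₜ u) ⊗ₜ x))) := by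
  have h : (List.range (d + 1)).reverse = ((List.range d).reverse.map (· + 1)) ++ [0] := by
    rw [List.range_succ_eq_map, List.reverse_cons, ← List.map_reverse]
  rw [moveFirst, h, List.map_append, foldr_comp_append, LinearMap.comp_apply]
  simp only [List.map_cons, List.map_nil, List.foldr_cons, List.foldr_nil, LinearMap.comp_id]
  rw [sigmaAt_zero_consEquiv]
  induction σ (v ⊗ₜ u) using TensorProduct.induction_on with
  | zero => simp
  | add p q hp hq => simp only [map_add, TensorProduct.add_tmul, hp, hq]
  | tmul p q =>
    rw [TensorProduct.assoc_tmul, LinearMap.lTensor_tmul, foldr_sigmaAt_succ]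
    rfl

theorem moveFirst_cast {m n : ℕ} (h : m = n) (d : ℕ) (x : ⨂[k]^m V) :
    moveFirst σ n d (TensorPower.cast k V h x) = TensorPower.cast k V h (moveFirst σ m d x) := by
  subst h; simp

theorem moveFirst_consEquiv (d e : ℕ) (v : V) (a : ⨂[k]^d V) (b : ⨂[k]^e V) :
    moveFirst σ (d + e + 1) d (consEquiv k V (d + e) (v ⊗ₜ TensorPower.mulEquiv (a ⊗ₜ[k] b))) =
      TensorPower.mulEquiv ((consEquiv k V e).toLinearMap.lTensor (⨂[k]^d V)
        (onFirst (⨂[k]^e V) (crossVec σ d) (v ⊗ₜ (a ⊗ₜ b)))) := by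
  induction d generalizing v with
  | zero =>
    obtain ⟨r, rfl⟩ := (TensorPower.algebraMap₀ : k ≃ₗ[k] ⨂[k]^0 V).surjective a
    rw [moveFirst_zero, algebraMap₀_mulEquiv, onFirst_tmul, crossVec, LinearEquiv.coe_coe,
      TensorProduct.comm_tmul, TensorProduct.assoc_tmul, LinearMap.lTensor_tmul,
      algebraMap₀_mulEquiv, consEquiv_cast]
    simp
  | succ d ih =>
    obtain ⟨a, rfl⟩ := (consEquiv k V d).surjective a
    induction a using TensorProduct.induction_on with
    | zero => simp
    | add p q hp hq => simp only [map_add, TensorProduct.add_tmul, TensorProduct.tmul_add, hp, hq]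
    | tmul u a =>
      have ht := (crossVec_cons σ d).apply (v ⊗ₜ (u ⊗ₜ a))
      rw [TensorProduct.map_tmul, LinearMap.id_apply, LinearEquiv.coe_coe, crossR_tmul] at ht
      rw [consEquiv_mul, consEquiv_cast, moveFirst_cast, moveFirst_succ, onFirst_tmul, ← ht]
      induction σ (v ⊗ₜ u) using TensorProduct.induction_on with
      | zero => simp
      | add p q hp hq => simp only [map_add, TensorProduct.add_tmul, hp, hq]
      | tmul u' v' =>
        rw [TensorProduct.assoc_tmul, LinearMap.lTensor_tmul, LinearMap.comp_apply,
          LinearEquiv.coe_coe, ih, onFirst_tmul, crossRSnd_tmul]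
        induction crossVec σ d (v' ⊗ₜ a) using TensorProduct.induction_on with
        | zero => simp
        | add p q hp hq => simp only [map_add, TensorProduct.add_tmul, TensorProduct.tmul_add, hp,
          hq]
        | tmul a' v' =>
          simp only [TensorProduct.assoc_tmul, TensorProduct.assoc_symm_tmul,
            TensorProduct.map_tmul, LinearMap.lTensor_tmul, LinearEquiv.coe_coe,
            LinearMap.id_apply]
          exact (consEquiv_mul (b := e + 1) u' a' (consEquiv k V e (v' ⊗ₜ b))).symm

end Powers

section Unshuffles

theorem succAbove_deleteZero {n : ℕ} (w : Equiv.Perm (Fin (n + 1))) (i : Fin n) :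
    (w 0).succAbove (deleteZero w i) = w i.succ := by
  have h : ∀ y : {y : Fin (n + 1) // y ≠ w 0},
      (w 0).succAbove ((finSuccAboveEquiv (w 0)).symm y) = y := fun y =>
    congrArg Subtype.val ((finSuccAboveEquiv (w 0)).apply_symm_apply y)
  simp only [deleteZero, Equiv.trans_apply, h]
  exact congrArg w (congrFun Fin.succAbove_zero i)

theorem val_deleteZero {n : ℕ} (w : Equiv.Perm (Fin (n + 1))) (i : Fin n) :
    (w i.succ : ℕ) = if (deleteZero w i : ℕ) < w 0 then (deleteZero w i : ℕ)
      else deleteZero w i + 1 := by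
  rw [← succAbove_deleteZero, Fin.succAbove]
  simp only [Fin.lt_def, Fin.val_castSucc]
  split_ifs <;> rfl

theorem deleteZero_lt_deleteZero {n : ℕ} (w : Equiv.Perm (Fin (n + 1))) (i j : Fin n) :
    deleteZero w i < deleteZero w j ↔ w i.succ < w j.succ := by
  rw [← succAbove_deleteZero, ← succAbove_deleteZero, Fin.succAbove_lt_succAbove_iff]

/-- `w` moves the positions `i` with `f i = true` to the front and the others to the back, without
changing the order among them. -/
structure IsUnshuffle {n : ℕ} (w : Equiv.Perm (Fin n)) (f : Fin n → Bool) : Prop where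
  mono : ∀ i j, f i = f j → i < j → w i < w j
  sep : ∀ i j, f i = true → f j = false → w i < w j

namespace IsUnshuffle

variable {n : ℕ} {w : Equiv.Perm (Fin (n + 1))} {f : Fin (n + 1) → Bool}

theorem tail (h : IsUnshuffle w f) : IsUnshuffle (deleteZero w) (Fin.tail f) where
  mono i j hf hij := (deleteZero_lt_deleteZero w i j).2 (h.mono _ _ hf (Fin.succ_lt_succ_iff.2 hij))
  sep i j hi hj := (deleteZero_lt_deleteZero w i j).2 (h.sep _ _ hi hj)

theorem card_lt_apply_zero (w : Equiv.Perm (Fin (n + 1))) :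
    (Finset.univ.filter fun j => w j < w 0).card = w 0 := by
  have h : (Finset.univ.filter fun j => w j < w 0).map w.toEmbedding = Finset.Iio (w 0) := by
    ext j
    simp only [Finset.mem_map, Finset.mem_filter, Finset.mem_univ, true_and, Finset.mem_Iio]
    exact ⟨fun ⟨a, ha, h⟩ => h ▸ ha, fun hj => ⟨w.symm j, by simpa using hj, by simp⟩⟩
  rw [← Finset.card_map w.toEmbedding, h, Fin.card_Iio]

theorem apply_zero_of_true (h : IsUnshuffle w f) (h0 : f 0 = true) : (w 0 : ℕ) = 0 := by
  rw [← card_lt_apply_zero w, Finset.card_eq_zero, Finset.filter_eq_empty_iff]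
  intro j _ hj
  rcases eq_or_ne j 0 with rfl | hj0
  · exact lt_irrefl _ hj
  · cases hf : f j
    · exact lt_asymm hj (h.sep _ _ h0 hf)
    · exact lt_asymm hj (h.mono _ _ (h0.trans hf.symm) (Fin.pos_of_ne_zero hj0))

theorem apply_zero_of_false (h : IsUnshuffle w f) (h0 : f 0 = false) :
    (w 0 : ℕ) = (Finset.univ.filter fun j => f j = true).card := by
  rw [← card_lt_apply_zero w]
  congr 1
  refine Finset.filter_congr fun j _ => ⟨fun hj => ?_, fun hj => h.sep _ _ hj h0⟩
  by_contra hf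
  rw [Bool.not_eq_true] at hf
  rcases eq_or_ne j 0 with rfl | hj0
  · exact lt_irrefl _ hj
  · exact lt_asymm hj (h.mono _ _ (h0.trans hf.symm) (Fin.pos_of_ne_zero hj0))

end IsUnshuffle

theorem Forest.Sub.isUnshuffle {F : Forest} (c : F.Sub) : IsUnshuffle c.perm⁻¹ c.mem := by
  have hv : ∀ i, i ∈ c.vertices ↔ c.mem i = true := fun i => by simp [vertices]
  have hl : ∀ a : Fin c.part.deg, c.perm (Fin.cast c.part_add_rest (Fin.castAdd _ a)) =
      c.vertices.orderEmbOfFin c.card_vertices a := fun a => by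
    simp [perm]
  have hr : ∀ a : Fin c.rest.deg, c.perm (Fin.cast c.part_add_rest (Fin.natAdd _ a)) =
      c.verticesᶜ.orderEmbOfFin c.card_compl a := fun a => by
    simp [perm]
  have hl' : ∀ i, c.mem i = true → ∃ a, i = c.vertices.orderEmbOfFin c.card_vertices a ∧
      c.perm⁻¹ i = Fin.cast c.part_add_rest (Fin.castAdd _ a) := fun i hi => by
    have : i ∈ Set.range (c.vertices.orderEmbOfFin c.card_vertices) := by
      rw [Finset.range_orderEmbOfFin]; exact (hv i).2 hi
    obtain ⟨a, rfl⟩ := this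
    exact ⟨a, rfl, by rw [Equiv.Perm.inv_eq_iff_eq, hl]⟩
  have hr' : ∀ i, c.mem i = false → ∃ a, i = c.verticesᶜ.orderEmbOfFin c.card_compl a ∧
      c.perm⁻¹ i = Fin.cast c.part_add_rest (Fin.natAdd _ a) := fun i hi => by
    have : i ∈ Set.range (c.verticesᶜ.orderEmbOfFin c.card_compl) := by
      rw [Finset.range_orderEmbOfFin]
      simp [hv, hi]
    obtain ⟨a, rfl⟩ := this
    exact ⟨a, rfl, by rw [Equiv.Perm.inv_eq_iff_eq, hr]⟩
  constructor
  · intro i j hij hlt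
    cases hi : c.mem i
    · obtain ⟨a, rfl, ha⟩ := hr' i hi
      obtain ⟨b, rfl, hb⟩ := hr' j (hij ▸ hi)
      rw [OrderEmbedding.lt_iff_lt] at hlt
      rw [ha, hb, Fin.lt_def]
      exact Nat.add_lt_add_left hlt _
    · obtain ⟨a, rfl, ha⟩ := hl' i hi
      obtain ⟨b, rfl, hb⟩ := hl' j (hij ▸ hi)
      rw [OrderEmbedding.lt_iff_lt] at hlt
      rw [ha, hb, Fin.lt_def]
      exact hlt
  · intro i j hi hj
    obtain ⟨a, rfl, ha⟩ := hl' i hi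
    obtain ⟨b, rfl, hb⟩ := hr' j hj
    rw [ha, hb]
    simp only [Fin.lt_def, Fin.val_cast, Fin.val_castAdd, Fin.val_natAdd]
    omega

variable {k V : Type*} [Field k] [AddCommGroup V] [Module k V]
  (σ : V ⊗[k] V →ₗ[k] V ⊗[k] V)

/-- The lift of `w`, followed by the decomposition of the tensor factors into blocks. -/
def unshuffle {n p q : ℕ} (w : Equiv.Perm (Fin n)) (h : n = p + q) :
    ⨂[k]^n V →ₗ[k] (⨂[k]^p V) ⊗[k] (⨂[k]^q V) :=
  TensorPower.mulEquiv.symm.toLinearMap ∘ₗ (TensorPower.cast k V h).toLinearMap ∘ₗ braidLift σ w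

theorem unshuffle_consEquiv_of_zero {n p q : ℕ} (w : Equiv.Perm (Fin (n + 1))) (h' : n = p + q)
    (h : n + 1 = p + 1 + q) (hw : (w 0 : ℕ) = 0) (v : V) (x : ⨂[k]^n V) :
    unshuffle σ w h (consEquiv k V n (v ⊗ₜ x)) = (consEquiv k V p).toLinearMap.rTensor _
      ((TensorProduct.assoc k V _ _).symm (v ⊗ₜ unshuffle σ (deleteZero w) h' x)) := by
  subst h'
  simp only [unshuffle, LinearMap.comp_apply, LinearEquiv.coe_coe]
  rw [LinearEquiv.symm_apply_eq, TensorPower.cast_refl, LinearEquiv.refl_apply,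
    braidLift_consEquiv, hw, moveFirst_zero]
  obtain ⟨z, hz⟩ := TensorPower.mulEquiv.surjective (braidLift σ (deleteZero w) x)
  rw [← hz, LinearEquiv.symm_apply_apply]
  clear hz
  induction z using TensorProduct.induction_on with
  | zero => simp
  | add a b ha hb => simp only [map_add, TensorProduct.tmul_add, ha, hb]
  | tmul a b =>
    rw [TensorProduct.assoc_symm_tmul, LinearMap.rTensor_tmul, LinearEquiv.coe_coe, consEquiv_mul]

theorem unshuffle_consEquiv_of_eq {n p q : ℕ} (w : Equiv.Perm (Fin (n + 1))) (h' : n = p + q)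
    (h : n + 1 = p + (q + 1)) (hw : (w 0 : ℕ) = p) (v : V) (x : ⨂[k]^n V) :
    unshuffle σ w h (consEquiv k V n (v ⊗ₜ x)) = (consEquiv k V q).toLinearMap.lTensor _
      (onFirst _ (crossVec σ p) (v ⊗ₜ unshuffle σ (deleteZero w) h' x)) := by
  subst h'
  simp only [unshuffle, LinearMap.comp_apply, LinearEquiv.coe_coe]
  rw [LinearEquiv.symm_apply_eq, TensorPower.cast_refl, LinearEquiv.refl_apply,
    braidLift_consEquiv, hw, TensorPower.cast_refl, LinearEquiv.refl_apply]
  obtain ⟨z, hz⟩ := TensorPower.mulEquiv.surjective (braidLift σ (deleteZero w) x)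
  rw [← hz, LinearEquiv.symm_apply_apply]
  clear hz
  induction z using TensorProduct.induction_on with
  | zero => simp
  | add a b ha hb => simp only [map_add, TensorProduct.tmul_add, ha, hb]
  | tmul a b => exact moveFirst_consEquiv σ p q v a b

theorem braidLift_of_apply_eq {n : ℕ} (w : Equiv.Perm (Fin n)) (h : ∀ i, (w i : ℕ) = i)
    (x : ⨂[k]^n V) : braidLift σ w x = x := by
  induction n with
  | zero => rfl
  | succ n ih =>
    obtain ⟨z, rfl⟩ := (consEquiv k V n).surjective x
    induction z using TensorProduct.induction_on with
    | zero => simp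
    | add a b ha hb => simp only [map_add, ha, hb]
    | tmul v x =>
      rw [braidLift_consEquiv, h 0, Fin.val_zero, moveFirst_zero, ih]
      intro i
      have h0 := h 0
      have hi := val_deleteZero w i
      rw [h i.succ, h0] at hi
      simpa using hi.symm

theorem unshuffle_eq_crossPow {m n N : ℕ} (e : m + n = N) (h : N = n + m)
    (w : Equiv.Perm (Fin N)) (hw : ∀ i, (w i : ℕ) = if (i : ℕ) < m then (i : ℕ) + n else i - m)
    (x : ⨂[k]^m V) (y : ⨂[k]^n V) :
    unshuffle σ w h (TensorPower.cast k V e (TensorPower.mulEquiv (x ⊗ₜ[k] y))) =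
      crossPow σ m n (x ⊗ₜ y) := by
  induction m generalizing N with
  | zero =>
    obtain rfl : N = n := h
    obtain ⟨r, rfl⟩ := (TensorPower.algebraMap₀ : k ≃ₗ[k] ⨂[k]^0 V).surjective x
    simp only [unshuffle, LinearMap.comp_apply, LinearEquiv.coe_coe]
    rw [braidLift_of_apply_eq σ w (by simpa using hw), LinearEquiv.symm_apply_eq, crossPow,
      LinearEquiv.coe_coe, TensorProduct.comm_tmul, mulEquiv_algebraMap₀, algebraMap₀_mulEquiv,
      TensorPower.cast_refl, LinearEquiv.refl_apply, TensorPower.cast_cast, TensorPower.cast_refl,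
      LinearEquiv.refl_apply]
  | succ m ih =>
    cases N with
    | zero => omega
    | succ N =>
    obtain ⟨z, rfl⟩ := (consEquiv k V m).surjective x
    induction z using TensorProduct.induction_on with
    | zero => simp
    | add a b ha hb => simp only [map_add, TensorProduct.add_tmul, ha, hb]
    | tmul v x =>
      have e' : m + n = N := by omega
      have h' : N = n + m := by omega
      have hw0 : (w 0 : ℕ) = n := by simpa using hw 0
      have hi : ∀ i, (deleteZero w i : ℕ) = if (i : ℕ) < m then (i : ℕ) + n else i - m := by
        intro i
        have h1 := val_deleteZero w i
        rw [hw, hw0, Fin.val_succ] at h1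
        split_ifs at h1 ⊢ <;> omega
      have hβ := (crossPow_cons σ m n).apply ((v ⊗ₜ x) ⊗ₜ y)
      rw [TensorProduct.map_tmul, LinearMap.id_apply, LinearEquiv.coe_coe] at hβ
      rw [consEquiv_mul, TensorPower.cast_cast, ← hβ]
      have hc := consEquiv_cast e' v (TensorPower.mulEquiv (x ⊗ₜ[k] y))
      refine Eq.trans (congrArg _ hc.symm) ?_
      rw [unshuffle_consEquiv_of_eq σ w h' h hw0, ih e' h' _ hi]
      rfl

theorem beta_eq_crossPow (m n : ℕ) : beta σ m n = crossPow σ m n := by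
  refine TensorProduct.ext' fun x y => ?_
  rw [← unshuffle_eq_crossPow σ rfl (Nat.add_comm m n) (chi m n), TensorPower.cast_refl]
  · rfl
  · intro i
    refine Fin.addCases (fun a => ?_) (fun a => ?_) i
    · simp [chi, Nat.add_comm]
    · simp [chi]

theorem map_beta_one (n : ℕ) :
    TensorProduct.map LinearMap.id
        (PiTensorProduct.subsingletonEquiv (R := k) (s := fun _ : Fin 1 => V) 0).toLinearMap ∘ₗ
      beta σ 1 n ∘ₗ (PiTensorProduct.subsingletonEquiv (R := k)
        (s := fun _ : Fin 1 => V) 0).symm.toLinearMap.rTensor (⨂[k]^n V) = crossVec σ n := by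
  refine TensorProduct.ext' fun v y => ?_
  have hβ := (crossPow_cons σ 0 n).apply ((v ⊗ₜ TensorPower.algebraMap₀ 1) ⊗ₜ y)
  rw [TensorProduct.map_tmul, LinearMap.id_apply, LinearEquiv.coe_coe, consEquiv_one,
    crossL_tmul, crossPow, LinearEquiv.coe_coe, TensorProduct.comm_tmul, crossLSnd_tmul] at hβ
  rw [beta_eq_crossPow, LinearMap.comp_apply, LinearMap.comp_apply, LinearMap.rTensor_tmul,
    LinearEquiv.coe_coe, ← hβ]
  induction crossVec σ n (v ⊗ₜ y) using TensorProduct.induction_on with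
  | zero => simp
  | add a b ha hb => simp only [map_add, TensorProduct.add_tmul, ha, hb]
  | tmul a u =>
    simp only [TensorProduct.assoc_tmul, TensorProduct.map_tmul, LinearEquiv.coe_coe,
      LinearMap.id_apply, consEquiv_one, LinearEquiv.apply_symm_apply]

end Unshuffles

section Reduction

variable {k : Type*} [CommRing k] {A A' B M M₁ : Type*} [AddCommGroup A] [Module k A]
  [AddCommGroup A'] [Module k A'] [AddCommGroup B] [Module k B] [AddCommGroup M] [Module k M]
  [AddCommGroup M₁] [Module k M₁]

theorem Intertwines.apply_of_comp {A₁ : Type*} [AddCommGroup A₁] [Module k A₁]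
    {x : A ⊗[k] M →ₗ[k] M ⊗[k] A} {x₁ : A₁ ⊗[k] M₁ →ₗ[k] M₁ ⊗[k] A₁}
    {x' : A' ⊗[k] B →ₗ[k] B ⊗[k] A'} {d : A₁ →ₗ[k] A} {e : M₁ →ₗ[k] M}
    {f : A →ₗ[k] A'} {g : M →ₗ[k] B} (h₁ : Intertwines x₁ x d e)
    (hg : Intertwines x₁ x' (f ∘ₗ d) (g ∘ₗ e)) (a : A₁) (m : M₁) :
    (TensorProduct.map g f ∘ₗ x) (d a ⊗ₜ e m) = (x' ∘ₗ TensorProduct.map f g) (d a ⊗ₜ e m) := by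
  have q := hg.apply (a ⊗ₜ m)
  have r := h₁.apply (a ⊗ₜ m)
  rw [TensorProduct.map_tmul] at r
  rw [TensorProduct.map_comp, LinearMap.comp_apply, r] at q
  simpa using q

theorem Intertwines.comp_of_left {x : A ⊗[k] M →ₗ[k] M ⊗[k] A} {x₁ : M₁ ⊗[k] M →ₗ[k] M ⊗[k] M₁}
    {x' : A' ⊗[k] B →ₗ[k] B ⊗[k] A'} {f : M₁ →ₗ[k] A'} {g : M →ₗ[k] B} {e : A →ₗ[k] M₁}
    (h : Intertwines x₁ x' f g) (he : Intertwines x x₁ e LinearMap.id) :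
    Intertwines x x' (f ∘ₗ e) g := by
  have := h.comp he
  rwa [LinearMap.comp_id] at this

theorem Intertwines.ext_right {x : A ⊗[k] (M ⊗[k] M₁) →ₗ[k] (M ⊗[k] M₁) ⊗[k] A}
    {x' : A' ⊗[k] B →ₗ[k] B ⊗[k] A'} {f : A →ₗ[k] A'} {g : M ⊗[k] M₁ →ₗ[k] B}
    (h : ∀ a m n, (TensorProduct.map g f ∘ₗ x) (a ⊗ₜ (m ⊗ₜ n)) =
      (x' ∘ₗ TensorProduct.map f g) (a ⊗ₜ (m ⊗ₜ n))) : Intertwines x x' f g :=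
  tensor_ext_right h

theorem Intertwines.ext_left {x : (M ⊗[k] M₁) ⊗[k] A →ₗ[k] A ⊗[k] (M ⊗[k] M₁)}
    {x' : B ⊗[k] A' →ₗ[k] A' ⊗[k] B} {f : A →ₗ[k] A'} {g : M ⊗[k] M₁ →ₗ[k] B}
    (h : ∀ m n a, (TensorProduct.map f g ∘ₗ x) ((m ⊗ₜ n) ⊗ₜ a) =
      (x' ∘ₗ TensorProduct.map g f) ((m ⊗ₜ n) ⊗ₜ a)) : Intertwines x x' g f :=
  tensor_ext_left h

end Reduction

/-! ### Decorated shapes -/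

section Shapes

variable {k V : Type*} [Field k] [AddCommGroup V] [Module k V]
  {S : Type*} [DecidableEq S] {deg : S → ℕ}

theorem decorate_cast {s : S} {m n : ℕ} (h : deg s = n) (e : m = n) (x : ⨂[k]^m V) :
    decorate k V deg s h (TensorPower.cast k V e x) = decorate k V deg s (h.trans e.symm) x := by
  subst e; simp

theorem decorate_rfl (s : S) :
    decorate k V deg s rfl = DirectSum.lof k S (fun s => ⨂[k]^(deg s) V) s := by
  ext; simp [decorate]

theorem decorated_induction {P : Decorated k V deg → Prop} (zero : P 0)
    (add : ∀ x y, P x → P y → P (x + y)) (dec : ∀ s x, P (decorate k V deg s rfl x))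
    (x : Decorated k V deg) : P x := by
  induction x using DirectSum.induction_on with
  | zero => exact zero
  | of s x =>
    have := dec s x
    rwa [decorate_rfl] at this
  | add x y hx hy => exact add x y hx hy

theorem decorated_ext {P : Type*} [AddCommGroup P] [Module k P] {f g : Decorated k V deg →ₗ[k] P}
    (h : ∀ s x, f (decorate k V deg s rfl x) = g (decorate k V deg s rfl x)) : f = g := by
  refine LinearMap.ext fun x => ?_
  induction x using decorated_induction with
  | zero => simp
  | add x y hx hy => simp only [map_add, hx, hy]
  | dec s x => exact h s x

theorem toModule_decorate {P : Type*} [AddCommMonoid P] [Module k P]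
    (f : ∀ s, ⨂[k]^(deg s) V →ₗ[k] P) (s : S) (x : ⨂[k]^(deg s) V) :
    DirectSum.toModule k S P f (decorate k V deg s rfl x) = f s x := by
  rw [decorate_rfl, DirectSum.toModule_lof]

variable (σ : V ⊗[k] V →ₗ[k] V ⊗[k] V)

theorem decorate_decBraiding {s t : S} {m n : ℕ} (hs : deg s = m) (ht : deg t = n) :
    Intertwines (crossPow σ m n) (decBraiding deg σ) (decorate k V deg s hs)
      (decorate k V deg t ht) := by
  subst hs ht
  refine TensorProduct.ext' fun x y => ?_
  simp [decBraiding, toModule_decorate, beta_eq_crossPow]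

theorem decorate_vecBraiding {s : S} {n : ℕ} (hs : deg s = n) :
    Intertwines (crossVec σ n) (vecBraiding deg σ) LinearMap.id (decorate k V deg s hs) := by
  subst hs
  refine TensorProduct.ext' fun x y => ?_
  rw [← map_beta_one]
  simp only [vecBraiding, TensorProduct.lift.tmul, LinearMap.comp_apply, LinearMap.flip_apply,
    toModule_decorate, TensorProduct.curry_apply, TensorProduct.map_tmul, LinearMap.id_apply]
  rw [← LinearMap.comp_apply, ← TensorProduct.map_comp]
  simp

/-- The decoration of a shape without vertices. -/
def emptyShape (s : S) (h : deg s = 0) : Decorated k V deg :=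
  decorate k V deg s h (TensorPower.algebraMap₀ 1)

theorem vecBraiding_emptyShape (s : S) (h : deg s = 0) (v : V) :
    vecBraiding deg σ (v ⊗ₜ emptyShape s h) = emptyShape s h ⊗ₜ v := by
  have := ((decorate_vecBraiding σ h).comp_right (crossVec_zero σ)).apply (v ⊗ₜ 1)
  simpa [emptyShape] using this.symm

theorem decBraiding_emptyShape (s : S) (h : deg s = 0) (x : Decorated k V deg) :
    decBraiding deg σ (emptyShape s h ⊗ₜ x) = x ⊗ₜ emptyShape s h := by
  induction x using decorated_induction with
  | zero => simp
  | add x y hx hy => simp only [TensorProduct.add_tmul, TensorProduct.tmul_add, map_add, hx, hy]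
  | dec t x =>
    have := ((decorate_decBraiding σ h rfl).comp (crossPow_zero σ (deg t))).apply (1 ⊗ₜ x)
    simpa [emptyShape] using this.symm

theorem deltaForm_decorate {s₀ : S} (h : deg s₀ = 0) {s : S} {n : ℕ} (hs : deg s = n)
    (hne : s ≠ s₀) (x : ⨂[k]^n V) : deltaForm deg s₀ h (decorate k V deg s hs x) = 0 := by
  subst hs
  rw [decorate_rfl, deltaForm, LinearMap.comp_apply, LinearMap.comp_apply, DirectSum.component.of,
    dif_neg hne, map_zero, map_zero]

theorem deltaForm_emptyShape {s₀ : S} (h : deg s₀ = 0) :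
    deltaForm (k := k) (V := V) deg s₀ h (emptyShape s₀ h) = 1 := by
  simp only [deltaForm, emptyShape, decorate, LinearMap.comp_apply, DirectSum.component.lof_self,
    LinearEquiv.coe_coe, TensorPower.cast_cast, TensorPower.cast_refl, LinearEquiv.refl_apply]
  simp [TensorPower.algebraMap₀]

/-- Truncation of the space of decorated shapes with respect to a function on shapes. -/
def truncate (k V : Type*) [Field k] [AddCommGroup V] [Module k V] (deg : S → ℕ) (ht : S → ℕ)
    (n : ℕ) : Decorated k V deg →ₗ[k] Decorated k V deg :=
  DirectSum.toModule k S _ fun s => if ht s ≤ n then decorate k V deg s rfl else 0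

theorem truncate_decorate {ht : S → ℕ} {n m : ℕ} {s : S} (h : deg s = m) (x : ⨂[k]^m V) :
    truncate k V deg ht n (decorate k V deg s h x) =
      if ht s ≤ n then decorate k V deg s h x else 0 := by
  subst h
  rw [truncate, toModule_decorate]
  split_ifs <;> rfl

theorem truncate_eventually (ht : S → ℕ) (x : Decorated k V deg) :
    ∃ n, ∀ i, n ≤ i → truncate k V deg ht i x = x := by
  induction x using decorated_induction with
  | zero => exact ⟨0, by simp⟩
  | add x y hx hy =>
    obtain ⟨m, hm⟩ := hx
    obtain ⟨n, hn⟩ := hy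
    exact ⟨max m n, fun i hi => by
      rw [map_add, hm i (le_trans (le_max_left _ _) hi), hn i (le_trans (le_max_right _ _) hi)]⟩
  | dec s x => exact ⟨ht s, fun i hi => by rw [truncate_decorate, if_pos hi]⟩

theorem truncate_zero (ht : S → ℕ) (h : ∀ s, 0 < ht s) : truncate k V deg ht 0 = 0 :=
  decorated_ext fun s x => by
    rw [truncate_decorate, if_neg (Nat.not_le.2 (h s)), LinearMap.zero_apply]

end Shapes

/-! ### Rooted forests -/

section ForestShapes

variable {k V : Type*} [Field k] [AddCommGroup V] [Module k V]

theorem Forest.deg_nil : Forest.nil.deg = 0 := rfl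

theorem rOne_eq : rOne k V = decorate k V Forest.deg .nil Forest.deg_nil
    (TensorPower.algebraMap₀ 1) := rfl

theorem rMul_decorate {F G : Forest} {m n : ℕ} (hF : F.deg = m) (hG : G.deg = n)
    (x : ⨂[k]^m V) (y : ⨂[k]^n V) :
    rMul k V (decorate k V Forest.deg F hF x ⊗ₜ decorate k V Forest.deg G hG y) =
      decorate k V Forest.deg (F.append G) (by rw [F.deg_append, hF, hG])
        (TensorPower.mulEquiv (x ⊗ₜ[k] y)) := by
  subst hF hG
  simp [rMul, toModule_decorate]

theorem bPlus_decorate {F : Forest} {n : ℕ} (hF : F.deg = n) (v : V) (x : ⨂[k]^n V) :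
    bPlus k V (v ⊗ₜ decorate k V Forest.deg F hF x) =
      decorate k V Forest.deg (.cons F .nil) (by rw [Forest.deg, hF]; rfl)
        (consEquiv k V n (v ⊗ₜ x)) := by
  subst hF
  simp only [bPlus, TensorProduct.lift.tmul, LinearMap.flip_apply, toModule_decorate]
  rfl

theorem rMul_comp_decorate (F G : Forest) :
    rMul k V ∘ₗ TensorProduct.map (decorate k V Forest.deg F rfl)
      (decorate k V Forest.deg G rfl) =
      decorate k V Forest.deg (F.append G) (F.deg_append G) ∘ₗ
        TensorPower.mulEquiv.toLinearMap :=
  TensorProduct.ext' fun x y => rMul_decorate rfl rfl x y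

theorem bPlus_comp_decorate (F : Forest) :
    bPlus k V ∘ₗ TensorProduct.map LinearMap.id (decorate k V Forest.deg F rfl) =
      decorate k V Forest.deg (.cons F .nil) rfl ∘ₗ (consEquiv k V F.deg).toLinearMap :=
  TensorProduct.ext' fun v x => bPlus_decorate rfl v x

variable (k V) in
/-- The operation `(v, F, G) ↦ B⁺_v(F) · G`. -/
def rCons : V ⊗[k] (RSpace k V ⊗[k] RSpace k V) →ₗ[k] RSpace k V :=
  rMul k V ∘ₗ TensorProduct.map (bPlus k V) LinearMap.id ∘ₗ
    (TensorProduct.assoc k V (RSpace k V) (RSpace k V)).symm.toLinearMap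

theorem rCons_tmul (v : V) (F G : RSpace k V) :
    rCons k V (v ⊗ₜ (F ⊗ₜ G)) = rMul k V (bPlus k V (v ⊗ₜ F) ⊗ₜ G) := by
  simp [rCons]

theorem rCons_decorate {F G : Forest} {m n : ℕ} (hF : F.deg = m) (hG : G.deg = n) (v : V)
    (x : ⨂[k]^m V) (y : ⨂[k]^n V) :
    rCons k V (v ⊗ₜ (decorate k V Forest.deg F hF x ⊗ₜ decorate k V Forest.deg G hG y)) =
      decorate k V Forest.deg (.cons F G) (by rw [Forest.deg, hF, hG])
        (TensorPower.mulEquiv (consEquiv k V m (v ⊗ₜ x) ⊗ₜ[k] y)) := by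
  rw [rCons_tmul, bPlus_decorate, rMul_decorate]
  rfl

theorem rOne_rMul (x : RSpace k V) : rMul k V (rOne k V ⊗ₜ x) = x := by
  induction x using decorated_induction with
  | zero => simp
  | add x y hx hy => simp only [TensorProduct.tmul_add, map_add, hx, hy]
  | dec G y =>
    refine (rMul_decorate (F := .nil) (m := 0) rfl rfl (TensorPower.algebraMap₀ 1) y).trans ?_
    rw [algebraMap₀_mulEquiv, decorate_cast, one_smul]
    rfl

theorem rCons_rMul (v : V) (F G x : RSpace k V) :
    rMul k V (rCons k V (v ⊗ₜ (F ⊗ₜ G)) ⊗ₜ x) = rCons k V (v ⊗ₜ (F ⊗ₜ rMul k V (G ⊗ₜ x))) := by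
  induction F using decorated_induction with
  | zero => simp
  | add a b ha hb => simp only [TensorProduct.add_tmul, TensorProduct.tmul_add, map_add, ha, hb]
  | dec F f =>
  induction G using decorated_induction with
  | zero => simp
  | add a b ha hb => simp only [TensorProduct.add_tmul, TensorProduct.tmul_add, map_add, ha, hb]
  | dec G g =>
  induction x using decorated_induction with
  | zero => simp
  | add a b ha hb => simp only [TensorProduct.tmul_add, map_add, ha, hb]
  | dec H x =>
    have h := TensorPower.mul_assoc (consEquiv k V _ (v ⊗ₜ f)) g x
    simp only [TensorPower.gMul_def] at h
    rw [rCons_decorate, rMul_decorate, rMul_decorate, rCons_decorate, ← h, decorate_cast]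
    rfl

variable (σ : V ⊗[k] V →ₗ[k] V ⊗[k] V)

theorem bPlus_vecBraiding : Intertwines (crossR σ (vecBraiding Forest.deg σ))
    (vecBraiding Forest.deg σ) LinearMap.id (bPlus k V) := by
  refine Intertwines.ext_right fun u v F => ?_
  induction F using decorated_induction with
  | zero => simp
  | add a b ha hb => simp only [TensorProduct.tmul_add, map_add, ha, hb]
  | dec F x =>
    refine Intertwines.apply_of_comp (d := LinearMap.id)
      (Intertwines.id.crossR (decorate_vecBraiding σ rfl)) ?_ u (v ⊗ₜ x)
    rw [bPlus_comp_decorate]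
    exact (decorate_vecBraiding σ rfl).comp_right (crossVec_cons σ _)

theorem bPlus_decBraiding : Intertwines (crossL (vecBraiding Forest.deg σ)
    (decBraiding Forest.deg σ)) (decBraiding Forest.deg σ) (bPlus k V) LinearMap.id := by
  refine Intertwines.ext_left fun v F y => ?_
  induction F using decorated_induction with
  | zero => simp
  | add a b ha hb => simp only [TensorProduct.tmul_add, TensorProduct.add_tmul, map_add, ha, hb]
  | dec F x =>
  induction y using decorated_induction with
  | zero => simp
  | add a b ha hb => simp only [TensorProduct.tmul_add, map_add, ha, hb]
  | dec G y =>
    refine Intertwines.apply_of_comp ((decorate_vecBraiding σ (rfl : G.deg = _)).crossL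
      (decorate_decBraiding σ (rfl : F.deg = _) (rfl : G.deg = _))) ?_ (v ⊗ₜ x) y
    rw [bPlus_comp_decorate, LinearMap.id_comp]
    exact (decorate_decBraiding σ rfl rfl).comp_of_left (crossPow_cons σ _ _)

theorem rMul_vecBraiding : Intertwines (crossR (vecBraiding Forest.deg σ)
    (vecBraiding Forest.deg σ)) (vecBraiding Forest.deg σ) LinearMap.id (rMul k V) := by
  refine Intertwines.ext_right fun u F G => ?_
  induction F using decorated_induction with
  | zero => simp
  | add a b ha hb => simp only [TensorProduct.add_tmul, TensorProduct.tmul_add, map_add, ha, hb]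
  | dec F x =>
  induction G using decorated_induction with
  | zero => simp
  | add a b ha hb => simp only [TensorProduct.tmul_add, map_add, ha, hb]
  | dec G y =>
    refine Intertwines.apply_of_comp (d := LinearMap.id)
      ((decorate_vecBraiding σ (rfl : F.deg = _)).crossR
        (decorate_vecBraiding σ (rfl : G.deg = _))) ?_ u (x ⊗ₜ y)
    rw [rMul_comp_decorate]
    exact (decorate_vecBraiding σ _).comp_right (crossVec_mul σ _ _)

theorem rMul_decBraiding : Intertwines (crossL (decBraiding Forest.deg σ)
    (decBraiding Forest.deg σ)) (decBraiding Forest.deg σ) (rMul k V) LinearMap.id := by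
  refine Intertwines.ext_left fun F G z => ?_
  induction F using decorated_induction with
  | zero => simp
  | add a b ha hb => simp only [TensorProduct.add_tmul, map_add, ha, hb]
  | dec F x =>
  induction G using decorated_induction with
  | zero => simp
  | add a b ha hb => simp only [TensorProduct.tmul_add, TensorProduct.add_tmul, map_add, ha, hb]
  | dec G y =>
  induction z using decorated_induction with
  | zero => simp
  | add a b ha hb => simp only [TensorProduct.tmul_add, map_add, ha, hb]
  | dec H z =>
    refine Intertwines.apply_of_comp
      ((decorate_decBraiding σ (rfl : F.deg = _) (rfl : H.deg = _)).crossL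
      (decorate_decBraiding σ (rfl : G.deg = _) (rfl : H.deg = _))) ?_ (x ⊗ₜ y) z
    rw [rMul_comp_decorate, LinearMap.id_comp]
    exact (decorate_decBraiding σ _ _).comp_of_left (crossPow_mul σ _ _ _)

theorem rCons_vecBraiding : Intertwines (crossR σ (crossR (vecBraiding Forest.deg σ)
    (vecBraiding Forest.deg σ))) (vecBraiding Forest.deg σ) LinearMap.id (rCons k V) :=
  (rMul_vecBraiding σ).comp_right (((bPlus_vecBraiding σ).crossR Intertwines.id).comp_right
    (Intertwines.assoc_right _ _ _).symm_right)

theorem rCons_decBraiding : Intertwines (crossL (vecBraiding Forest.deg σ)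
    (crossL (decBraiding Forest.deg σ) (decBraiding Forest.deg σ))) (decBraiding Forest.deg σ)
    (rCons k V) LinearMap.id :=
  (rMul_decBraiding σ).comp_left (((bPlus_decBraiding σ).crossL Intertwines.id).comp_left
    (Intertwines.assoc_left _ _ _).symm_left)

end ForestShapes

section ForestModel

variable {k V : Type*} [Field k] [AddCommGroup V] [Module k V]

theorem forestPower_induction {F G : Forest} {P : ⨂[k]^((Forest.cons F G).deg) V → Prop}
    (zero : P 0) (add : ∀ x y, P x → P y → P (x + y))
    (cons : ∀ v (x : ⨂[k]^F.deg V) (y : ⨂[k]^G.deg V),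
      P ((TensorPower.mulEquiv (consEquiv k V F.deg (v ⊗ₜ x) ⊗ₜ[k] y) :
        ⨂[k]^(F.deg + 1 + G.deg) V)))
    (x : ⨂[k]^((Forest.cons F G).deg) V) : P x := by
  obtain ⟨z, rfl⟩ := (TensorPower.mulEquiv :
    (⨂[k]^(F.deg + 1) V) ⊗[k] (⨂[k]^G.deg V) ≃ₗ[k] ⨂[k]^(F.deg + 1 + G.deg) V).surjective x
  induction z using TensorProduct.induction_on with
  | zero => rw [map_zero]; exact zero
  | add a b ha hb => rw [map_add]; exact add _ _ ha hb
  | tmul z y =>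
  obtain ⟨z, rfl⟩ := (consEquiv k V F.deg).surjective z
  induction z using TensorProduct.induction_on with
  | zero => rw [map_zero, TensorProduct.zero_tmul, map_zero]; exact zero
  | add a b ha hb => rw [map_add, TensorProduct.add_tmul, map_add]; exact add _ _ ha hb
  | tmul v x => exact cons v x y

theorem rCons_decorate_rfl (F G : Forest) (v : V) (x : ⨂[k]^F.deg V) (y : ⨂[k]^G.deg V) :
    decorate k V Forest.deg (.cons F G) rfl
        (TensorPower.mulEquiv (consEquiv k V F.deg (v ⊗ₜ x) ⊗ₜ[k] y) :
          ⨂[k]^(F.deg + 1 + G.deg) V) =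
      rCons k V (v ⊗ₜ (decorate k V Forest.deg F rfl x ⊗ₜ decorate k V Forest.deg G rfl y)) :=
  (rCons_decorate rfl rfl v x y).symm

theorem decorate_nil (r : k) :
    decorate k V Forest.deg .nil Forest.deg_nil (TensorPower.algebraMap₀ r) = r • rOne k V := by
  rw [rOne_eq, ← map_smul, ← map_smul, smul_eq_mul, mul_one]

theorem rCons_rOne (v : V) (F : RSpace k V) :
    rCons k V (v ⊗ₜ (F ⊗ₜ rOne k V)) = bPlus k V (v ⊗ₜ F) := by
  induction F using decorated_induction with
  | zero => simp
  | add a b ha hb => simp only [TensorProduct.add_tmul, TensorProduct.tmul_add, map_add, ha, hb]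
  | dec F x =>
    refine (rCons_decorate (G := .nil) (n := 0) rfl rfl v x (TensorPower.algebraMap₀ 1)).trans ?_
    rw [mulEquiv_algebraMap₀, one_smul, bPlus_decorate]

/-- The height of a forest. -/
def Forest.height : Forest → ℕ
  | nil => 1
  | cons F G => max F.height G.height + 1

theorem Forest.height_pos : ∀ F : Forest, 0 < F.height
  | nil => Nat.one_pos
  | cons _ _ => Nat.succ_pos _

theorem rCover : Cover (LinearMap.toSpanSingleton k _ (rOne k V)) (rCons k V)
    (truncate k V Forest.deg Forest.height) where
  surj m := by
    induction m using decorated_induction with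
    | zero => exact ⟨0, 0, by simp⟩
    | add a b ha hb =>
      obtain ⟨a₁, a₂, rfl⟩ := ha
      obtain ⟨b₁, b₂, rfl⟩ := hb
      exact ⟨a₁ + b₁, a₂ + b₂, by simp only [map_add]; abel⟩
    | dec F x =>
      cases F with
      | nil =>
        obtain ⟨r, rfl⟩ := (TensorPower.algebraMap₀ : k ≃ₗ[k] ⨂[k]^0 V).surjective x
        exact ⟨r, 0, by rw [map_zero, add_zero]; exact decorate_nil r⟩
      | cons F G =>
        refine ⟨0, ?_⟩
        induction x using forestPower_induction with
        | zero => exact ⟨0, by simp⟩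
        | add a b ha hb =>
          obtain ⟨a', ha⟩ := ha
          obtain ⟨b', hb⟩ := hb
          exact ⟨a' + b', by rw [map_add, ha, hb]; simp⟩
        | cons v x y =>
          exact ⟨_, by rw [map_zero, zero_add]; exact rCons_decorate_rfl F G v x y⟩
  zero := truncate_zero _ Forest.height_pos
  eventually := truncate_eventually _

theorem truncate_rOne (n : ℕ) :
    truncate k V Forest.deg Forest.height (n + 1) (rOne k V) = rOne k V := by
  rw [rOne_eq, truncate_decorate, if_pos
    (show Forest.nil.height ≤ n + 1 from Nat.succ_le_succ n.zero_le)]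

theorem truncate_comp_rCons (n : ℕ) :
    truncate k V Forest.deg Forest.height (n + 1) ∘ₗ rCons k V =
      rCons k V ∘ₗ TensorProduct.map LinearMap.id
        (TensorProduct.map (truncate k V Forest.deg Forest.height n)
          (truncate k V Forest.deg Forest.height n)) := by
  refine tensor_ext_right fun v F G => ?_
  induction F using decorated_induction with
  | zero => simp
  | add a b ha hb => simp only [TensorProduct.add_tmul, TensorProduct.tmul_add, map_add, ha, hb]
  | dec F x =>
  induction G using decorated_induction with
  | zero => simp
  | add a b ha hb => simp only [TensorProduct.tmul_add, map_add, ha, hb]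
  | dec G y =>
    simp only [LinearMap.comp_apply, TensorProduct.map_tmul, LinearMap.id_apply,
      truncate_decorate, rCons_decorate]
    have h : (Forest.cons F G).height ≤ n + 1 ↔ F.height ≤ n ∧ G.height ≤ n := by
      rw [Forest.height, Nat.succ_le_succ_iff, max_le_iff]
    by_cases hF : F.height ≤ n
    · by_cases hG : G.height ≤ n
      · rw [if_pos (h.2 ⟨hF, hG⟩), if_pos hF, if_pos hG, rCons_decorate]
      · rw [if_neg fun h' => hG (h.1 h').2, if_neg hG, TensorProduct.tmul_zero,
          TensorProduct.tmul_zero, map_zero]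
    · rw [if_neg fun h' => hF (h.1 h').1, if_neg hF, TensorProduct.zero_tmul,
        TensorProduct.tmul_zero, map_zero]

variable (σ : V ⊗[k] V →ₗ[k] V ⊗[k] V)

/-- `(μ ⊗ μ) σ₂` on `ℛ(V) ⊗ ℛ(V)`. -/
def rMul₂ : (RSpace k V ⊗[k] RSpace k V) ⊗[k] (RSpace k V ⊗[k] RSpace k V) →ₗ[k]
    RSpace k V ⊗[k] RSpace k V :=
  TensorProduct.map (rMul k V) (rMul k V) ∘ₗ onMiddle _ _ (decBraiding Forest.deg σ)

/-- The coproduct of trees `B⁺_v(F)`, in terms of the coproduct `φ` of `F`. -/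
def graftComul (F : Forest) (φ : ⨂[k]^F.deg V →ₗ[k] RSpace k V ⊗[k] RSpace k V) :
    ⨂[k]^(F.deg + 1) V →ₗ[k] RSpace k V ⊗[k] RSpace k V :=
  appendElt _ (rOne k V) ∘ₗ decorate (n := F.deg + 1) k V Forest.deg (.cons F .nil) rfl +
    (bPlus k V).lTensor (RSpace k V) ∘ₗ onFirst _ (vecBraiding Forest.deg σ) ∘ₗ φ.lTensor V ∘ₗ
      (consEquiv k V F.deg).symm.toLinearMap

/-- The coproduct of forests, recursively. -/
def recComul : (F : Forest) → ⨂[k]^F.deg V →ₗ[k] RSpace k V ⊗[k] RSpace k V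
  | .nil => LinearMap.toSpanSingleton k _ (rOne k V ⊗ₜ rOne k V) ∘ₗ
      (TensorPower.algebraMap₀.symm : ⨂[k]^0 V ≃ₗ[k] k).toLinearMap
  | .cons F G => rMul₂ σ ∘ₗ TensorProduct.map (graftComul σ F (recComul F)) (recComul G) ∘ₗ
      (TensorPower.mulEquiv.symm : ⨂[k]^(F.deg + 1 + G.deg) V ≃ₗ[k] _).toLinearMap

/-- The Hopf algebra `ℛ(V)`, with the recursive coproduct. -/
def recHopf : BraidedData k (RSpace k V) :=
  { rHopf σ with comul := DirectSum.toModule k Forest _ fun F => recComul σ F }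

theorem recComul_nil :
    recComul σ .nil (TensorPower.algebraMap₀ 1 : ⨂[k]^0 V) = rOne k V ⊗ₜ rOne k V :=
  (congrArg (LinearMap.toSpanSingleton k _ (rOne k V ⊗ₜ[k] rOne k V))
    (LinearEquiv.symm_apply_apply TensorPower.algebraMap₀ (1 : k))).trans (one_smul _ _)

theorem recComul_cons (F G : Forest) (z : (⨂[k]^(F.deg + 1) V) ⊗[k] (⨂[k]^G.deg V)) :
    recComul σ (.cons F G) (TensorPower.mulEquiv z : ⨂[k]^(F.deg + 1 + G.deg) V) =
      rMul₂ σ (TensorProduct.map (graftComul σ F (recComul σ F)) (recComul σ G) z) :=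
  congrArg (fun z => rMul₂ σ (TensorProduct.map (graftComul σ F (recComul σ F)) (recComul σ G) z))
    (LinearEquiv.symm_apply_apply _ z)

theorem graftComul_consEquiv (F : Forest) (v : V) (x : ⨂[k]^F.deg V)
    (φ : ⨂[k]^F.deg V →ₗ[k] RSpace k V ⊗[k] RSpace k V) :
    graftComul σ F φ (consEquiv k V F.deg (v ⊗ₜ x)) =
      bPlus k V (v ⊗ₜ decorate k V Forest.deg F rfl x) ⊗ₜ rOne k V +
        (bPlus k V).lTensor (RSpace k V) (onFirst _ (vecBraiding Forest.deg σ) (v ⊗ₜ φ x)) := by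
  rw [bPlus_decorate]
  simp [graftComul]

theorem rCons_comp_append :
    rCons k V ∘ₗ (appendElt (RSpace k V) (rOne k V)).lTensor V = bPlus k V :=
  TensorProduct.ext' fun v F => by
    rw [LinearMap.comp_apply, LinearMap.lTensor_tmul, appendElt_apply, rCons_rOne]

theorem recHopf_comul_rCons (v : V) (F G : RSpace k V) :
    (recHopf σ).comul (rCons k V (v ⊗ₜ (F ⊗ₜ G))) =
      rMul₂ σ ((bPlus k V (v ⊗ₜ F) ⊗ₜ rOne k V + (bPlus k V).lTensor (RSpace k V)
        (onFirst _ (vecBraiding Forest.deg σ) (v ⊗ₜ (recHopf σ).comul F))) ⊗ₜ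
          (recHopf σ).comul G) := by
  induction F using decorated_induction with
  | zero => simp
  | add a b ha hb =>
    simp only [TensorProduct.add_tmul, TensorProduct.tmul_add, map_add, ha, hb]; abel
  | dec F x =>
  induction G using decorated_induction with
  | zero => simp
  | add a b ha hb => simp only [TensorProduct.tmul_add, map_add, ha, hb]
  | dec G y =>
    have h : ∀ F (x : ⨂[k]^F.deg V),
        (recHopf σ).comul (decorate k V Forest.deg F rfl x) = recComul σ F x :=
      fun F x => toModule_decorate _ F x
    rw [← rCons_decorate_rfl, h F, h G, ← graftComul_consEquiv]
    exact (h (.cons F G) _).trans (recComul_cons σ F G _)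

theorem recHopf_comul_rOne : (recHopf σ).comul (rOne k V) = rOne k V ⊗ₜ rOne k V :=
  (toModule_decorate _ Forest.nil _).trans (recComul_nil σ)

theorem deltaForm_rCons (z : V ⊗[k] (RSpace k V ⊗[k] RSpace k V)) :
    deltaForm Forest.deg .nil Forest.deg_nil (rCons k V z) = 0 := by
  induction z using TensorProduct.induction_on with
  | zero => simp
  | add a b ha hb => rw [map_add, map_add, ha, hb, add_zero]
  | tmul v z =>
  induction z using TensorProduct.induction_on with
  | zero => simp
  | add a b ha hb => rw [TensorProduct.tmul_add, map_add, map_add, ha, hb, add_zero]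
  | tmul F G =>
  induction F using decorated_induction with
  | zero => simp
  | add a b ha hb =>
    rw [TensorProduct.add_tmul, TensorProduct.tmul_add, map_add, map_add, ha, hb, add_zero]
  | dec F x =>
  induction G using decorated_induction with
  | zero => simp
  | add a b ha hb =>
    rw [TensorProduct.tmul_add, TensorProduct.tmul_add, map_add, map_add, ha, hb, add_zero]
  | dec G y =>
    rw [rCons_decorate]
    exact deltaForm_decorate Forest.deg_nil _ (by simp) _

/-- `ℛ(V)` is generated by the empty forest and the operation `(v, F, G) ↦ B⁺_v(F) · G`. -/
def rModel (hσ : IsBraiding σ) : ForestModel (RSpace k V) σ where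
  D := recHopf σ
  τ := vecBraiding Forest.deg σ
  cons := rCons k V
  p := truncate k V Forest.deg Forest.height
  cover := rCover
  p_one := truncate_rOne
  p_cons := truncate_comp_rCons
  braid := hσ
  τ_one := vecBraiding_emptyShape σ Forest.nil Forest.deg_nil
  τ_cons := rCons_vecBraiding σ
  braiding_one := decBraiding_emptyShape σ Forest.nil Forest.deg_nil
  braiding_cons := rCons_decBraiding σ
  one_mul := rOne_rMul
  cons_mul := rCons_rMul
  comul_one := recHopf_comul_rOne σ
  comul_cons v F G := by
    refine (recHopf_comul_rCons σ v F G).trans ?_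
    rw [← rCons_comp_append, LinearMap.comp_apply, LinearMap.lTensor_tmul, appendElt_apply]
    rfl
  counit_one := deltaForm_emptyShape Forest.deg_nil
  counit_cons := deltaForm_rCons

end ForestModel

/-! ### Unshuffles and the braided product of `R ⊗ R` -/

theorem unshuffle_algebraMap₀ {k V : Type*} [Field k] [AddCommGroup V] [Module k V]
    (σ : V ⊗[k] V →ₗ[k] V ⊗[k] V) (w : Equiv.Perm (Fin 0)) (h : 0 = 0 + 0) (r : k) :
    unshuffle σ w h (TensorPower.algebraMap₀ r) =
      TensorPower.algebraMap₀ r ⊗ₜ TensorPower.algebraMap₀ 1 := by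
  simp only [unshuffle, LinearMap.comp_apply, LinearEquiv.coe_coe]
  rw [LinearEquiv.symm_apply_eq, mulEquiv_algebraMap₀, one_smul, TensorPower.cast_refl]
  rfl

namespace ForestModel

variable {k V R : Type*} [Field k] [AddCommGroup V] [Module k V]
    [AddCommGroup R] [Module k R] {σ : V ⊗[k] V →ₗ[k] V ⊗[k] V} (M : ForestModel R σ)

/-- `(v, F) ↦ B⁺_v(1) · F`. -/
def addDot : V ⊗[k] R →ₗ[k] R := M.cons ∘ₗ TensorProduct.map LinearMap.id (prependElt R M.D.one)

theorem addDot_tmul (v : V) (F : R) : M.addDot (v ⊗ₜ F) = M.cons (v ⊗ₜ (M.D.one ⊗ₜ F)) := by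
  simp [addDot]

theorem addDot_V : Intertwines (crossR σ M.τ) M.τ LinearMap.id M.addDot :=
  M.τ_cons.comp_right (Intertwines.id.crossR M.unit_V.prepend_right)

theorem addDot_R : Intertwines (crossL M.τ M.D.braiding) M.D.braiding M.addDot LinearMap.id :=
  M.braiding_cons.comp_left (Intertwines.id.crossL M.unit_R.prepend_left)

/-- `v₁ ⊗ ⋯ ⊗ vₙ`, as a forest of trees with one vertex. -/
def dots : (n : ℕ) → ⨂[k]^n V →ₗ[k] R
  | 0 => M.unit ∘ₗ (TensorPower.algebraMap₀.symm : ⨂[k]^0 V ≃ₗ[k] k).toLinearMap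
  | n + 1 => M.addDot ∘ₗ TensorProduct.map LinearMap.id (dots n) ∘ₗ
      (consEquiv k V n).symm.toLinearMap

theorem dots_algebraMap₀ (r : k) : M.dots 0 (TensorPower.algebraMap₀ r) = r • M.D.one := by
  simp [dots]

theorem dots_consEquiv (n : ℕ) (v : V) (x : ⨂[k]^n V) :
    M.dots (n + 1) (consEquiv k V n (v ⊗ₜ x)) = M.addDot (v ⊗ₜ M.dots n x) := by
  simp [dots]

theorem dots_cast {m n : ℕ} (h : m = n) (x : ⨂[k]^m V) :
    M.dots n (TensorPower.cast k V h x) = M.dots m x := by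
  subst h; simp

theorem dots_V (n : ℕ) : Intertwines (crossVec σ n) M.τ LinearMap.id (M.dots n) := by
  induction n with
  | zero => exact M.unit_V.comp_right (crossVec_zero σ).symm_right
  | succ n ih =>
    exact M.addDot_V.comp_right ((Intertwines.id.crossR ih).comp_right
      (crossVec_cons σ n).symm_right)

theorem dots_R (m n : ℕ) :
    Intertwines (crossPow σ m n) M.D.braiding (M.dots m) (M.dots n) := by
  induction m with
  | zero =>
    refine TensorProduct.ext' fun x y => ?_
    obtain ⟨r, rfl⟩ := (TensorPower.algebraMap₀ : k ≃ₗ[k] ⨂[k]^0 V).surjective x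
    simp [crossPow, dots_algebraMap₀, ← TensorProduct.smul_tmul', M.braiding_one]
  | succ m ih =>
    exact M.addDot_R.comp_left (((M.dots_V n).crossL ih).comp_of_left
      (crossPow_cons σ m n).symm_left)

theorem dots_mulEquiv (m n : ℕ) (x : ⨂[k]^m V) (y : ⨂[k]^n V) :
    M.dots (m + n) (TensorPower.mulEquiv (x ⊗ₜ[k] y)) = M.D.mul (M.dots m x ⊗ₜ M.dots n y) := by
  induction m with
  | zero =>
    obtain ⟨r, rfl⟩ := (TensorPower.algebraMap₀ : k ≃ₗ[k] ⨂[k]^0 V).surjective x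
    rw [algebraMap₀_mulEquiv, dots_cast, dots_algebraMap₀, map_smul, ← TensorProduct.smul_tmul',
      map_smul, M.one_mul]
  | succ m ih =>
    obtain ⟨z, rfl⟩ := (consEquiv k V m).surjective x
    induction z using TensorProduct.induction_on with
    | zero => simp
    | add a b ha hb => simp only [map_add, TensorProduct.add_tmul, ha, hb]
    | tmul v x =>
      rw [consEquiv_mul, dots_cast, dots_consEquiv, dots_consEquiv, ih, addDot_tmul, addDot_tmul,
        M.cons_mul]

/-- `(v, F, G) ↦ F' ⊗ g(v', G)`, with `v` crossing `F`. -/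
def crossFirst (g : V ⊗[k] R →ₗ[k] R) : V ⊗[k] (R ⊗[k] R) →ₗ[k] R ⊗[k] R :=
  g.lTensor R ∘ₗ onFirst R M.τ

/-- `v₁ ⊗ ⋯ ⊗ vₙ`, as the product of the elements `v_i ⊗ 1` for `f i = true` and `1 ⊗ v_i` for
`f i = false`. -/
def maskProd : (n : ℕ) → (Fin n → Bool) → ⨂[k]^n V →ₗ[k] R ⊗[k] R
  | 0, _ => LinearMap.toSpanSingleton k _ (M.D.one ⊗ₜ M.D.one) ∘ₗ
      (TensorPower.algebraMap₀.symm : ⨂[k]^0 V ≃ₗ[k] k).toLinearMap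
  | n + 1, f => (if f 0 then M.addDot.rTensor R ∘ₗ (TensorProduct.assoc k V R R).symm.toLinearMap
      else M.crossFirst M.addDot) ∘ₗ TensorProduct.map LinearMap.id (maskProd n (Fin.tail f)) ∘ₗ
      (consEquiv k V n).symm.toLinearMap

theorem maskProd_algebraMap₀ (f : Fin 0 → Bool) (r : k) :
    M.maskProd 0 f (TensorPower.algebraMap₀ r) = r • (M.D.one ⊗ₜ M.D.one) := by
  simp [maskProd]

theorem maskProd_of_true {n : ℕ} {f : Fin (n + 1) → Bool} (h : f 0 = true) (v : V)
    (x : ⨂[k]^n V) : M.maskProd (n + 1) f (consEquiv k V n (v ⊗ₜ x)) =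
      M.addDot.rTensor R ((TensorProduct.assoc k V R R).symm
        (v ⊗ₜ M.maskProd n (Fin.tail f) x)) := by
  simp [maskProd, h]

theorem maskProd_of_false {n : ℕ} {f : Fin (n + 1) → Bool} (h : f 0 = false) (v : V)
    (x : ⨂[k]^n V) : M.maskProd (n + 1) f (consEquiv k V n (v ⊗ₜ x)) =
      M.crossFirst M.addDot (v ⊗ₜ M.maskProd n (Fin.tail f) x) := by
  simp [maskProd, h]

theorem maskProd_cast {m n : ℕ} (h : m = n) (f : Fin n → Bool) (x : ⨂[k]^m V) :
    M.maskProd n f (TensorPower.cast k V h x) = M.maskProd m (f ∘ Fin.cast h) x := by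
  subst h; simp

theorem addDot_mul (v : V) (F G : R) :
    M.D.mul (M.addDot (v ⊗ₜ F) ⊗ₜ G) = M.addDot (v ⊗ₜ M.D.mul (F ⊗ₜ G)) := by
  rw [addDot_tmul, addDot_tmul, M.cons_mul]

theorem addDot_rTensor_mul₂ (v : V) (X Y : R ⊗[k] R) :
    M.addDot.rTensor R ((TensorProduct.assoc k V R R).symm (v ⊗ₜ M.D.mul₂ (X ⊗ₜ Y))) =
      M.D.mul₂ (M.addDot.rTensor R ((TensorProduct.assoc k V R R).symm (v ⊗ₜ X)) ⊗ₜ Y) := by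
  induction X using TensorProduct.induction_on with
  | zero => simp
  | add a b ha hb => simp only [map_add, TensorProduct.add_tmul, TensorProduct.tmul_add, ha, hb]
  | tmul a b =>
  induction Y using TensorProduct.induction_on with
  | zero => simp
  | add a b ha hb => simp only [map_add, TensorProduct.tmul_add, ha, hb]
  | tmul c d =>
    rw [TensorProduct.assoc_symm_tmul, LinearMap.rTensor_tmul, M.mul₂_tmul, M.mul₂_tmul]
    induction M.D.braiding (b ⊗ₜ c) using TensorProduct.induction_on with
    | zero => simp
    | add a b ha hb => simp only [map_add, TensorProduct.tmul_add, ha, hb]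
    | tmul c b =>
      rw [sandwich_tmul, sandwich_tmul, addDot_mul, TensorProduct.assoc_symm_tmul,
        LinearMap.rTensor_tmul]

theorem crossFirst_addDot (v : V) (X : R ⊗[k] R) : M.crossFirst M.addDot (v ⊗ₜ X) =
    M.D.mul₂ ((M.D.one ⊗ₜ M.graft (v ⊗ₜ M.D.one)) ⊗ₜ X) := by
  induction X using TensorProduct.induction_on with
  | zero => simp
  | add a b ha hb => simp only [map_add, TensorProduct.tmul_add, ha, hb]
  | tmul a b =>
    have hR := M.graft_R.apply ((v ⊗ₜ M.D.one) ⊗ₜ a)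
    rw [TensorProduct.map_tmul, LinearMap.id_apply, crossL_tmul, M.braiding_one,
      crossLSnd_tmul] at hR
    rw [M.mul₂_tmul, ← hR, crossFirst, LinearMap.comp_apply, onFirst_tmul]
    induction M.τ (v ⊗ₜ a) using TensorProduct.induction_on with
    | zero => simp
    | add a b ha hb => simp only [map_add, TensorProduct.add_tmul, ha, hb]
    | tmul a v =>
      simp [M.one_mul, M.graft_mul, addDot_tmul]

theorem maskProd_append {m n : ℕ} (f : Fin m → Bool) (g : Fin n → Bool) (x : ⨂[k]^m V)
    (y : ⨂[k]^n V) : M.maskProd (m + n) (Fin.append f g) (TensorPower.mulEquiv (x ⊗ₜ[k] y)) =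
      M.D.mul₂ (M.maskProd m f x ⊗ₜ M.maskProd n g y) := by
  induction m with
  | zero =>
    obtain ⟨r, rfl⟩ := (TensorPower.algebraMap₀ : k ≃ₗ[k] ⨂[k]^0 V).surjective x
    rw [algebraMap₀_mulEquiv, maskProd_cast, maskProd_algebraMap₀, map_smul,
      ← TensorProduct.smul_tmul', map_smul, M.one_mul₂]
    congr 3
    funext i
    have : Fin.cast (Nat.zero_add n).symm i = Fin.natAdd 0 i := Fin.ext (by simp)
    rw [Function.comp_apply, this, Fin.append_right]
  | succ m ih =>
    obtain ⟨z, rfl⟩ := (consEquiv k V m).surjective x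
    induction z using TensorProduct.induction_on with
    | zero => simp
    | add a b ha hb => simp only [map_add, TensorProduct.add_tmul, ha, hb]
    | tmul v x =>
      have h0 : (Fin.append f g ∘ Fin.cast (Nat.add_right_comm m n 1)) 0 = f 0 :=
        Fin.append_left f g 0
      have ht : Fin.tail (Fin.append f g ∘ Fin.cast (Nat.add_right_comm m n 1)) =
          Fin.append (Fin.tail f) g := by
        funext i
        refine Fin.addCases (fun j => ?_) (fun j => ?_) i
        · rw [Fin.append_left]
          exact Fin.append_left f g j.succ
        · have : Fin.cast (Nat.add_right_comm m n 1) (Fin.natAdd m j).succ =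
            Fin.natAdd (m + 1) j := Fin.ext (by simp; omega)
          rw [Fin.append_right, Fin.tail, Function.comp_apply, this, Fin.append_right]
      rw [consEquiv_mul, maskProd_cast]
      cases hf : f 0
      · rw [M.maskProd_of_false (h0.trans hf), M.maskProd_of_false hf, ht, ih,
          crossFirst_addDot, crossFirst_addDot, M.mul₂_assoc]
      · rw [M.maskProd_of_true (h0.trans hf), M.maskProd_of_true hf, ht, ih,
          addDot_rTensor_mul₂]

theorem maskProd_true (n : ℕ) (x : ⨂[k]^n V) :
    M.maskProd n (fun _ => true) x = M.dots n x ⊗ₜ M.D.one := by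
  induction n with
  | zero =>
    obtain ⟨r, rfl⟩ := (TensorPower.algebraMap₀ : k ≃ₗ[k] ⨂[k]^0 V).surjective x
    rw [maskProd_algebraMap₀, dots_algebraMap₀, TensorProduct.smul_tmul']
  | succ n ih =>
    obtain ⟨z, rfl⟩ := (consEquiv k V n).surjective x
    induction z using TensorProduct.induction_on with
    | zero => simp
    | add a b ha hb => simp only [map_add, TensorProduct.add_tmul, ha, hb]
    | tmul v x =>
      rw [M.maskProd_of_true rfl, Fin.tail_def, ih, dots_consEquiv, TensorProduct.assoc_symm_tmul,
        LinearMap.rTensor_tmul]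

theorem map_crossFirst {p q : ℕ} (v : V)
    (z : (⨂[k]^p V) ⊗[k] (⨂[k]^q V)) {a : ⨂[k]^p V →ₗ[k] R} {b : ⨂[k]^q V →ₗ[k] R}
    {b' : ⨂[k]^(q + 1) V →ₗ[k] R} {g : V ⊗[k] R →ₗ[k] R}
    (ha : Intertwines (crossVec σ p) M.τ LinearMap.id a)
    (hb : ∀ v y, b' (consEquiv k V q (v ⊗ₜ y)) = g (v ⊗ₜ b y)) :
    TensorProduct.map a b' ((consEquiv k V q).toLinearMap.lTensor _
      (onFirst _ (crossVec σ p) (v ⊗ₜ z))) = M.crossFirst g (v ⊗ₜ TensorProduct.map a b z) := by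
  induction z using TensorProduct.induction_on with
  | zero => simp
  | add a b ha hb => simp only [map_add, TensorProduct.tmul_add, ha, hb]
  | tmul x y =>
    have h := ha.apply (v ⊗ₜ x)
    rw [TensorProduct.map_tmul, LinearMap.id_apply] at h
    rw [crossFirst, LinearMap.comp_apply, TensorProduct.map_tmul, onFirst_tmul, onFirst_tmul, ← h]
    induction crossVec σ p (v ⊗ₜ x) using TensorProduct.induction_on with
    | zero => simp
    | add a b ha hb => simp only [map_add, TensorProduct.add_tmul, ha, hb]
    | tmul x v => simp [hb]

theorem maskProd_eq_unshuffle {n p q : ℕ} (w : Equiv.Perm (Fin n)) {f : Fin n → Bool}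
    (hw : IsUnshuffle w f) (h : n = p + q)
    (hp : (Finset.univ.filter fun j => f j = true).card = p) (x : ⨂[k]^n V) :
    TensorProduct.map (M.dots p) (M.dots q) (unshuffle σ w h x) = M.maskProd n f x := by
  induction n generalizing p q with
  | zero =>
    obtain rfl : p = 0 := by omega
    obtain rfl : q = 0 := by omega
    obtain ⟨r, rfl⟩ := (TensorPower.algebraMap₀ : k ≃ₗ[k] ⨂[k]^0 V).surjective x
    rw [unshuffle_algebraMap₀, TensorProduct.map_tmul, dots_algebraMap₀, dots_algebraMap₀,
      maskProd_algebraMap₀,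
      one_smul, TensorProduct.smul_tmul']
  | succ n ih =>
    obtain ⟨z, rfl⟩ := (consEquiv k V n).surjective x
    induction z using TensorProduct.induction_on with
    | zero => simp
    | add a b ha hb => simp only [map_add, ha, hb]
    | tmul v x =>
      have hcard : (Finset.univ.filter fun j => f j = true).card =
          (if f 0 = true then 1 else 0) +
            (Finset.univ.filter fun j => Fin.tail f j = true).card := by
        rw [Finset.card_filter, Finset.card_filter, Fin.sum_univ_succ]
        rfl
      have hle : (Finset.univ.filter fun j => Fin.tail f j = true).card ≤ n :=
        (Finset.card_le_univ _).trans (by simp)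
      cases hf : f 0
      · rw [hp, hf] at hcard
        have hq : q = (q - 1) + 1 := by simp at hcard; omega
        generalize q - 1 = q' at hq
        subst hq
        have hw0 : (w 0 : ℕ) = p := (hw.apply_zero_of_false hf).trans hp
        have h' : n = p + q' := by omega
        rw [M.maskProd_of_false hf, unshuffle_consEquiv_of_eq σ w h' h hw0,
          M.map_crossFirst v _ (M.dots_V p) (b := M.dots q') (M.dots_consEquiv q'),
          ih _ hw.tail h' (by simpa using hcard.symm)]
      · rw [hp, hf] at hcard
        have hp' : p = (p - 1) + 1 := by simp at hcard; omega
        have hcard' : (Finset.univ.filter fun j => Fin.tail f j = true).card = p - 1 := by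
          simp at hcard; omega
        clear hcard hp
        generalize p - 1 = p' at hp' hcard'
        subst hp'
        have h' : n = p' + q := by omega
        rw [M.maskProd_of_true hf, unshuffle_consEquiv_of_zero σ w h' h
          (hw.apply_zero_of_true hf), ← ih _ hw.tail h' hcard']
        induction unshuffle σ (deleteZero w) h' x using TensorProduct.induction_on with
        | zero => simp
        | add a b ha hb => simp only [map_add, TensorProduct.tmul_add, ha, hb]
        | tmul a b => simp [dots_consEquiv]

end ForestModel

theorem map_onMiddle {k A B C D A' B' C' D' : Type*} [CommRing k] [AddCommGroup A] [Module k A]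
    [AddCommGroup B] [Module k B] [AddCommGroup C] [Module k C] [AddCommGroup D] [Module k D]
    [AddCommGroup A'] [Module k A'] [AddCommGroup B'] [Module k B'] [AddCommGroup C'] [Module k C']
    [AddCommGroup D'] [Module k D'] {x : B ⊗[k] C →ₗ[k] C ⊗[k] B}
    {x' : B' ⊗[k] C' →ₗ[k] C' ⊗[k] B'} {a : A →ₗ[k] A'} {b : B →ₗ[k] B'} {c : C →ₗ[k] C'}
    {d : D →ₗ[k] D'} (h : Intertwines x x' b c) (X : A ⊗[k] B) (Y : C ⊗[k] D) :
    TensorProduct.map (TensorProduct.map a c) (TensorProduct.map b d) (onMiddle A D x (X ⊗ₜ Y)) =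
      onMiddle A' D' x' (TensorProduct.map a b X ⊗ₜ TensorProduct.map c d Y) := by
  induction X using TensorProduct.induction_on with
  | zero => simp
  | add p q hp hq => simp only [map_add, TensorProduct.add_tmul, hp, hq]
  | tmul p q =>
  induction Y using TensorProduct.induction_on with
  | zero => simp
  | add p q hp hq => simp only [map_add, TensorProduct.tmul_add, hp, hq]
  | tmul r s =>
    have hx := h.apply (q ⊗ₜ r)
    rw [TensorProduct.map_tmul] at hx
    rw [TensorProduct.map_tmul, TensorProduct.map_tmul, onMiddle_tmul, onMiddle_tmul, ← hx]
    induction x (q ⊗ₜ r) using TensorProduct.induction_on with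
    | zero => simp
    | add p q hp hq => simp only [map_add, hp, hq]
    | tmul r q => simp

theorem map_rTensor_apply {k A B C A' B' : Type*} [CommRing k] [AddCommGroup A] [Module k A]
    [AddCommGroup B] [Module k B] [AddCommGroup C] [Module k C] [AddCommGroup A'] [Module k A']
    [AddCommGroup B'] [Module k B'] (f : C →ₗ[k] A') (g : B →ₗ[k] B') (e : A →ₗ[k] C)
    (z : A ⊗[k] B) :
    TensorProduct.map f g (e.rTensor B z) = TensorProduct.map (f ∘ₗ e) g z :=
  LinearMap.congr_fun (LinearMap.map_comp_rTensor _ _ _ _) z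

theorem tensorPower_zero_ext {k V P : Type*} [CommRing k] [AddCommGroup V] [Module k V]
    [AddCommGroup P] [Module k P] {f g : ⨂[k]^0 V →ₗ[k] P}
    (h : f (TensorPower.algebraMap₀ 1) = g (TensorPower.algebraMap₀ 1)) : f = g := by
  refine LinearMap.ext fun x => ?_
  obtain ⟨r, rfl⟩ := (TensorPower.algebraMap₀ : k ≃ₗ[k] ⨂[k]^0 V).surjective x
  rw [← mul_one r, ← smul_eq_mul, map_smul, map_smul, map_smul, h]

section ForestSum

variable {k V : Type*} [Field k] [AddCommGroup V] [Module k V]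
  {σ : V ⊗[k] V →ₗ[k] V ⊗[k] V} (hσ : IsBraiding σ)

/-- The forest that consists of `n` trees with one vertex. -/
def Forest.discrete : ℕ → Forest
  | 0 => nil
  | n + 1 => cons nil (discrete n)

theorem Forest.deg_discrete : ∀ n, (discrete n).deg = n
  | 0 => rfl
  | n + 1 => by rw [discrete, deg, deg_discrete n, deg_nil]; omega

theorem dots_eq_decorate (n : ℕ) : (rModel σ hσ).dots n =
    decorate k V Forest.deg (Forest.discrete n) (Forest.deg_discrete n) := by
  refine LinearMap.ext fun x => ?_
  induction n with
  | zero =>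
    obtain ⟨r, rfl⟩ := (TensorPower.algebraMap₀ : k ≃ₗ[k] ⨂[k]^0 V).surjective x
    rw [ForestModel.dots_algebraMap₀]
    exact (decorate_nil r).symm
  | succ n ih =>
    obtain ⟨z, rfl⟩ := (consEquiv k V n).surjective x
    induction z using TensorProduct.induction_on with
    | zero => simp
    | add a b ha hb => simp only [map_add, ha, hb]
    | tmul v x =>
      rw [ForestModel.dots_consEquiv, ih, ForestModel.addDot_tmul]
      refine (rCons_decorate (F := .nil) (m := 0) Forest.deg_nil (Forest.deg_discrete n) v
        (TensorPower.algebraMap₀ 1) x).trans ?_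
      rw [consEquiv_mul, decorate_cast, algebraMap₀_mulEquiv, consEquiv_cast, decorate_cast,
        one_smul]
      rfl

theorem map_dots_injective (p q : ℕ) : Function.Injective
    (TensorProduct.map ((rModel σ hσ).dots p) ((rModel σ hσ).dots q)) := by
  have h : ∀ n, Function.Injective ((rModel σ hσ).dots n) := by
    intro n
    rw [dots_eq_decorate, decorate, LinearMap.coe_comp]
    exact (DirectSum.of_injective _).comp (LinearEquiv.injective _)
  exact TensorProduct.map_injective_of_flat_flat _ _ (h p) (h q)

/-- The summand of the coproduct of a forest that belongs to a subforest. -/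
def subTerm (σ : V ⊗[k] V →ₗ[k] V ⊗[k] V) {F : Forest} (c : F.Sub) :
    ⨂[k]^F.deg V →ₗ[k] RSpace k V ⊗[k] RSpace k V :=
  TensorProduct.map (decorate k V Forest.deg c.part rfl) (decorate k V Forest.deg c.rest rfl) ∘ₗ
    unshuffle σ c.perm⁻¹ c.part_add_rest.symm

theorem map_dots_unshuffle {F : Forest} (c : F.Sub) (x : ⨂[k]^F.deg V) :
    TensorProduct.map ((rModel σ hσ).dots c.part.deg) ((rModel σ hσ).dots c.rest.deg)
      (unshuffle σ c.perm⁻¹ c.part_add_rest.symm x) = (rModel σ hσ).maskProd F.deg c.mem x :=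
  ForestModel.maskProd_eq_unshuffle _ _ c.isUnshuffle _ c.card_vertices x

include hσ in
theorem unshuffle_none {F G : Forest} (d : G.Sub) (x : ⨂[k]^(F.deg + 1) V) (y : ⨂[k]^G.deg V) :
    unshuffle σ (Forest.Sub.perm (F := .cons F G) (none, d))⁻¹
        (p := F.deg + 1 + d.part.deg) (q := d.rest.deg)
        (Forest.Sub.part_add_rest (F := .cons F G) (none, d)).symm
        (TensorPower.mulEquiv (x ⊗ₜ[k] y) : ⨂[k]^(F.deg + 1 + G.deg) V) =
      TensorPower.mulEquiv.toLinearMap.rTensor _ ((TensorProduct.assoc k _ _ _).symm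
        (x ⊗ₜ unshuffle σ d.perm⁻¹ d.part_add_rest.symm y)) := by
  apply map_dots_injective hσ
  refine (map_dots_unshuffle hσ (F := .cons F G) (none, d) _).trans ?_
  refine (ForestModel.maskProd_append _ (fun _ : Fin (F.deg + 1) => true) d.mem x y).trans ?_
  rw [ForestModel.maskProd_true, ← map_dots_unshuffle]
  induction unshuffle σ d.perm⁻¹ d.part_add_rest.symm y using TensorProduct.induction_on with
  | zero => simp
  | add a b ha hb => simp only [map_add, TensorProduct.tmul_add, ha, hb]
  | tmul a b =>
    rw [TensorProduct.assoc_symm_tmul, LinearMap.rTensor_tmul, TensorProduct.map_tmul,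
      TensorProduct.map_tmul, LinearEquiv.coe_coe, ForestModel.dots_mulEquiv,
      ForestModel.mul₂_tmul, (rModel σ hσ).braiding_one, sandwich_tmul, (rModel σ hσ).one_mul]

/-- Deconcatenates a product of two unshuffled blocks, the first of which begins with a vector. -/
def joinBlocks (σ : V ⊗[k] V →ₗ[k] V ⊗[k] V) {p q p' q' : ℕ} (v : V)
    (z : (⨂[k]^p V) ⊗[k] (⨂[k]^q V)) (z' : (⨂[k]^p' V) ⊗[k] (⨂[k]^q' V)) :
    (⨂[k]^(p + p') V) ⊗[k] (⨂[k]^(q + 1 + q') V) :=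
  TensorProduct.map TensorPower.mulEquiv.toLinearMap TensorPower.mulEquiv.toLinearMap
    (onMiddle _ _ (crossPow σ (q + 1) p') ((consEquiv k V q).toLinearMap.lTensor _
      (onFirst _ (crossVec σ p) (v ⊗ₜ z)) ⊗ₜ z'))

theorem map_joinBlocks (M : ForestModel (RSpace k V) σ) {p q p' q' : ℕ} (v : V)
    (z : (⨂[k]^p V) ⊗[k] (⨂[k]^q V)) (z' : (⨂[k]^p' V) ⊗[k] (⨂[k]^q' V))
    {a : ⨂[k]^p V →ₗ[k] RSpace k V} {b : ⨂[k]^q V →ₗ[k] RSpace k V}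
    {b' : ⨂[k]^(q + 1) V →ₗ[k] RSpace k V} {g : V ⊗[k] RSpace k V →ₗ[k] RSpace k V}
    {c : ⨂[k]^p' V →ₗ[k] RSpace k V} {d : ⨂[k]^q' V →ₗ[k] RSpace k V}
    {ac : ⨂[k]^(p + p') V →ₗ[k] RSpace k V} {bd : ⨂[k]^(q + 1 + q') V →ₗ[k] RSpace k V}
    (ha : Intertwines (crossVec σ p) M.τ LinearMap.id a)
    (hb : ∀ v y, b' (consEquiv k V q (v ⊗ₜ y)) = g (v ⊗ₜ b y))
    (hbc : Intertwines (crossPow σ (q + 1) p') M.D.braiding b' c)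
    (hac : ∀ x y, ac (TensorPower.mulEquiv (x ⊗ₜ[k] y)) = M.D.mul (a x ⊗ₜ c y))
    (hbd : ∀ x y, bd (TensorPower.mulEquiv (x ⊗ₜ[k] y)) = M.D.mul (b' x ⊗ₜ d y)) :
    TensorProduct.map ac bd (joinBlocks σ v z z') =
      M.D.mul₂ (M.crossFirst g (v ⊗ₜ TensorProduct.map a b z) ⊗ₜ TensorProduct.map c d z') := by
  have h₁ : ac ∘ₗ TensorPower.mulEquiv.toLinearMap = M.D.mul ∘ₗ TensorProduct.map a c :=
    TensorProduct.ext' hac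
  have h₂ : bd ∘ₗ TensorPower.mulEquiv.toLinearMap = M.D.mul ∘ₗ TensorProduct.map b' d :=
    TensorProduct.ext' hbd
  rw [joinBlocks, ← LinearMap.comp_apply, ← TensorProduct.map_comp, h₁, h₂,
    TensorProduct.map_comp, LinearMap.comp_apply, map_onMiddle hbc, M.map_crossFirst v z ha hb]
  rfl

include hσ in
theorem unshuffle_some {F G : Forest} (c : F.Sub) (d : G.Sub) (v : V) (x : ⨂[k]^F.deg V)
    (y : ⨂[k]^G.deg V) :
    unshuffle σ (Forest.Sub.perm (F := .cons F G) (some c, d))⁻¹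
        (p := (c.part.append d.part).deg) (q := c.rest.deg + 1 + d.rest.deg)
        (Forest.Sub.part_add_rest (F := .cons F G) (some c, d)).symm
        (TensorPower.mulEquiv (consEquiv k V _ (v ⊗ₜ x) ⊗ₜ[k] y) :
          ⨂[k]^(F.deg + 1 + G.deg) V) =
      (TensorPower.cast k V (Forest.deg_append _ _).symm).toLinearMap.rTensor _
        (joinBlocks σ v (unshuffle σ c.perm⁻¹ c.part_add_rest.symm x)
          (unshuffle σ d.perm⁻¹ d.part_add_rest.symm y)) := by
  apply map_dots_injective hσ
  refine (map_dots_unshuffle hσ (F := .cons F G) (some c, d) _).trans ?_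
  refine (ForestModel.maskProd_append _ (Fin.cons (n := F.deg) (α := fun _ => Bool) false c.mem)
    d.mem _ y).trans ?_
  have hc : (rModel σ hσ).dots (c.part.append d.part).deg ∘ₗ
      (TensorPower.cast k V (Forest.deg_append _ _).symm).toLinearMap =
      (rModel σ hσ).dots (c.part.deg + d.part.deg) :=
    LinearMap.ext fun x => ForestModel.dots_cast _ _ x
  rw [ForestModel.maskProd_of_false _ rfl, Fin.tail_cons, ← map_dots_unshuffle,
    ← map_dots_unshuffle, map_rTensor_apply, hc]
  exact (map_joinBlocks (rModel σ hσ) v _ _ (ForestModel.dots_V _ _)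
    (ForestModel.dots_consEquiv _ _) (ForestModel.dots_R _ _ _)
    (ForestModel.dots_mulEquiv _ _ _) (ForestModel.dots_mulEquiv _ _ _)).symm

include hσ in
theorem subTerm_none {F G : Forest} (d : G.Sub) (x : ⨂[k]^(F.deg + 1) V) (y : ⨂[k]^G.deg V) :
    subTerm σ (F := .cons F G) (none, d)
        (TensorPower.mulEquiv (x ⊗ₜ[k] y) : ⨂[k]^(F.deg + 1 + G.deg) V) =
      rMul₂ σ ((decorate (n := F.deg + 1) k V Forest.deg (.cons F .nil) rfl x ⊗ₜ rOne k V) ⊗ₜ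
        subTerm σ d y) := by
  refine (congrArg (TensorProduct.map (decorate (n := F.deg + 1 + d.part.deg) k V Forest.deg
    (.cons F d.part) rfl) (decorate k V Forest.deg d.rest rfl)) (unshuffle_none hσ d x y)).trans ?_
  rw [subTerm, LinearMap.comp_apply]
  induction unshuffle σ d.perm⁻¹ d.part_add_rest.symm y using TensorProduct.induction_on with
  | zero => simp
  | add a b ha hb => simp only [map_add, TensorProduct.tmul_add, ha, hb]
  | tmul a b =>
    rw [TensorProduct.assoc_symm_tmul, LinearMap.rTensor_tmul, TensorProduct.map_tmul,
      TensorProduct.map_tmul]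
    refine Eq.trans ?_ ((rModel σ hσ).mul₂_tmul _ _ _ _).symm
    refine Eq.trans ?_ (congrArg _ ((rModel σ hσ).braiding_one _).symm)
    rw [sandwich_tmul, (rModel σ hσ).one_mul]
    congr 1
    exact (rMul_decorate (F := .cons F .nil) (m := F.deg + 1) rfl rfl x a).symm

include hσ in
theorem subTerm_some {F G : Forest} (c : F.Sub) (d : G.Sub) (v : V) (x : ⨂[k]^F.deg V)
    (y : ⨂[k]^G.deg V) :
    subTerm σ (F := .cons F G) (some c, d)
        (TensorPower.mulEquiv (consEquiv k V _ (v ⊗ₜ x) ⊗ₜ[k] y) :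
          ⨂[k]^(F.deg + 1 + G.deg) V) =
      rMul₂ σ ((bPlus k V).lTensor (RSpace k V)
        (onFirst _ (vecBraiding Forest.deg σ) (v ⊗ₜ subTerm σ c x)) ⊗ₜ subTerm σ d y) := by
  refine (congrArg (TensorProduct.map (decorate k V Forest.deg (c.part.append d.part) rfl)
    (decorate (n := c.rest.deg + 1 + d.rest.deg) k V Forest.deg (.cons c.rest d.rest) rfl))
    (unshuffle_some hσ c d v x y)).trans ?_
  have hc : decorate k V Forest.deg (c.part.append d.part) rfl ∘ₗ
      (TensorPower.cast k V (Forest.deg_append _ _).symm).toLinearMap =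
      decorate k V Forest.deg (c.part.append d.part) (Forest.deg_append _ _) :=
    LinearMap.ext fun x => decorate_cast (s := c.part.append d.part) (deg := Forest.deg)
      (m := c.part.deg + d.part.deg) rfl (Forest.deg_append _ _).symm x
  have ha : Intertwines (crossVec σ c.part.deg) (rModel σ hσ).τ LinearMap.id
      (decorate k V Forest.deg c.part rfl) := decorate_vecBraiding σ rfl
  have hb : ∀ (v : V) (y : ⨂[k]^c.rest.deg V),
      decorate (n := c.rest.deg + 1) k V Forest.deg (.cons c.rest .nil) rfl
        (consEquiv k V c.rest.deg (v ⊗ₜ y)) =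
      bPlus k V (v ⊗ₜ decorate k V Forest.deg c.rest rfl y) :=
    fun v y => (bPlus_decorate rfl v y).symm
  have hbc : Intertwines (crossPow σ (c.rest.deg + 1) d.part.deg) (rModel σ hσ).D.braiding
      (decorate (n := c.rest.deg + 1) k V Forest.deg (.cons c.rest .nil) rfl)
      (decorate k V Forest.deg d.part rfl) := decorate_decBraiding σ _ rfl
  have hac : ∀ (x : ⨂[k]^c.part.deg V) (y : ⨂[k]^d.part.deg V),
      decorate k V Forest.deg (c.part.append d.part) (Forest.deg_append _ _)
        (TensorPower.mulEquiv (x ⊗ₜ[k] y)) =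
      (rModel σ hσ).D.mul (decorate k V Forest.deg c.part rfl x ⊗ₜ
        decorate k V Forest.deg d.part rfl y) :=
    fun x y => (rMul_decorate rfl rfl x y).symm
  have hbd : ∀ (x : ⨂[k]^(c.rest.deg + 1) V) (y : ⨂[k]^d.rest.deg V),
      decorate (n := c.rest.deg + 1 + d.rest.deg) k V Forest.deg (.cons c.rest d.rest) rfl
        (TensorPower.mulEquiv (x ⊗ₜ[k] y)) =
      (rModel σ hσ).D.mul (decorate (n := c.rest.deg + 1) k V Forest.deg (.cons c.rest .nil) rfl x
        ⊗ₜ decorate k V Forest.deg d.rest rfl y) :=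
    fun x y => (rMul_decorate (F := .cons c.rest .nil) (m := c.rest.deg + 1) rfl rfl x y).symm
  rw [map_rTensor_apply, hc]
  exact map_joinBlocks (rModel σ hσ) v _ _ ha hb hbc hac hbd

theorem sum_sub_cons {P : Type*} [AddCommMonoid P] {F G : Forest}
    (f : (Forest.cons F G).Sub → P) :
    ∑ c, f c = ∑ d : G.Sub, f (none, d) + ∑ c : F.Sub, ∑ d : G.Sub, f (some c, d) := by
  refine (Fintype.sum_prod_type (α₁ := Option F.Sub) (α₂ := G.Sub) f).trans ?_
  rw [Fintype.sum_option]

theorem rMul₂_graft_sum {σ : V ⊗[k] V →ₗ[k] V ⊗[k] V} {ι κ : Type*} [Fintype ι] [Fintype κ] (v : V)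
    (t : RSpace k V) (f : ι → RSpace k V ⊗[k] RSpace k V) (g : κ → RSpace k V ⊗[k] RSpace k V) :
    rMul₂ σ ((t ⊗ₜ rOne k V + (bPlus k V).lTensor (RSpace k V)
        (onFirst _ (vecBraiding Forest.deg σ) (v ⊗ₜ ∑ i, f i))) ⊗ₜ ∑ j, g j) =
      ∑ j, rMul₂ σ ((t ⊗ₜ rOne k V) ⊗ₜ g j) +
        ∑ i, ∑ j, rMul₂ σ ((bPlus k V).lTensor (RSpace k V)
          (onFirst _ (vecBraiding Forest.deg σ) (v ⊗ₜ f i)) ⊗ₜ g j) := by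
  rw [TensorProduct.add_tmul, map_add]
  simp only [TensorProduct.tmul_sum, TensorProduct.sum_tmul, map_sum]
  rw [Finset.sum_comm (s := (Finset.univ : Finset κ))]

include hσ in
theorem sum_subTerm (F : Forest) (x : ⨂[k]^F.deg V) :
    ∑ c : F.Sub, subTerm σ c x = recComul σ F x := by
  induction F with
  | nil =>
    refine (Fintype.sum_unique (ι := Unit) fun c => subTerm σ (F := .nil) c x).trans ?_
    have h : subTerm σ (F := .nil) () = recComul σ .nil := by
      refine tensorPower_zero_ext (k := k) (V := V) (P := RSpace k V ⊗[k] RSpace k V)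
        (Eq.trans ?_ (recComul_nil σ).symm)
      exact congrArg (TensorProduct.map (decorate k V Forest.deg .nil Forest.deg_nil)
        (decorate k V Forest.deg .nil Forest.deg_nil)) (unshuffle_algebraMap₀ σ (Forest.Sub.perm
          (F := .nil) ())⁻¹ rfl 1)
    exact LinearMap.congr_fun h x
  | cons F G hF hG =>
    induction x using forestPower_induction with
    | zero => simp
    | add a b ha hb => simp only [map_add, Finset.sum_add_distrib, ha, hb]
    | cons v x y =>
      rw [recComul_cons, TensorProduct.map_tmul, graftComul_consEquiv, ← hF, ← hG, bPlus_decorate,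
        rMul₂_graft_sum]
      refine (sum_sub_cons _).trans ?_
      exact congrArg₂ (· + ·) (Finset.sum_congr rfl fun d _ => subTerm_none hσ d _ y)
        (Finset.sum_congr rfl fun c _ => Finset.sum_congr rfl fun d _ => subTerm_some hσ c d v x y)

include hσ in
theorem treeComul_eq (F : Forest) : treeComul σ F = graftComul σ F (recComul σ F) := by
  refine LinearMap.ext fun x => ?_
  refine (LinearMap.sum_apply _ _ _).trans ?_
  refine (sum_subTerm hσ (.cons F .nil) x).trans ?_
  have h : x = (TensorPower.mulEquiv (x ⊗ₜ[k] (TensorPower.algebraMap₀ 1 : ⨂[k]^0 V)) :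
      ⨂[k]^(F.deg + 1 + 0) V) := by
    rw [mulEquiv_algebraMap₀, one_smul]
  refine (congrArg (recComul σ (.cons F .nil)) h).trans ?_
  refine (recComul_cons σ F .nil _).trans ?_
  refine (congrArg (rMul₂ σ) (TensorProduct.map_tmul _ _ _ _)).trans ?_
  refine (congrArg (fun z => rMul₂ σ (graftComul σ F (recComul σ F) x ⊗ₜ z))
    (recComul_nil σ)).trans ?_
  exact (rModel σ hσ).mul₂_one _

include hσ in
theorem forestComul_eq (F : Forest) : forestComul σ F = recComul σ F := by
  induction F with
  | nil => rfl
  | cons F G hF hG =>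
    rw [forestComul, recComul, treeComul_eq hσ, hG]
    rfl

include hσ in
theorem recHopf_eq : recHopf σ = rHopf σ := by
  rw [recHopf, rHopf, funext (forestComul_eq hσ)]

end ForestSum

/-! ### Binary trees -/

section TreeShapes

variable {k V : Type*} [Field k] [AddCommGroup V] [Module k V]

theorem btDeg_nil : btDeg .nil = 0 := rfl

theorem yOne_eq : yOne k V = emptyShape BinaryTree.nil btDeg_nil := rfl

theorem splitEquiv_toLinearMap (a b : ℕ) : (splitEquiv k V a b).toLinearMap =
    TensorPower.mulEquiv.toLinearMap ∘ₗ
      TensorProduct.map LinearMap.id (consEquiv k V b).toLinearMap :=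
  tensor_ext_right fun _ _ _ => rfl

theorem vee_decorate {l r : BT} {m n : ℕ} (hl : btDeg l = m) (hr : btDeg r = n) (v : V)
    (x : ⨂[k]^m V) (y : ⨂[k]^n V) :
    vee k V (decorate k V btDeg l hl x ⊗ₜ (v ⊗ₜ decorate k V btDeg r hr y)) =
      decorate k V btDeg (.node () l r) (by rw [btDeg, hl, hr])
        (splitEquiv k V m n (x ⊗ₜ (v ⊗ₜ y))) := by
  subst hl hr
  simp only [vee, TensorProduct.lift.tmul, LinearMap.flip_apply, toModule_decorate]
  rfl

theorem vee_comp_decorate (l r : BT) :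
    vee k V ∘ₗ TensorProduct.map (decorate k V btDeg l rfl)
      (TensorProduct.map LinearMap.id (decorate k V btDeg r rfl)) =
      decorate k V btDeg (.node () l r) rfl ∘ₗ
        (splitEquiv k V (btDeg l) (btDeg r)).toLinearMap :=
  tensor_ext_right fun x v y => vee_decorate rfl rfl v x y

theorem treePower_induction {a : Unit} {l r : BT}
    {P : ⨂[k]^(btDeg (.node a l r)) V → Prop}
    (zero : P 0) (add : ∀ x y, P x → P y → P (x + y))
    (node : ∀ (x : ⨂[k]^(btDeg l) V) v (y : ⨂[k]^(btDeg r) V),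
      P (nodeEquiv k V a l r (x ⊗ₜ (v ⊗ₜ y))))
    (x : ⨂[k]^(btDeg (.node a l r)) V) : P x := by
  obtain ⟨z, rfl⟩ := (nodeEquiv k V a l r).surjective x
  induction z using TensorProduct.induction_on with
  | zero => rw [map_zero]; exact zero
  | add a b ha hb => rw [map_add]; exact add _ _ ha hb
  | tmul x z =>
  induction z using TensorProduct.induction_on with
  | zero => rw [TensorProduct.tmul_zero, map_zero]; exact zero
  | add a b ha hb => rw [TensorProduct.tmul_add, map_add]; exact add _ _ ha hb
  | tmul v y => exact node x v y

theorem decorate_nodeEquiv (a : Unit) (l r : BT) (x : ⨂[k]^(btDeg l) V) (v : V)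
    (y : ⨂[k]^(btDeg r) V) :
    decorate k V btDeg (.node a l r) rfl (nodeEquiv k V a l r (x ⊗ₜ (v ⊗ₜ y))) =
      vee k V (decorate k V btDeg l rfl x ⊗ₜ (v ⊗ₜ decorate k V btDeg r rfl y)) :=
  (vee_decorate rfl rfl v x y).symm

theorem ySpace_induction {P : YSpace k V → Prop} (zero : P 0)
    (add : ∀ x y, P x → P y → P (x + y)) (nil : ∀ r : k, P (r • yOne k V))
    (vee : ∀ l r x v y, P (vee k V
      (decorate k V btDeg l rfl x ⊗ₜ (v ⊗ₜ decorate k V btDeg r rfl y))))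
    (x : YSpace k V) : P x := by
  induction x using decorated_induction with
  | zero => exact zero
  | add a b ha hb => exact add a b ha hb
  | dec Y x =>
    cases Y with
    | nil =>
      obtain ⟨r, rfl⟩ := (TensorPower.algebraMap₀ : k ≃ₗ[k] ⨂[k]^0 V).surjective x
      have h := nil r
      rw [yOne_eq, emptyShape, ← map_smul, ← map_smul, smul_eq_mul, mul_one] at h
      exact h
    | node a l r =>
      induction x using treePower_induction with
      | zero => rw [map_zero]; exact zero
      | add a b ha hb => rw [map_add]; exact add _ _ ha hb
      | node x v y => rw [decorate_nodeEquiv]; exact vee l r x v y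

variable (k V) in
theorem yMul_decorate (Y Y' : BT) (x : ⨂[k]^(btDeg Y) V) (y : ⨂[k]^(btDeg Y') V) :
    yMul k V (decorate k V btDeg Y rfl x ⊗ₜ decorate k V btDeg Y' rfl y) =
      mulShape k V Y Y' (x ⊗ₜ y) := by
  simp [yMul, toModule_decorate]

theorem yOne_yMul (x : YSpace k V) : yMul k V (yOne k V ⊗ₜ x) = x := by
  induction x using decorated_induction with
  | zero => simp
  | add a b ha hb => simp only [TensorProduct.tmul_add, map_add, ha, hb]
  | dec Y x =>
    refine (yMul_decorate k V .nil Y (TensorPower.algebraMap₀ 1 : ⨂[k]^0 V) x).trans ?_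
    rw [mulShape]
    refine (congrArg (fun r : k => decorate k V btDeg Y rfl (r • x))
      (LinearEquiv.symm_apply_apply TensorPower.algebraMap₀ (1 : k))).trans ?_
    rw [one_smul]

theorem yMul_yOne (x : YSpace k V) : yMul k V (x ⊗ₜ yOne k V) = x := by
  induction x using ySpace_induction with
  | zero => simp
  | add a b ha hb => simp only [TensorProduct.add_tmul, map_add, ha, hb]
  | nil r => rw [TensorProduct.smul_tmul, TensorProduct.tmul_smul, map_smul, yOne_yMul]
  | vee l r x v y =>
    rw [← decorate_nodeEquiv ()]
    refine (yMul_decorate k V (.node () l r) .nil _ (TensorPower.algebraMap₀ 1 : ⨂[k]^0 V)).trans ?_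
    rw [mulShape]
    refine (congrArg (fun t : k => decorate k V btDeg (.node () l r) rfl
      (t • nodeEquiv k V () l r (x ⊗ₜ (v ⊗ₜ y))))
      (LinearEquiv.symm_apply_apply TensorPower.algebraMap₀ (1 : k))).trans ?_
    rw [one_smul]

theorem vee_yMul_vee (a : YSpace k V) (u : V) (b a' : YSpace k V) (v : V) (b' : YSpace k V) :
    yMul k V (vee k V (a ⊗ₜ (u ⊗ₜ b)) ⊗ₜ vee k V (a' ⊗ₜ (v ⊗ₜ b'))) =
      vee k V (a ⊗ₜ (u ⊗ₜ yMul k V (b ⊗ₜ vee k V (a' ⊗ₜ (v ⊗ₜ b'))))) +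
        vee k V (yMul k V (vee k V (a ⊗ₜ (u ⊗ₜ b)) ⊗ₜ a') ⊗ₜ (v ⊗ₜ b')) := by
  induction a using decorated_induction with
  | zero => simp
  | add x y hx hy =>
    simp only [TensorProduct.add_tmul, map_add, hx, hy]
    abel
  | dec Y₁ x₁ =>
  induction b using decorated_induction with
  | zero => simp
  | add x y hx hy =>
    simp only [TensorProduct.tmul_add, TensorProduct.add_tmul, map_add, hx, hy]
    abel
  | dec Y₂ x₂ =>
  induction a' using decorated_induction with
  | zero => simp
  | add x y hx hy =>
    simp only [TensorProduct.tmul_add, TensorProduct.add_tmul, map_add, hx, hy]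
    abel
  | dec Y₁' y₁ =>
  induction b' using decorated_induction with
  | zero => simp
  | add x y hx hy =>
    simp only [TensorProduct.tmul_add, map_add, hx, hy]
    abel
  | dec Y₂' y₂ =>
    rw [← decorate_nodeEquiv (), ← decorate_nodeEquiv (), yMul_decorate, yMul_decorate,
      yMul_decorate, mulShape]
    simp

variable (σ : V ⊗[k] V →ₗ[k] V ⊗[k] V)

theorem vee_vecBraiding : Intertwines (crossR (vecBraiding btDeg σ)
    (crossR σ (vecBraiding btDeg σ))) (vecBraiding btDeg σ) LinearMap.id (vee k V) := by
  refine Intertwines.ext_right fun u l z => ?_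
  induction z using TensorProduct.induction_on with
  | zero => simp
  | add a b ha hb => simp only [TensorProduct.tmul_add, map_add, ha, hb]
  | tmul v r =>
  induction l using decorated_induction with
  | zero => simp
  | add a b ha hb => simp only [TensorProduct.add_tmul, TensorProduct.tmul_add, map_add, ha, hb]
  | dec l x =>
  induction r using decorated_induction with
  | zero => simp
  | add a b ha hb => simp only [TensorProduct.tmul_add, map_add, ha, hb]
  | dec r y =>
    refine Intertwines.apply_of_comp (d := LinearMap.id)
      ((decorate_vecBraiding σ (rfl : btDeg l = _)).crossR
        (Intertwines.id.crossR (decorate_vecBraiding σ (rfl : btDeg r = _)))) ?_ u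
          (x ⊗ₜ (v ⊗ₜ y))
    rw [vee_comp_decorate, splitEquiv_toLinearMap]
    exact (decorate_vecBraiding σ _).comp_right ((crossVec_mul σ _ _).comp_right
      (Intertwines.id.crossR (crossVec_cons σ _)))

theorem vee_decBraiding : Intertwines (crossL (decBraiding btDeg σ)
    (crossL (vecBraiding btDeg σ) (decBraiding btDeg σ))) (decBraiding btDeg σ) (vee k V)
    LinearMap.id := by
  refine Intertwines.ext_left fun l z t => ?_
  induction z using TensorProduct.induction_on with
  | zero => simp
  | add a b ha hb => simp only [TensorProduct.tmul_add, TensorProduct.add_tmul, map_add, ha, hb]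
  | tmul v r =>
  induction l using decorated_induction with
  | zero => simp
  | add a b ha hb => simp only [TensorProduct.add_tmul, map_add, ha, hb]
  | dec l x =>
  induction r using decorated_induction with
  | zero => simp
  | add a b ha hb => simp only [TensorProduct.tmul_add, TensorProduct.add_tmul, map_add, ha, hb]
  | dec r y =>
  induction t using decorated_induction with
  | zero => simp
  | add a b ha hb => simp only [TensorProduct.tmul_add, map_add, ha, hb]
  | dec t z =>
    refine Intertwines.apply_of_comp
      ((decorate_decBraiding σ (rfl : btDeg l = _) (rfl : btDeg t = _)).crossL
        ((decorate_vecBraiding σ (rfl : btDeg t = _)).crossL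
          (decorate_decBraiding σ (rfl : btDeg r = _) (rfl : btDeg t = _)))) ?_
          (x ⊗ₜ (v ⊗ₜ y)) z
    rw [vee_comp_decorate, splitEquiv_toLinearMap, LinearMap.id_comp]
    exact (decorate_decBraiding σ _ _).comp_of_left ((crossPow_mul σ _ _ _).comp_left
      (Intertwines.id.crossL (crossPow_cons σ _ _)))

/-- The height of a binary tree. -/
def btHeight : BT → ℕ
  | .nil => 1
  | .node _ l r => max (btHeight l) (btHeight r) + 1

theorem btHeight_pos : ∀ Y : BT, 0 < btHeight Y
  | .nil => Nat.one_pos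
  | .node _ _ _ => Nat.succ_pos _

theorem yCover : Cover (M₂ := YSpace k V ⊗[k] (V ⊗[k] YSpace k V))
    (LinearMap.toSpanSingleton k _ (yOne k V)) (vee k V)
    (truncate k V btDeg btHeight) where
  surj m := by
    induction m using ySpace_induction with
    | zero => exact ⟨0, 0, by simp⟩
    | add a b ha hb =>
      obtain ⟨a₁, a₂, rfl⟩ := ha
      obtain ⟨b₁, b₂, rfl⟩ := hb
      exact ⟨a₁ + b₁, a₂ + b₂, by simp only [map_add]; abel⟩
    | nil r => exact ⟨r, 0, by simp⟩
    | vee l r x v y => exact ⟨0, _, by rw [map_zero, zero_add]⟩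
  zero := truncate_zero _ btHeight_pos
  eventually := truncate_eventually _

theorem truncate_yOne (n : ℕ) : truncate k V btDeg btHeight (n + 1) (yOne k V) = yOne k V := by
  rw [yOne_eq, emptyShape, truncate_decorate,
    if_pos (show btHeight .nil ≤ n + 1 from Nat.succ_le_succ n.zero_le)]

theorem truncate_comp_vee (n : ℕ) :
    truncate k V btDeg btHeight (n + 1) ∘ₗ vee k V =
      vee k V ∘ₗ TensorProduct.map (truncate k V btDeg btHeight n)
        (TensorProduct.map LinearMap.id (truncate k V btDeg btHeight n)) := by
  refine tensor_ext_right fun l v r => ?_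
  induction l using decorated_induction with
  | zero => simp
  | add a b ha hb => simp only [TensorProduct.add_tmul, map_add, ha, hb]
  | dec l x =>
  induction r using decorated_induction with
  | zero => simp
  | add a b ha hb => simp only [TensorProduct.tmul_add, map_add, ha, hb]
  | dec r y =>
    simp only [LinearMap.comp_apply, TensorProduct.map_tmul, LinearMap.id_apply,
      truncate_decorate, vee_decorate]
    have h : btHeight (.node () l r) ≤ n + 1 ↔ btHeight l ≤ n ∧ btHeight r ≤ n := by
      rw [btHeight, Nat.succ_le_succ_iff, max_le_iff]
    by_cases hl : btHeight l ≤ n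
    · by_cases hr : btHeight r ≤ n
      · rw [if_pos (h.2 ⟨hl, hr⟩), if_pos hl, if_pos hr, vee_decorate]
      · rw [if_neg fun h' => hr (h.1 h').2, if_neg hr, TensorProduct.tmul_zero,
          TensorProduct.tmul_zero, map_zero]
    · rw [if_neg fun h' => hl (h.1 h').1, if_neg hl, TensorProduct.zero_tmul, map_zero]

theorem yHopf_comul_yOne : (yHopf σ).comul (yOne k V) = yOne k V ⊗ₜ yOne k V :=
  (toModule_decorate _ BinaryTree.nil _).trans
    ((congrArg (LinearMap.toSpanSingleton k _ (yOne k V ⊗ₜ[k] yOne k V))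
      (LinearEquiv.symm_apply_apply TensorPower.algebraMap₀ (1 : k))).trans (one_smul _ _))

theorem yHopf_comul_vee (a : YSpace k V) (v : V) (b : YSpace k V) :
    (yHopf σ).comul (vee k V (a ⊗ₜ (v ⊗ₜ b))) = vee k V (a ⊗ₜ (v ⊗ₜ b)) ⊗ₜ yOne k V +
      mulVee σ ((yHopf σ).comul a ⊗ₜ (v ⊗ₜ (yHopf σ).comul b)) := by
  induction a using decorated_induction with
  | zero => simp
  | add x y hx hy => simp only [TensorProduct.add_tmul, map_add, hx, hy]; abel
  | dec l x =>
  induction b using decorated_induction with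
  | zero => simp
  | add x y hx hy =>
    simp only [TensorProduct.tmul_add, TensorProduct.add_tmul, map_add, hx, hy]; abel
  | dec r y =>
    have h : ∀ Y (x : ⨂[k]^(btDeg Y) V),
        (yHopf σ).comul (decorate k V btDeg Y rfl x) = comulShape σ Y x :=
      fun Y x => toModule_decorate _ Y x
    rw [← decorate_nodeEquiv (), h, h, h, comulShape]
    simp

theorem deltaForm_vee (z : YSpace k V ⊗[k] (V ⊗[k] YSpace k V)) :
    deltaForm btDeg .nil btDeg_nil (vee k V z) = 0 := by
  have h : deltaForm btDeg .nil btDeg_nil ∘ₗ vee k V = 0 := by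
    refine tensor_ext_right fun l v r => ?_
    induction l using decorated_induction with
    | zero => simp
    | add a b ha hb => simp only [TensorProduct.add_tmul, map_add, ha, hb]
    | dec l x =>
    induction r using decorated_induction with
    | zero => simp
    | add a b ha hb => simp only [TensorProduct.tmul_add, map_add, ha, hb]
    | dec r y =>
      rw [LinearMap.comp_apply, vee_decorate]
      exact deltaForm_decorate btDeg_nil _ (by simp) _
  exact LinearMap.congr_fun h z

/-- `𝒴(V)` is generated by the tree `|` and the operation `(Y, v, Y') ↦ Y ∨_v Y'`. -/
def yModel : TreeModel (YSpace k V) σ where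
  D := yHopf σ
  τ := vecBraiding btDeg σ
  vee := vee k V
  p := truncate k V btDeg btHeight
  cover := yCover
  p_one := truncate_yOne
  p_vee := truncate_comp_vee
  τ_one := vecBraiding_emptyShape σ BinaryTree.nil btDeg_nil
  τ_vee := vee_vecBraiding σ
  braiding_one := decBraiding_emptyShape σ BinaryTree.nil btDeg_nil
  braiding_vee := vee_decBraiding σ
  one_mul := yOne_yMul
  mul_one := yMul_yOne
  vee_mul_vee := vee_yMul_vee
  comul_one := yHopf_comul_yOne σ
  comul_vee a v b := (yHopf_comul_vee σ a v b).trans (by simp [mulVee]; rfl)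
  counit_one := deltaForm_emptyShape btDeg_nil
  counit_vee := deltaForm_vee

end TreeShapes

/-! ### The isomorphism -/

section Theta

variable {k V : Type*} [Field k] [AddCommGroup V] [Module k V]

variable (k V) in
/-- The left dendriform action `≻` of forests of a given shape on `ℛ(V)`. -/
def actShape : (F : Forest) → (⨂[k]^F.deg V) ⊗[k] RSpace k V →ₗ[k] RSpace k V
  | .nil => (TensorProduct.lid k _).toLinearMap ∘ₗ
      (TensorPower.algebraMap₀.symm : ⨂[k]^0 V ≃ₗ[k] k).toLinearMap.rTensor _
  | .cons F G => (rCons k V - bPlus k V ∘ₗ (rMul k V).lTensor V) ∘ₗ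
      TensorProduct.map LinearMap.id
        (TensorProduct.map (decorate k V Forest.deg F rfl) (actShape G)) ∘ₗ
      (TensorProduct.assoc k V (⨂[k]^F.deg V) ((⨂[k]^G.deg V) ⊗[k] RSpace k V)).toLinearMap ∘ₗ
      TensorProduct.map (consEquiv k V F.deg).symm.toLinearMap LinearMap.id ∘ₗ
      (TensorProduct.assoc k (⨂[k]^(F.deg + 1) V) (⨂[k]^G.deg V) (RSpace k V)).toLinearMap ∘ₗ
      (TensorPower.mulEquiv.symm : ⨂[k]^(F.deg + 1 + G.deg) V ≃ₗ[k] _).toLinearMap.rTensor _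

variable (k V) in
/-- The left dendriform action `≻` of `ℛ(V)` on itself. -/
def rAct : RSpace k V ⊗[k] RSpace k V →ₗ[k] RSpace k V :=
  TensorProduct.lift <| DirectSum.toModule k Forest _ fun F => TensorProduct.curry (actShape k V F)

theorem rAct_decorate (F : Forest) (x : ⨂[k]^F.deg V) (z : RSpace k V) :
    rAct k V (decorate k V Forest.deg F rfl x ⊗ₜ z) = actShape k V F (x ⊗ₜ z) := by
  rw [rAct, TensorProduct.lift.tmul, toModule_decorate, TensorProduct.curry_apply]

theorem rAct_one (z : RSpace k V) : rAct k V (rOne k V ⊗ₜ z) = z := by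
  refine (rAct_decorate .nil (TensorPower.algebraMap₀ 1 : ⨂[k]^0 V) z).trans ?_
  exact (congrArg (fun r : k => r • z)
    (LinearEquiv.symm_apply_apply TensorPower.algebraMap₀ (1 : k))).trans (one_smul k z)

theorem actShape_cons (F G : Forest) (v : V) (x : ⨂[k]^F.deg V) (y : ⨂[k]^G.deg V)
    (z : RSpace k V) :
    actShape k V (.cons F G) ((TensorPower.mulEquiv (consEquiv k V F.deg (v ⊗ₜ x) ⊗ₜ[k] y) :
        ⨂[k]^(F.deg + 1 + G.deg) V) ⊗ₜ z) =
      rCons k V (v ⊗ₜ (decorate k V Forest.deg F rfl x ⊗ₜ actShape k V G (y ⊗ₜ z))) -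
        bPlus k V (v ⊗ₜ rMul k V (decorate k V Forest.deg F rfl x ⊗ₜ actShape k V G (y ⊗ₜ z))) := by
  refine (congrArg (fun w => (rCons k V - bPlus k V ∘ₗ (rMul k V).lTensor V)
    (TensorProduct.map LinearMap.id
        (TensorProduct.map (decorate k V Forest.deg F rfl) (actShape k V G))
      ((TensorProduct.assoc k V (⨂[k]^F.deg V) ((⨂[k]^G.deg V) ⊗[k] RSpace k V)).toLinearMap
        (TensorProduct.map (consEquiv k V F.deg).symm.toLinearMap LinearMap.id
      ((TensorProduct.assoc k (⨂[k]^(F.deg + 1) V) (⨂[k]^G.deg V) (RSpace k V)).toLinearMap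
        (w ⊗ₜ z)))))) (LinearEquiv.symm_apply_apply TensorPower.mulEquiv
          (consEquiv k V F.deg (v ⊗ₜ x) ⊗ₜ[k] y))).trans ?_
  simp

theorem rAct_rCons (v : V) (F G z : RSpace k V) :
    rAct k V (rCons k V (v ⊗ₜ (F ⊗ₜ G)) ⊗ₜ z) =
      rCons k V (v ⊗ₜ (F ⊗ₜ rAct k V (G ⊗ₜ z))) -
        bPlus k V (v ⊗ₜ rMul k V (F ⊗ₜ rAct k V (G ⊗ₜ z))) := by
  induction F using decorated_induction with
  | zero => simp
  | add a b ha hb =>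
    simp only [TensorProduct.add_tmul, TensorProduct.tmul_add, map_add, ha, hb]; abel
  | dec F x =>
  induction G using decorated_induction with
  | zero => simp
  | add a b ha hb =>
    simp only [TensorProduct.add_tmul, TensorProduct.tmul_add, map_add, ha, hb]; abel
  | dec G y =>
    rw [← rCons_decorate_rfl, rAct_decorate G]
    exact (rAct_decorate (.cons F G) _ z).trans (actShape_cons F G v x y z)

variable (k V) in
/-- The isomorphism `𝒴(V) → ℛ(V)` on trees of a given shape. -/
def thetaShape : (Y : BT) → ⨂[k]^(btDeg Y) V →ₗ[k] RSpace k V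
  | .nil => LinearMap.toSpanSingleton k _ (rOne k V) ∘ₗ
      (TensorPower.algebraMap₀.symm : ⨂[k]^0 V ≃ₗ[k] k).toLinearMap
  | .node a l r => rAct k V ∘ₗ
      TensorProduct.map (thetaShape l) (bPlus k V ∘ₗ (thetaShape r).lTensor V) ∘ₗ
        (nodeEquiv k V a l r).symm.toLinearMap

variable (k V) in
/-- The isomorphism `𝒴(V) → ℛ(V)`. -/
def theta : YSpace k V →ₗ[k] RSpace k V := DirectSum.toModule k BT _ (thetaShape k V)

theorem theta_yOne : theta k V (yOne k V) = rOne k V :=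
  (toModule_decorate _ BinaryTree.nil _).trans
    ((congrArg (LinearMap.toSpanSingleton k _ (rOne k V))
      (LinearEquiv.symm_apply_apply TensorPower.algebraMap₀ (1 : k))).trans (one_smul _ _))

theorem theta_vee (a : YSpace k V) (v : V) (b : YSpace k V) :
    theta k V (vee k V (a ⊗ₜ (v ⊗ₜ b))) =
      rAct k V (theta k V a ⊗ₜ bPlus k V (v ⊗ₜ theta k V b)) := by
  induction a using decorated_induction with
  | zero => simp
  | add x y hx hy => simp only [TensorProduct.add_tmul, map_add, hx, hy]
  | dec l x =>
  induction b using decorated_induction with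
  | zero => simp
  | add x y hx hy => simp only [TensorProduct.tmul_add, map_add, hx, hy]
  | dec r y =>
    have h : ∀ Y (x : ⨂[k]^(btDeg Y) V),
        theta k V (decorate k V btDeg Y rfl x) = thetaShape k V Y x :=
      fun Y x => toModule_decorate _ Y x
    rw [← decorate_nodeEquiv (), h, h, h, thetaShape]
    simp

variable (k V) in
/-- The inverse isomorphism `ℛ(V) → 𝒴(V)` on forests of a given shape. -/
def thetaInvShape : (F : Forest) → ⨂[k]^F.deg V →ₗ[k] YSpace k V
  | .nil => LinearMap.toSpanSingleton k _ (yOne k V) ∘ₗ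
      (TensorPower.algebraMap₀.symm : ⨂[k]^0 V ≃ₗ[k] k).toLinearMap
  | .cons F G => yMul k V ∘ₗ TensorProduct.map (vee k V ∘ₗ TensorProduct.mk k _ _ (yOne k V) ∘ₗ
        (thetaInvShape F).lTensor V ∘ₗ (consEquiv k V F.deg).symm.toLinearMap)
        (thetaInvShape G) ∘ₗ
      (TensorPower.mulEquiv.symm : ⨂[k]^(F.deg + 1 + G.deg) V ≃ₗ[k] _).toLinearMap

variable (k V) in
/-- The inverse isomorphism `ℛ(V) → 𝒴(V)`. -/
def thetaInv : RSpace k V →ₗ[k] YSpace k V := DirectSum.toModule k Forest _ (thetaInvShape k V)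

theorem thetaInv_rOne : thetaInv k V (rOne k V) = yOne k V :=
  (toModule_decorate _ Forest.nil _).trans
    ((congrArg (LinearMap.toSpanSingleton k _ (yOne k V))
      (LinearEquiv.symm_apply_apply TensorPower.algebraMap₀ (1 : k))).trans (one_smul _ _))

theorem thetaInvShape_cons (F G : Forest) (v : V) (x : ⨂[k]^F.deg V) (y : ⨂[k]^G.deg V) :
    thetaInvShape k V (.cons F G) (TensorPower.mulEquiv (consEquiv k V F.deg (v ⊗ₜ x) ⊗ₜ[k] y) :
        ⨂[k]^(F.deg + 1 + G.deg) V) =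
      yMul k V (vee k V (yOne k V ⊗ₜ (v ⊗ₜ thetaInvShape k V F x)) ⊗ₜ thetaInvShape k V G y) := by
  refine (congrArg (fun w => yMul k V (TensorProduct.map (vee k V ∘ₗ
    TensorProduct.mk k _ _ (yOne k V) ∘ₗ (thetaInvShape k V F).lTensor V ∘ₗ
      (consEquiv k V F.deg).symm.toLinearMap) (thetaInvShape k V G) w))
    (LinearEquiv.symm_apply_apply TensorPower.mulEquiv
      (consEquiv k V F.deg (v ⊗ₜ x) ⊗ₜ[k] y))).trans ?_
  simp

theorem thetaInv_rCons (v : V) (F G : RSpace k V) :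
    thetaInv k V (rCons k V (v ⊗ₜ (F ⊗ₜ G))) =
      yMul k V (vee k V (yOne k V ⊗ₜ (v ⊗ₜ thetaInv k V F)) ⊗ₜ thetaInv k V G) := by
  induction F using decorated_induction with
  | zero => simp
  | add a b ha hb => simp only [TensorProduct.add_tmul, TensorProduct.tmul_add, map_add, ha, hb]
  | dec F x =>
  induction G using decorated_induction with
  | zero => simp
  | add a b ha hb => simp only [TensorProduct.tmul_add, map_add, ha, hb]
  | dec G y =>
    have h : ∀ F (x : ⨂[k]^F.deg V),
        thetaInv k V (decorate k V Forest.deg F rfl x) = thetaInvShape k V F x :=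
      fun F x => toModule_decorate _ F x
    rw [← rCons_decorate_rfl, h F, h G]
    exact (h (.cons F G) _).trans (thetaInvShape_cons F G v x y)

variable {σ : V ⊗[k] V →ₗ[k] V ⊗[k] V} (hσ : IsBraiding σ)

theorem rModel_graft (v : V) (F : RSpace k V) :
    (rModel σ hσ).graft (v ⊗ₜ F) = bPlus k V (v ⊗ₜ F) :=
  ((rModel σ hσ).graft_tmul v F).trans (rCons_rOne v F)

/-- The isomorphism between the models `𝒴(V)` and `ℛ(V)`. -/
def thetaSystem : ThetaSystem (rModel σ hσ) (yModel σ) where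
  act := rAct k V
  dendriform :=
    { one := rAct_one
      cons := fun u A C x => by
        rw [rModel_graft]
        exact rAct_rCons u A C x }
  Θ := theta k V
  Θ_one := theta_yOne
  Θ_vee a v b := by
    rw [rModel_graft]
    exact theta_vee a v b
  Ψ := thetaInv k V
  Ψ_one := thetaInv_rOne
  Ψ_cons := thetaInv_rCons

end Theta

/-! ### Gradings -/

section DegreePart

variable {k V : Type*} [Field k] [AddCommGroup V] [Module k V]
  {S : Type*} [DecidableEq S] {deg : S → ℕ}

theorem decorate_mem {s : S} {n : ℕ} (h : deg s = n) (x : ⨂[k]^n V) :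
    decorate k V deg s h x ∈ degreePart k V deg n :=
  Submodule.mem_iSup_of_mem (⟨s, h⟩ : {s : S // deg s = n}) ⟨x, rfl⟩

theorem degreePart_congr {m n : ℕ} (h : m = n) {x : Decorated k V deg}
    (hx : x ∈ degreePart k V deg m) : x ∈ degreePart k V deg n := h ▸ hx

theorem degreePart_induction {n : ℕ} {P : ∀ x, x ∈ degreePart k V deg n → Prop}
    (zero : P 0 (Submodule.zero_mem _))
    (add : ∀ x y hx hy, P x hx → P y hy → P (x + y) (Submodule.add_mem _ hx hy))
    (dec : ∀ s (h : deg s = n) x, P (decorate k V deg s h x) (decorate_mem h x))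
    {x : Decorated k V deg} (hx : x ∈ degreePart k V deg n) : P x hx := by
  refine Submodule.iSup_induction' _ ?_ zero add hx
  rintro ⟨s, h⟩ _ ⟨x, rfl⟩
  exact dec s h x

theorem degreePart_le {n : ℕ} {Q : Submodule k (Decorated k V deg)}
    (h : ∀ s (h : deg s = n) x, decorate k V deg s h x ∈ Q) : degreePart k V deg n ≤ Q :=
  iSup_le fun s => by
    rintro _ ⟨x, rfl⟩
    exact h s.1 s.2 x

theorem degreePart_isInternal : DirectSum.IsInternal (degreePart k V deg) := by
  let f : Decorated k V deg →ₗ[k] ⨁ n, degreePart k V deg n :=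
    DirectSum.toModule k S _ fun s =>
      DirectSum.lof k ℕ (fun n => degreePart k V deg n) (deg s) ∘ₗ
        (decorate k V deg s rfl).codRestrict _ (decorate_mem rfl)
  have hf : ∀ {s n} (h : deg s = n) (x : ⨂[k]^n V), f (decorate k V deg s h x) =
      DirectSum.lof k ℕ (fun n => degreePart k V deg n) n
        ⟨decorate k V deg s h x, decorate_mem h x⟩ := by
    rintro s _ rfl x
    exact toModule_decorate _ s x
  have h₁ : DirectSum.coeLinearMap (degreePart k V deg) ∘ₗ f = LinearMap.id :=
    decorated_ext fun s x => by
      rw [LinearMap.comp_apply, hf, DirectSum.coeLinearMap_lof]; rfl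
  have h₂ : f ∘ₗ DirectSum.coeLinearMap (degreePart k V deg) = LinearMap.id := by
    refine DirectSum.linearMap_ext k fun n => LinearMap.ext fun x => ?_
    obtain ⟨x, hx⟩ := x
    have key : ∀ y (hy : y ∈ degreePart k V deg n),
        f y = DirectSum.lof k ℕ (fun n => degreePart k V deg n) n ⟨y, hy⟩ := by
      intro y hy
      induction hy using degreePart_induction with
      | zero => rw [map_zero]; exact (map_zero _).symm
      | add a b ha hb ha' hb' => rw [map_add, ha', hb', ← map_add]; rfl
      | dec s h x => exact hf h x
    rw [LinearMap.comp_apply, LinearMap.comp_apply, DirectSum.coeLinearMap_lof]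
    exact key x hx
  exact ⟨fun a b h => by
      have := congrArg f h
      exact (LinearMap.congr_fun h₂ a).symm.trans (this.trans (LinearMap.congr_fun h₂ b)),
    fun x => ⟨f x, LinearMap.congr_fun h₁ x⟩⟩

theorem map_decorate_mem {s t : S} {m n : ℕ} (hs : deg s = m) (ht : deg t = n)
    (z : (⨂[k]^m V) ⊗[k] (⨂[k]^n V)) :
    TensorProduct.map (decorate k V deg s hs) (decorate k V deg t ht) z ∈
      tensorSub (degreePart k V deg m) (degreePart k V deg n) := by
  induction z using TensorProduct.induction_on with
  | zero => rw [map_zero]; exact Submodule.zero_mem _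
  | add a b ha hb => rw [map_add]; exact Submodule.add_mem _ ha hb
  | tmul x y => exact tensorSub_le_iff.1 le_rfl _ (decorate_mem hs x) _ (decorate_mem ht y)

theorem decBraiding_graded (σ : V ⊗[k] V →ₗ[k] V ⊗[k] V) (m n : ℕ) :
    (tensorSub (degreePart k V deg m) (degreePart k V deg n)).map (decBraiding deg σ) ≤
      tensorSub (degreePart k V deg n) (degreePart k V deg m) := by
  rw [Submodule.map_le_iff_le_comap, tensorSub_le_iff]
  intro a ha b hb
  rw [Submodule.mem_comap]
  induction ha using degreePart_induction with
  | zero => simp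
  | add x y _ _ hx hy => rw [TensorProduct.add_tmul, map_add]; exact Submodule.add_mem _ hx hy
  | dec s hs x =>
  induction hb using degreePart_induction with
  | zero => simp
  | add x y _ _ hx hy => rw [TensorProduct.tmul_add, map_add]; exact Submodule.add_mem _ hx hy
  | dec t ht y =>
    have h := (decorate_decBraiding σ hs ht).apply (x ⊗ₜ y)
    rw [TensorProduct.map_tmul] at h
    rw [← h]
    exact map_decorate_mem ht hs _

theorem deltaForm_graded {s₀ : S} (h : deg s₀ = 0) (n : ℕ) (hn : n ≠ 0) :
    degreePart k V deg n ≤ LinearMap.ker (deltaForm (k := k) (V := V) deg s₀ h) :=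
  degreePart_le fun s hs x => deltaForm_decorate h hs
    (fun e => hn (by rw [← hs, e, h])) x

theorem deltaForm_connected {s₀ : S} (h : deg s₀ = 0) (huniq : ∀ s, deg s = 0 → s = s₀)
    {x : Decorated k V deg} (hx : x ∈ degreePart k V deg 0) :
    deltaForm deg s₀ h x • emptyShape s₀ h = x := by
  induction hx using degreePart_induction with
  | zero => simp
  | add x y _ _ hx hy => rw [map_add, add_smul, hx, hy]
  | dec s hs x =>
    obtain rfl := huniq s hs
    obtain ⟨r, rfl⟩ := (TensorPower.algebraMap₀ : k ≃ₗ[k] ⨂[k]^0 V).surjective x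
    have e : decorate k V deg s hs (TensorPower.algebraMap₀ r) = r • emptyShape s h := by
      rw [emptyShape, ← map_smul, ← map_smul, smul_eq_mul, mul_one]
    rw [e, map_smul, deltaForm_emptyShape, smul_eq_mul, mul_one]

end DegreePart

section Graded

variable {k V : Type*} [Field k] [AddCommGroup V] [Module k V]

theorem rMul_mem {m n : ℕ} {F G : RSpace k V} (hF : F ∈ degreePart k V Forest.deg m)
    (hG : G ∈ degreePart k V Forest.deg n) :
    rMul k V (F ⊗ₜ G) ∈ degreePart k V Forest.deg (m + n) := by
  induction hF using degreePart_induction with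
  | zero => simp
  | add x y _ _ hx hy => rw [TensorProduct.add_tmul, map_add]; exact Submodule.add_mem _ hx hy
  | dec s hs x =>
  induction hG using degreePart_induction with
  | zero => simp
  | add x y _ _ hx hy => rw [TensorProduct.tmul_add, map_add]; exact Submodule.add_mem _ hx hy
  | dec t ht y => rw [rMul_decorate]; exact decorate_mem _ _

theorem bPlus_mem {n : ℕ} (v : V) {F : RSpace k V} (hF : F ∈ degreePart k V Forest.deg n) :
    bPlus k V (v ⊗ₜ F) ∈ degreePart k V Forest.deg (n + 1) := by
  induction hF using degreePart_induction with
  | zero => simp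
  | add x y _ _ hx hy => rw [TensorProduct.tmul_add, map_add]; exact Submodule.add_mem _ hx hy
  | dec s hs x => rw [bPlus_decorate]; exact decorate_mem _ _

theorem rOne_mem : rOne k V ∈ degreePart k V Forest.deg 0 := decorate_mem _ _

theorem yOne_mem : yOne k V ∈ degreePart k V btDeg 0 := decorate_mem _ _

theorem actShape_mem {n : ℕ} {z : RSpace k V} (hz : z ∈ degreePart k V Forest.deg n) (F : Forest)
    (x : ⨂[k]^F.deg V) : actShape k V F (x ⊗ₜ z) ∈ degreePart k V Forest.deg (F.deg + n) := by
  induction F with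
  | nil =>
    refine degreePart_congr (Nat.zero_add n).symm ?_
    exact Submodule.smul_mem _ _ hz
  | cons F G _ hG =>
    induction x using forestPower_induction with
    | zero => rw [TensorProduct.zero_tmul, map_zero]; exact Submodule.zero_mem _
    | add a b ha hb => rw [TensorProduct.add_tmul, map_add]; exact Submodule.add_mem _ ha hb
    | cons v x y =>
      rw [actShape_cons, rCons_tmul]
      refine Submodule.sub_mem _ ?_ ?_
      · refine degreePart_congr (m := F.deg + 1 + (G.deg + n)) (by rw [Forest.deg]; omega) ?_
        exact rMul_mem (bPlus_mem v (decorate_mem (s := F) rfl x)) (hG y)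
      · refine degreePart_congr (m := F.deg + (G.deg + n) + 1) (by rw [Forest.deg]; omega) ?_
        exact bPlus_mem v (rMul_mem (decorate_mem (s := F) rfl x) (hG y))

theorem rAct_mem {m n : ℕ} {F G : RSpace k V} (hF : F ∈ degreePart k V Forest.deg m)
    (hG : G ∈ degreePart k V Forest.deg n) :
    rAct k V (F ⊗ₜ G) ∈ degreePart k V Forest.deg (m + n) := by
  induction hF using degreePart_induction with
  | zero => simp
  | add x y _ _ hx hy => rw [TensorProduct.add_tmul, map_add]; exact Submodule.add_mem _ hx hy
  | dec s hs x =>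
    cases hs
    rw [rAct_decorate]
    exact actShape_mem hG s x

theorem theta_mem {n : ℕ} {a : YSpace k V} (ha : a ∈ degreePart k V btDeg n) :
    theta k V a ∈ degreePart k V Forest.deg n := by
  induction ha using degreePart_induction with
  | zero => simp
  | add x y _ _ hx hy => rw [map_add]; exact Submodule.add_mem _ hx hy
  | dec Y hY x =>
    cases hY
    rw [theta, toModule_decorate]
    induction Y with
    | nil => exact Submodule.smul_mem _ _ rOne_mem
    | node u l r hl hr =>
      induction x using treePower_induction with
      | zero => rw [map_zero]; exact Submodule.zero_mem _
      | add a b ha hb => rw [map_add]; exact Submodule.add_mem _ ha hb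
      | node x v y =>
        rw [thetaShape]
        simp only [LinearMap.comp_apply, LinearEquiv.coe_coe, LinearEquiv.symm_apply_apply,
          TensorProduct.map_tmul, LinearMap.lTensor_tmul]
        exact rAct_mem (hl x) (bPlus_mem v (hr y))

theorem vee_mem {m n : ℕ} {a b : YSpace k V} (ha : a ∈ degreePart k V btDeg m) (v : V)
    (hb : b ∈ degreePart k V btDeg n) :
    vee k V (a ⊗ₜ (v ⊗ₜ b)) ∈ degreePart k V btDeg (m + (n + 1)) := by
  induction ha using degreePart_induction with
  | zero => simp
  | add x y _ _ hx hy => rw [TensorProduct.add_tmul, map_add]; exact Submodule.add_mem _ hx hy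
  | dec s hs x =>
  induction hb using degreePart_induction with
  | zero => simp
  | add x y _ _ hx hy =>
    rw [TensorProduct.tmul_add, TensorProduct.tmul_add, map_add]; exact Submodule.add_mem _ hx hy
  | dec t ht y => rw [vee_decorate]; exact decorate_mem _ _

theorem yMul_decorate_mem (Y Y' : BT) (x : ⨂[k]^(btDeg Y) V) (y : ⨂[k]^(btDeg Y') V) :
    yMul k V (decorate k V btDeg Y rfl x ⊗ₜ decorate k V btDeg Y' rfl y) ∈
      degreePart k V btDeg (btDeg Y + btDeg Y') := by
  induction Y generalizing Y' with
  | nil =>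
    obtain ⟨r, rfl⟩ := (TensorPower.algebraMap₀ : k ≃ₗ[k] ⨂[k]^0 V).surjective x
    have e : decorate k V btDeg .nil btDeg_nil (TensorPower.algebraMap₀ r) = r • yOne k V := by
      rw [yOne_eq, emptyShape, ← map_smul, ← map_smul, smul_eq_mul, mul_one]
    refine degreePart_congr (Nat.zero_add (btDeg Y')).symm ?_
    refine Set.mem_of_eq_of_mem (congrArg (fun z => yMul k V (z ⊗ₜ _)) e) ?_
    rw [← TensorProduct.smul_tmul', map_smul, yOne_yMul]
    exact Submodule.smul_mem _ _ (decorate_mem rfl y)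
  | node u l r _ hr =>
  induction x using treePower_induction with
  | zero => rw [map_zero, TensorProduct.zero_tmul, map_zero]; exact Submodule.zero_mem _
  | add a b ha hb =>
    rw [map_add, TensorProduct.add_tmul, map_add]; exact Submodule.add_mem _ ha hb
  | node x₁ v x₂ =>
  induction Y' with
  | nil =>
    obtain ⟨t, rfl⟩ := (TensorPower.algebraMap₀ : k ≃ₗ[k] ⨂[k]^0 V).surjective y
    have e : decorate k V btDeg .nil btDeg_nil (TensorPower.algebraMap₀ t) = t • yOne k V := by
      rw [yOne_eq, emptyShape, ← map_smul, ← map_smul, smul_eq_mul, mul_one]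
    refine degreePart_congr (m := btDeg (.node u l r)) rfl ?_
    refine Set.mem_of_eq_of_mem (congrArg (fun z => yMul k V (_ ⊗ₜ z)) e) ?_
    rw [TensorProduct.tmul_smul, map_smul, yMul_yOne]
    exact Submodule.smul_mem _ _ (decorate_mem rfl _)
  | node u' l' r' hl' _ =>
  induction y using treePower_induction with
  | zero => rw [map_zero, TensorProduct.tmul_zero, map_zero]; exact Submodule.zero_mem _
  | add a b ha hb =>
    rw [map_add, TensorProduct.tmul_add, map_add]; exact Submodule.add_mem _ ha hb
  | node y₁ w y₂ =>
    have h₁ := vee_mem (decorate_mem rfl x₁) v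
      (hr (.node u' l' r') x₂ (nodeEquiv k V u' l' r' (y₁ ⊗ₜ (w ⊗ₜ y₂))))
    have h₂ := vee_mem (hl' y₁) w (decorate_mem rfl y₂)
    rw [decorate_nodeEquiv] at h₁ h₂ ⊢
    rw [decorate_nodeEquiv, vee_yMul_vee]
    refine Submodule.add_mem _ ?_ ?_
    · exact degreePart_congr (by simp only [btDeg]; omega) h₁
    · exact degreePart_congr (by simp only [btDeg]; omega) h₂

theorem yMul_mem {m n : ℕ} {a b : YSpace k V} (ha : a ∈ degreePart k V btDeg m)
    (hb : b ∈ degreePart k V btDeg n) :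
    yMul k V (a ⊗ₜ b) ∈ degreePart k V btDeg (m + n) := by
  induction ha using degreePart_induction with
  | zero => simp
  | add x y _ _ hx hy => rw [TensorProduct.add_tmul, map_add]; exact Submodule.add_mem _ hx hy
  | dec s hs x =>
  induction hb using degreePart_induction with
  | zero => simp
  | add x y _ _ hx hy => rw [TensorProduct.tmul_add, map_add]; exact Submodule.add_mem _ hx hy
  | dec t ht y =>
    cases hs
    cases ht
    exact yMul_decorate_mem s t x y

theorem thetaInvShape_mem (F : Forest) (x : ⨂[k]^F.deg V) :
    thetaInvShape k V F x ∈ degreePart k V btDeg F.deg := by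
  induction F with
  | nil => exact Submodule.smul_mem _ _ yOne_mem
  | cons F G hF hG =>
    induction x using forestPower_induction with
    | zero => rw [map_zero]; exact Submodule.zero_mem _
    | add a b ha hb => rw [map_add]; exact Submodule.add_mem _ ha hb
    | cons v x y =>
      rw [thetaInvShape_cons, Forest.deg, ← Nat.zero_add (F.deg + 1)]
      exact yMul_mem (vee_mem yOne_mem v (hF x)) (hG y)

theorem thetaInv_mem {n : ℕ} {x : RSpace k V} (hx : x ∈ degreePart k V Forest.deg n) :
    thetaInv k V x ∈ degreePart k V btDeg n := by
  induction hx using degreePart_induction with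
  | zero => simp
  | add x y _ _ hx hy => rw [map_add]; exact Submodule.add_mem _ hx hy
  | dec F hF x =>
    cases hF
    rw [thetaInv, toModule_decorate]
    exact thetaInvShape_mem F x

theorem Forest.eq_nil_of_deg : ∀ F : Forest, F.deg = 0 → F = nil
  | nil, _ => rfl
  | cons F G, h => by rw [deg] at h; omega

variable {σ : V ⊗[k] V →ₗ[k] V ⊗[k] V} (hσ : IsBraiding σ)
include hσ

theorem recComul_mem (F : Forest) (x : ⨂[k]^F.deg V) :
    recComul σ F x ∈ ⨆ p ∈ Finset.HasAntidiagonal.antidiagonal F.deg,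
      tensorSub (degreePart k V Forest.deg p.1) (degreePart k V Forest.deg p.2) := by
  rw [← sum_subTerm hσ]
  refine Submodule.sum_mem _ fun c _ => ?_
  refine Submodule.mem_iSup_of_mem (c.part.deg, c.rest.deg) (Submodule.mem_iSup_of_mem
    (Finset.HasAntidiagonal.mem_antidiagonal.2 c.part_add_rest) ?_)
  exact map_decorate_mem rfl rfl _

theorem rHopf_isConnectedGraded : (rHopf σ).IsConnectedGraded where
  toIsBraidedBialgebra := recHopf_eq hσ ▸ (rModel σ hσ).isBraidedBialgebra
  isInternal := degreePart_isInternal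
  mul_graded m n := by
    rw [Submodule.map_le_iff_le_comap, tensorSub_le_iff]
    exact fun a ha b hb => rMul_mem ha hb
  one_graded := rOne_mem
  comul_graded n := by
    rw [Submodule.map_le_iff_le_comap]
    refine degreePart_le fun F hF x => ?_
    subst hF
    rw [Submodule.mem_comap, ← recHopf_eq hσ]
    exact Set.mem_of_eq_of_mem (toModule_decorate _ F x) (recComul_mem hσ F x)
  counit_graded := deltaForm_graded Forest.deg_nil
  braiding_graded := decBraiding_graded σ
  connected _ := deltaForm_connected Forest.deg_nil Forest.eq_nil_of_deg

theorem theta_isDataEquiv : IsDataEquiv (yHopf σ) (rHopf σ) (thetaSystem hσ).equiv :=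
  recHopf_eq hσ ▸ (thetaSystem hσ).isDataEquiv (fun _ _ h => theta_mem h)
    fun _ _ h => thetaInv_mem h

theorem yHopf_isConnectedGraded : (yHopf σ).IsConnectedGraded :=
  (theta_isDataEquiv hσ).isConnectedGraded (rHopf_isConnectedGraded hσ) degreePart_isInternal

theorem theta_isTheta : IsTheta σ (theta k V) :=
  ⟨((theta_isDataEquiv hσ).isGradedBraidedHopfIso
    (rHopf_isConnectedGraded hσ).toIsBraidedBialgebra).toIsAlgHom, fun v Y =>
      ((thetaSystem hσ).Θ_one_vee v Y).trans (rModel_graft hσ v _)⟩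

theorem IsTheta.eq_theta {Θ : YSpace k V →ₗ[k] RSpace k V} (h : IsTheta σ Θ) : Θ = theta k V :=
  (thetaSystem hσ).eq_Θ h.1.map_one (fun a b => LinearMap.congr_fun h.1.map_mul (a ⊗ₜ b))
    fun v Y => (h.2 v Y).trans (rModel_graft hσ v _).symm

end Graded

end

end BraidedTrees

theorem mainTheorem2 {k V : Type*} [Field k] [CharZero k] [AddCommGroup V] [Module k V]
    (σ : V ⊗[k] V →ₗ[k] V ⊗[k] V) (hσ : BraidedTrees.IsBraiding σ) :
    BraidedTrees.IsGradedBraidedHopf (BraidedTrees.yHopf σ) ∧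
    BraidedTrees.IsGradedBraidedHopf (BraidedTrees.rHopf σ) ∧
    ∃ Θ : BraidedTrees.YSpace k V →ₗ[k] BraidedTrees.RSpace k V,
      BraidedTrees.IsTheta σ Θ ∧
      (∀ Θ', BraidedTrees.IsTheta σ Θ' → Θ' = Θ) ∧
      BraidedTrees.IsGradedBraidedHopfIso (BraidedTrees.yHopf σ) (BraidedTrees.rHopf σ) Θ :=
  have hR := BraidedTrees.rHopf_isConnectedGraded hσ
  ⟨(BraidedTrees.yHopf_isConnectedGraded hσ).isGradedBraidedHopf, hR.isGradedBraidedHopf,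
    BraidedTrees.theta k V, BraidedTrees.theta_isTheta hσ, fun _ h => h.eq_theta hσ,
    (BraidedTrees.theta_isDataEquiv hσ).isGradedBraidedHopfIso hR.toIsBraidedBialgebra⟩
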